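/- All commutative differential graded algebras (CDGAs) are over $\mathbb{Q}$, graded by the non-negative integers, with differential of degree $+1$. A CDGA $A$ is connected if the unit gives an isomorphism $\mathbb{Q}\cong A^0$, $1$-connected if moreover $A^1=0$, and of finite type if each $A^i$ is finite-dimensional. A Poincaré duality CDGA in dimension $n$ is a connected CDGA $P$ of finite type with $P^{>n}=0$ admitting a linear form $\epsilon\colon P^n\to\mathbb{Q}$ with $\epsilon(dP^{n-1})=0$ such that $P^k\to\mathrm{Hom}(P^{n-k},\mathbb{Q})$, $y\mapsto(x\mapsto\epsilon(yx))$, is an isomorphism for $0\le k\le n$; when $d=0$ it is called a Poincaré duality algebra in dimension $n$. Two CDGA morphisms are equivalent if they are joined by a finite zigzag of commutative squares of CDGA morphisms whose vertical maps are quasi-isomorphisms. Two CDGA morphisms with the same target $B$ are equivalent over $B$ if such a zigzag exists in which all targets are $B$ and all vertical maps between targets are $\mathrm{id}_B$. **Proposition.** Let $n\ge 0$ be an integer and let $\psi\colon A\to B$ be a morphism of CDGAs such that $H(A)$ is a $1$-connected Poincaré duality algebra in dimension $n$, $H(B)$ is $1$-connected and of finite type, $H^{i}(B)=0$ for all $i\ge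 \frac n2-1$, and $H^2(\psi)\colon H^2(A)\to H^2(B)$ is surjective. Then $\psi$ is equivalent to some surjective CDGA morphism $\varphi\colon P\twoheadrightarrow Q$ such that $P$ is a $1$-connected Poincaré duality CDGA in dimension $n$, $Q$ is $1$-connected, and $Q^{i}=0$ for all $i\ge\frac n2-1$. Moreover, if $B$ itself is $1$-connected, of finite type, and satisfies $B^{i}=0$ for all $i\ge\frac n2-1$, then one can take $Q=B$: there are a $1$-connected Poincaré duality CDGA $P$ in dimension $n$ and a surjective CDGA morphism $\varphi\colon P\twoheadrightarrow B$ which is equivalent to $\psi$, and even equivalent to $\psi$ over $B$. -/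

import Mathlib

universe u

/-- A commutative differential graded algebra over `ℚ`, graded by the natural numbers, with a
differential of degree `+1`.  The algebra is the (internal) direct sum of the `gr i`. -/
structure CDGA where
  carrier : Type u
  [ring : Ring carrier]
  [algebra : Algebra ℚ carrier]
  gr : ℕ → Submodule ℚ carrier
  [graded : GradedAlgebra gr]
  d : carrier →ₗ[ℚ] carrier
  d_mem : ∀ (i : ℕ) (x : carrier), x ∈ gr i → d x ∈ gr (i + 1)
  d_d : ∀ x : carrier, d (d x) = 0
  leibniz : ∀ (i : ℕ) (x y : carrier), x ∈ gr i →
    d (x * y) = d x * y + ((-1 : ℚ) ^ i) • (x * d y)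
  gr_comm : ∀ (i j : ℕ) (x y : carrier), x ∈ gr i → y ∈ gr j →
    x * y = ((-1 : ℚ) ^ (i * j)) • (y * x)

namespace CDGA

attribute [instance] CDGA.ring CDGA.algebra CDGA.graded

/-- A morphism of CDGAs: an algebra map of degree `0` commuting with the differentials. -/
@[ext]
structure Hom (A B : CDGA.{u}) where
  toAlgHom : A.carrier →ₐ[ℚ] B.carrier
  map_gr : ∀ (i : ℕ) (x : A.carrier), x ∈ A.gr i → toAlgHom x ∈ B.gr i
  map_d : ∀ x : A.carrier, toAlgHom (A.d x) = B.d (toAlgHom x)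

/-- Composition of morphisms, `g ∘ f`. -/
def Hom.comp {A B C : CDGA.{u}} (g : Hom B C) (f : Hom A B) : Hom A C where
  toAlgHom := g.toAlgHom.comp f.toAlgHom
  map_gr i x hx := g.map_gr i _ (f.map_gr i x hx)
  map_d x := by simp [f.map_d, g.map_d]

/-! ### Cohomology, as a graded algebra (a CDGA with zero differential) -/

section Cohomology

variable (A : CDGA.{u})

theorem d_one : A.d 1 = 0 := by
  have h := A.leibniz 0 1 1 SetLike.GradedOne.one_mem
  simpa using h

theorem d_proj_aux (j : ℕ) (y : A.carrier) (hy : y ∈ A.gr j) (i : ℕ) :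
    A.d (GradedRing.proj A.gr i y) = GradedRing.proj A.gr (i + 1) (A.d y) := by
  simp only [GradedRing.proj_apply]
  by_cases h : j = i
  · subst h
    rw [DirectSum.decompose_of_mem_same _ hy, DirectSum.decompose_of_mem_same _ (A.d_mem _ _ hy)]
  · rw [DirectSum.decompose_of_mem_ne _ hy h,
      DirectSum.decompose_of_mem_ne _ (A.d_mem _ _ hy) (by omega), map_zero]

theorem d_proj (i : ℕ) (x : A.carrier) :
    A.d (GradedRing.proj A.gr i x) = GradedRing.proj A.gr (i + 1) (A.d x) := by
  classical
  rw [← DirectSum.sum_support_decompose A.gr x]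
  simp only [map_sum]
  refine Finset.sum_congr rfl fun j _ => ?_
  exact A.d_proj_aux j _ (SetLike.coe_mem _) i

theorem proj_zero_d (x : A.carrier) : GradedRing.proj A.gr 0 (A.d x) = 0 := by
  classical
  rw [← DirectSum.sum_support_decompose A.gr x]
  simp only [map_sum]
  refine Finset.sum_eq_zero fun j _ => ?_
  rw [GradedRing.proj_apply]
  exact DirectSum.decompose_of_mem_ne _ (A.d_mem _ _ (SetLike.coe_mem _)) (by omega)

theorem mem_proj (i : ℕ) (x : A.carrier) : GradedRing.proj A.gr i x ∈ A.gr i := by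
  rw [GradedRing.proj_apply]; exact SetLike.coe_mem _

theorem d_mul_cocycle (x y : A.carrier) (hy : A.d y = 0) : A.d (x * y) = A.d x * y := by
  classical
  rw [← DirectSum.sum_support_decompose A.gr x]
  simp only [map_sum, Finset.sum_mul]
  refine Finset.sum_congr rfl fun j _ => ?_
  rw [A.leibniz j _ _ (SetLike.coe_mem _), hy]
  simp

/-- The algebra of cocycles, `ker d`. -/
def cocycles : Subalgebra ℚ A.carrier where
  carrier := {x | A.d x = 0}
  mul_mem' {x y} hx hy := by
    have h := A.d_mul_cocycle x y hy
    rw [show A.d x = 0 from hx, zero_mul] at h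
    exact h
  add_mem' {x y} hx hy := by
    simp only [Set.mem_ofPred_eq] at *
    rw [map_add, hx, hy, add_zero]
  algebraMap_mem' r := by
    simp only [Set.mem_ofPred_eq]
    rw [Algebra.algebraMap_eq_smul_one, map_smul, A.d_one, smul_zero]

theorem proj_mem_cocycles (i : ℕ) (x : A.carrier) (hx : A.d x = 0) :
    GradedRing.proj A.gr i x ∈ A.cocycles := by
  change A.d _ = 0
  rw [A.d_proj, hx, map_zero]

theorem cocycle_mul_d (x w : A.carrier) (hx : A.d x = 0) : ∃ v, A.d v = x * A.d w := by
  classical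
  refine ⟨∑ i ∈ (DirectSum.decompose A.gr x).support,
    ((-1 : ℚ) ^ i) • (((DirectSum.decompose A.gr x) i : A.carrier) * w), ?_⟩
  conv_rhs => rw [← DirectSum.sum_support_decompose A.gr x]
  simp only [map_sum, Finset.sum_mul, map_smul]
  refine Finset.sum_congr rfl fun i _ => ?_
  have h0 : A.d ((DirectSum.decompose A.gr x) i : A.carrier) = 0 := by
    have h := A.proj_mem_cocycles i x hx
    rw [GradedRing.proj_apply] at h
    exact h
  rw [A.leibniz i _ _ (SetLike.coe_mem _), h0, zero_mul, zero_add, smul_smul, ← mul_pow]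
  simp

/-- The two-sided ideal of coboundaries, `im d`, in the algebra of cocycles. -/
def coboundaries : Ideal A.cocycles where
  carrier := {z | ∃ w, A.d w = (z : A.carrier)}
  add_mem' := by
    rintro x y ⟨v, hv⟩ ⟨w, hw⟩
    exact ⟨v + w, by rw [map_add, hv, hw]; rfl⟩
  zero_mem' := ⟨0, by simp⟩
  smul_mem' := by
    rintro c x ⟨w, hw⟩
    obtain ⟨v, hv⟩ := A.cocycle_mul_d c w c.2
    exact ⟨v, by rw [hv, hw]; rfl⟩

instance : A.coboundaries.IsTwoSided where
  mul_mem_of_left := by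
    rintro a b ⟨w, hw⟩
    exact ⟨w * b, by rw [A.d_mul_cocycle _ _ b.2, hw]; rfl⟩

/-- The cocycles of degree `i`. -/
def cocyclesGr (i : ℕ) : Submodule ℚ A.cocycles :=
  (A.gr i).comap A.cocycles.val.toLinearMap

/-- The quotient algebra `ker d / im d`. -/
def CohomologyRing : Type u := A.cocycles ⧸ A.coboundaries

noncomputable instance : Ring A.CohomologyRing :=
  inferInstanceAs (Ring (A.cocycles ⧸ A.coboundaries))

noncomputable instance : Algebra ℚ A.CohomologyRing :=
  inferInstanceAs (Algebra ℚ (A.cocycles ⧸ A.coboundaries))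

/-- The class of a cocycle. -/
noncomputable def cohomologyMk : A.cocycles →ₐ[ℚ] A.CohomologyRing :=
  Ideal.Quotient.mkₐ ℚ A.coboundaries

/-- The classes of the cocycles of degree `i`. -/
noncomputable def cohomologyGr (i : ℕ) : Submodule ℚ A.CohomologyRing :=
  (A.cocyclesGr i).map A.cohomologyMk.toLinearMap

theorem cohomologyMk_eq_zero (z : A.cocycles) :
    A.cohomologyMk z = 0 ↔ ∃ w, A.d w = (z : A.carrier) :=
  Ideal.Quotient.eq_zero_iff_mem

theorem mk_mem_cohomologyGr (i : ℕ) (z : A.cocycles) (hz : (z : A.carrier) ∈ A.gr i) :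
    A.cohomologyMk z ∈ A.cohomologyGr i :=
  ⟨z, hz, rfl⟩

theorem cohomologyGr_isInternal : DirectSum.IsInternal A.cohomologyGr := by
  classical
  constructor
  · rw [injective_iff_map_eq_zero]
    intro f hf
    have hc : ∀ i, ∃ z : A.cocycles, (z : A.carrier) ∈ A.gr i ∧
        A.cohomologyMk z = (f i : A.CohomologyRing) := fun i => (f i).2
    choose z hz hzf using hc
    rw [DirectSum.coeAddMonoidHom_eq_dfinsuppSum, DFinsupp.sum] at hf
    have hf' : A.cohomologyMk (∑ i ∈ DFinsupp.support f, z i) = 0 := by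
      rw [map_sum]
      refine Eq.trans (Finset.sum_congr rfl fun i _ => ?_) hf
      exact hzf i
    obtain ⟨w, hw⟩ := (A.cohomologyMk_eq_zero _).1 hf'
    ext i
    by_cases hi : i ∈ DFinsupp.support f
    · rw [← hzf i]
      change A.cohomologyMk (z i) = 0
      rw [A.cohomologyMk_eq_zero]
      have key : GradedRing.proj A.gr i (A.d w) = z i := by
        rw [hw, AddSubmonoidClass.coe_finsetSum, map_sum, Finset.sum_eq_single i]
        · rw [GradedRing.proj_apply, DirectSum.decompose_of_mem_same _ (hz i)]
        · intro j _ hj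
          rw [GradedRing.proj_apply, DirectSum.decompose_of_mem_ne _ (hz j) hj]
        · intro h; exact absurd hi h
      rcases i with _ | i
      · exact ⟨0, by rw [← key, A.proj_zero_d, map_zero]⟩
      · exact ⟨GradedRing.proj A.gr i w, by rw [A.d_proj, key]⟩
    · rw [DFinsupp.notMem_support_iff] at hi
      rw [hi, DirectSum.zero_apply]
  · intro x
    obtain ⟨z, rfl⟩ := Ideal.Quotient.mk_surjective x
    let c : ℕ → A.cocycles := fun i =>
      ⟨GradedRing.proj A.gr i z, A.proj_mem_cocycles i z z.2⟩
    refine ⟨∑ i ∈ (DirectSum.decompose A.gr (z : A.carrier)).support,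
      DirectSum.of (fun i => A.cohomologyGr i) i
        ⟨A.cohomologyMk (c i), A.mk_mem_cohomologyGr i (c i) (A.mem_proj i z)⟩, ?_⟩
    rw [map_sum]
    simp only [DirectSum.coeAddMonoidHom_of]
    rw [← map_sum]
    change A.cohomologyMk _ = A.cohomologyMk z
    congr 1
    apply Subtype.ext
    rw [AddSubmonoidClass.coe_finsetSum]
    exact DirectSum.sum_support_decompose A.gr (z : A.carrier)

noncomputable instance : GradedAlgebra A.cohomologyGr :=
  { A.cohomologyGr_isInternal.chooseDecomposition with
    one_mem := A.mk_mem_cohomologyGr 0 1 SetLike.GradedOne.one_mem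
    mul_mem := by
      rintro i j _ _ ⟨x, hx, rfl⟩ ⟨y, hy, rfl⟩
      exact ⟨x * y, SetLike.GradedMul.mul_mem (A := A.gr) hx hy, map_mul A.cohomologyMk x y⟩ }

/-- The cohomology algebra `H(A) = ker d / im d`, as a CDGA with zero differential. -/
noncomputable def cohomology : CDGA.{u} where
  carrier := A.CohomologyRing
  gr := A.cohomologyGr
  d := 0
  d_mem i x _ := zero_mem _
  d_d _ := rfl
  leibniz i x y _ := by simp
  gr_comm := by
    rintro i j _ _ ⟨x, hx, rfl⟩ ⟨y, hy, rfl⟩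
    have h : x * y = ((-1 : ℚ) ^ (i * j)) • (y * x) :=
      Subtype.ext (A.gr_comm i j x y hx hy)
    change A.cohomologyMk x * A.cohomologyMk y = _ • (A.cohomologyMk y * A.cohomologyMk x)
    rw [← map_mul, ← map_mul, ← map_smul, h]

end Cohomology

/-- The map induced by a morphism on cocycles. -/
def Hom.cocyclesMap {A B : CDGA.{u}} (f : Hom A B) : A.cocycles →ₐ[ℚ] B.cocycles :=
  (f.toAlgHom.comp A.cocycles.val).codRestrict B.cocycles fun z => by
    change B.d (f.toAlgHom z) = 0
    rw [← f.map_d, show A.d (z : A.carrier) = 0 from z.2, map_zero]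

/-- The morphism `H(f) : H(A) → H(B)` induced by `f : A → B`. -/
noncomputable def Hom.cohomologyMap {A B : CDGA.{u}} (f : Hom A B) :
    Hom A.cohomology B.cohomology where
  toAlgHom := Ideal.Quotient.liftₐ A.coboundaries (B.cohomologyMk.comp f.cocyclesMap) <| by
    rintro z ⟨w, hw⟩
    refine (B.cohomologyMk_eq_zero _).2 ⟨f.toAlgHom w, ?_⟩
    rw [← f.map_d, hw]
    rfl
  map_gr := by
    rintro i _ ⟨z, hz, rfl⟩
    exact B.mk_mem_cohomologyGr i (f.cocyclesMap z) (f.map_gr i z hz)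
  map_d _ := map_zero _

/-! ### Quasi-isomorphisms and equivalence of morphisms -/

/-- A quasi-isomorphism is a morphism inducing an isomorphism in cohomology. -/
def Hom.IsQuasiIso {A B : CDGA.{u}} (f : Hom A B) : Prop :=
  Function.Bijective f.cohomologyMap.toAlgHom

/-- Surjectivity of a morphism of CDGAs. -/
def Hom.Surjective {A B : CDGA.{u}} (f : Hom A B) : Prop :=
  Function.Surjective f.toAlgHom

/-- A morphism of CDGAs together with its source and target. -/
structure Arrow where
  src : CDGA.{u}
  tgt : CDGA.{u}
  hom : Hom src tgt

/-- There is a commutative square from the arrow `f` to the arrow `g` whose two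
vertical morphisms are quasi-isomorphisms. -/
def Arrow.Step (f g : Arrow.{u}) : Prop :=
  ∃ (α : Hom f.src g.src) (β : Hom f.tgt g.tgt),
    α.IsQuasiIso ∧ β.IsQuasiIso ∧ β.comp f.hom = g.hom.comp α

/-- Two morphisms of CDGAs are (weakly) equivalent if they are joined by a finite zigzag of
commutative squares whose vertical morphisms are quasi-isomorphisms. -/
def Hom.Equivalent {A B A' B' : CDGA.{u}} (f : Hom A B) (g : Hom A' B') : Prop :=
  Relation.EqvGen Arrow.Step ⟨A, B, f⟩ ⟨A', B', g⟩

/-- A CDGA with a morphism to the fixed CDGA `B`. -/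
structure Over (B : CDGA.{u}) where
  src : CDGA.{u}
  hom : Hom src B

/-- There is a quasi-isomorphism over `B` from the source of `f` to the source of `g`. -/
def Over.Step {B : CDGA.{u}} (f g : Over B) : Prop :=
  ∃ α : Hom f.src g.src, α.IsQuasiIso ∧ g.hom.comp α = f.hom

/-- Two morphisms with the same target `B` are equivalent over `B` if they are joined by a finite
zigzag of commutative triangles of quasi-isomorphisms over `B` (so the zigzag on the targets is
constantly the identity of `B`). -/
def Hom.EquivalentOver {A A' B : CDGA.{u}} (f : Hom A B) (g : Hom A' B) : Prop :=
  Relation.EqvGen Over.Step (⟨A, f⟩ : Over B) ⟨A', g⟩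

/-! ### Connectedness, finiteness and Poincaré duality -/

/-- `A` is connected: the unit map is an isomorphism `ℚ ≅ A⁰`. -/
def IsConnected (A : CDGA.{u}) : Prop :=
  ∀ x ∈ A.gr 0, ∃! r : ℚ, algebraMap ℚ A.carrier r = x

/-- `A` is `1`-connected: it is connected and `A¹ = 0`. -/
def IsOneConnected (A : CDGA.{u}) : Prop :=
  A.IsConnected ∧ A.gr 1 = ⊥

/-- `A` is of finite type: each `Aⁱ` is finite-dimensional. -/
def IsFiniteType (A : CDGA.{u}) : Prop :=
  ∀ i, FiniteDimensional ℚ (A.gr i)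

/-- `A^{≥ r} = 0`, for a rational number `r`. -/
def VanishesFrom (A : CDGA.{u}) (r : ℚ) : Prop :=
  ∀ i : ℕ, r ≤ i → A.gr i = ⊥

/-- For a linear form `ε` on `A`, the linear map `A^p → Hom(A^q, ℚ)`, `y ↦ (x ↦ ε (y * x))`. -/
def dualityMap (A : CDGA.{u}) (ε : A.carrier →ₗ[ℚ] ℚ) (p q : ℕ) :
    A.gr p →ₗ[ℚ] Module.Dual ℚ (A.gr q) :=
  (((LinearMap.mul ℚ A.carrier).compr₂ ε).domRestrict₁₂ (A.gr p) (A.gr q))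

/-- `A` is a Poincaré duality CDGA in dimension `n`: it is connected, of finite type, and there is
an orientation, that is a linear form `ε` of degree `-n` (zero outside `Aⁿ`) with `ε ∘ d = 0`,
such that `y ↦ ε (y * ·)` is an isomorphism from `A` to its `n`-fold shifted dual:
`A^p ≅ Hom(A^{n-p}, ℚ)` for `p ≤ n`, and `A^p = 0` for `p > n`. When `d = 0` this says that
the graded algebra `A` is a Poincaré duality algebra. -/
def IsPoincareDuality (A : CDGA.{u}) (n : ℕ) : Prop :=
  A.IsConnected ∧ A.IsFiniteType ∧
    ∃ ε : A.carrier →ₗ[ℚ] ℚ,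
      (∀ i, i ≠ n → ∀ x ∈ A.gr i, ε x = 0) ∧
      (∀ x, ε (A.d x) = 0) ∧
      (∀ p q, p + q = n → Function.Bijective (A.dualityMap ε p q)) ∧
      (∀ p, n < p → A.gr p = ⊥)

end CDGA

/-! Reduction to a surjection. Since H⁰(B) ≠ 0, the vanishing hypothesis forces n ≥ 3. The mapping
path object A ×_B B[t, dt] replaces ψ, over B, by a surjection X → B
(`exists_surjective_factorization`). If B is not already small, a 1-connected finite-type model B' →
B is chosen (`exists_finiteType_sub`), the surjection is pulled back to B', and B' is divided by an
acyclic ideal containing everything in degrees ≥ n/2 - 1 (`exists_truncation`). What remains is a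
surjection X → Q with Q small, treated in `exists_poincareDuality_of_surjective`: X contains a
quasi-isomorphic 1-connected finite-type sub-CDGA F that still surjects onto Q, and F is replaced by
a Poincaré duality CDGA P without losing the map to Q.

The duality model (`exists_poincareDuality_model`). Let A be 1-connected of finite type, and let ε
be a form of degree -n with ε ∘ d = 0 inducing duality on H(A). A contraction h of A defines a
differential ideal J (`lagr`) which is zero below degree ⌊n/2⌋, is stable under h, and carries
exactly the cohomology of degree ≥ n/2. Put E = A ⊕ (A/J)^*[-n], a square-zero extension, with the
form (a, f) ↦ ε(a) + f(1). Its radical, the orphans, consists of the pairs (a, -ε(a ·)) with a ∈ J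
and ε(aJ) = 0; the quotient P of E by the radical has a nondegenerate pairing.

Since H(A/J) is the part of H(A) of degree < n/2, its shifted dual adds to H(A) a second copy of the
part of degree > n/2, and the orphans cancel it. Concretely, A → P is injective in cohomology by
Poincaré duality of H(A) (`exists_primitive_of_mk_exact`) and surjective by
`IsOrientation.exists_lagr_correction`. A morphism A → Q with Q zero from degree n/2 - 1 kills J for
degree reasons, so it extends to P by ignoring the dual summand. -/

/-! ### Graded vector spaces -/

section Graded

variable {V W : Type*} [AddCommGroup V] [Module ℚ V] [AddCommGroup W] [Module ℚ W]
variable (gr : ℕ → Submodule ℚ V) [DirectSum.Decomposition gr]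

/-- The linear map which is `g i` on the component of degree `i`. -/
noncomputable def gsum (g : ℕ → V →ₗ[ℚ] W) : V →ₗ[ℚ] W :=
  DirectSum.toModule ℚ ℕ W (fun i => g i ∘ₗ (gr i).subtype) ∘ₗ
    (DirectSum.decomposeLinearEquiv gr).toLinearMap

theorem gsum_of_mem (g : ℕ → V →ₗ[ℚ] W) {i : ℕ} {x : V} (hx : x ∈ gr i) :
    gsum gr g x = g i x := by
  simp only [gsum, LinearMap.comp_apply, LinearEquiv.coe_coe, DirectSum.decomposeLinearEquiv_apply]
  rw [DirectSum.decompose_of_mem gr hx]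
  exact DirectSum.toModule_lof (R := ℚ) (M := fun i => gr i)
    (φ := fun i => g i ∘ₗ (gr i).subtype) i ⟨x, hx⟩

/-- The projection to the component of degree `i`. -/
noncomputable def gpr (i : ℕ) : V →ₗ[ℚ] V :=
  (gr i).subtype ∘ₗ DirectSum.component ℚ ℕ _ i ∘ₗ (DirectSum.decomposeLinearEquiv gr).toLinearMap

theorem gpr_apply (i : ℕ) (x : V) : gpr gr i x = DirectSum.decompose gr x i := rfl

theorem gpr_mem (i : ℕ) (x : V) : gpr gr i x ∈ gr i := SetLike.coe_mem _

theorem gpr_of_mem {i : ℕ} {x : V} (hx : x ∈ gr i) : gpr gr i x = x := by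
  rw [gpr_apply, DirectSum.decompose_of_mem_same _ hx]

theorem gpr_of_mem_ne {i j : ℕ} {x : V} (hx : x ∈ gr i) (h : i ≠ j) : gpr gr j x = 0 := by
  rw [gpr_apply, DirectSum.decompose_of_mem_ne _ hx h]

theorem sum_gpr (x : V) : ∃ s : Finset ℕ, x = ∑ i ∈ s, gpr gr i x := by
  classical
  exact ⟨_, (DirectSum.sum_support_decompose gr x).symm⟩

theorem graded_induction {p : V → Prop} (h0 : p 0) (hadd : ∀ x y, p x → p y → p (x + y))
    (hgr : ∀ i, ∀ x ∈ gr i, p x) (x : V) : p x := by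
  classical
  obtain ⟨s, hs⟩ := sum_gpr gr x
  rw [hs]
  exact Finset.sum_induction _ p hadd h0 fun i _ => hgr i _ (gpr_mem gr i x)

theorem graded_linearMap_ext {f g : V →ₗ[ℚ] W} (h : ∀ i, ∀ x ∈ gr i, f x = g x) : f = g := by
  ext x
  refine graded_induction gr (p := fun x => f x = g x) (by simp) ?_ h x
  intro x y hx hy
  rw [map_add, map_add, hx, hy]

end Graded

/-- A family of projections yields a direct sum decomposition. -/
theorem isInternal_of_proj {V : Type*} [AddCommGroup V] [Module ℚ V]
    (gr : ℕ → Submodule ℚ V) (π : ℕ → V →ₗ[ℚ] V)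
    (h1 : ∀ i, ∀ x ∈ gr i, π i x = x) (h2 : ∀ i j, i ≠ j → ∀ x ∈ gr i, π j x = 0)
    (h3 : ∀ x, x ∈ ⨆ i, gr i) : DirectSum.IsInternal gr := by
    rw [DirectSum.isInternal_submodule_iff_iSupIndep_and_iSup_eq_top]
    refine ⟨?_, ?_⟩
    · intro i
      rw [Submodule.disjoint_def]
      intro x hx hx'
      have : (⨆ j, ⨆ (_ : j ≠ i), gr j) ≤ LinearMap.ker (π i) :=
        iSup₂_le fun j hj y hy => h2 j i hj y hy
      rw [← h1 i x hx]
      exact this hx'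
    · exact eq_top_iff.2 fun x _ => h3 x

/-- Factorization of a linear map through a surjective one. -/
theorem exists_factor_of_surjective {V W U : Type*} [AddCommGroup V] [Module ℚ V] [AddCommGroup W]
    [Module ℚ W] [AddCommGroup U] [Module ℚ U] (π : V →ₗ[ℚ] W) (hπ : Function.Surjective π)
    (g : V →ₗ[ℚ] U) (h : ∀ x, π x = 0 → g x = 0) : ∃ g' : W →ₗ[ℚ] U, ∀ x, g' (π x) = g x := by
  obtain ⟨s, hs⟩ := π.exists_rightInverse_of_surjective (LinearMap.range_eq_top.2 hπ)
  refine ⟨g ∘ₗ s, fun x => ?_⟩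
  have h1 : π (s (π x) - x) = 0 := by
    rw [map_sub, sub_eq_zero]
    exact LinearMap.congr_fun hs (π x)
  have h2 := h _ h1
  rw [map_sub, sub_eq_zero] at h2
  exact h2

theorem neg_one_pow_smul_smul {V : Type*} [AddCommGroup V] [Module ℚ V] (i : ℕ) (x : V) :
    ((-1 : ℚ) ^ i) • ((-1 : ℚ) ^ i) • x = x := by
  rw [smul_smul, ← mul_pow]; simp

namespace CDGA

/-! ### Projections to the homogeneous components -/

section Basic

variable (A : CDGA.{u})

/-- The projection to the component of degree `i`. -/
noncomputable abbrev pr (i : ℕ) : A.carrier →ₗ[ℚ] A.carrier := gpr A.gr i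

theorem pr_mem (i : ℕ) (x : A.carrier) : A.pr i x ∈ A.gr i := gpr_mem A.gr i x

theorem one_mem_gr : (1 : A.carrier) ∈ A.gr 0 := SetLike.GradedOne.one_mem

theorem mul_mem_gr {i j : ℕ} {x y : A.carrier} (hx : x ∈ A.gr i) (hy : y ∈ A.gr j) :
    x * y ∈ A.gr (i + j) := SetLike.GradedMul.mul_mem hx hy

theorem d_pr (i : ℕ) (x : A.carrier) : A.d (A.pr i x) = A.pr (i + 1) (A.d x) :=
  A.d_proj i x

theorem pr_zero_d (x : A.carrier) : A.pr 0 (A.d x) = 0 := A.proj_zero_d x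

variable {A}

theorem Hom.map_pr {B : CDGA.{u}} (f : Hom A B) (i : ℕ) (x : A.carrier) :
    f.toAlgHom (A.pr i x) = B.pr i (f.toAlgHom x) := by
  refine graded_induction A.gr
    (p := fun x => f.toAlgHom (A.pr i x) = B.pr i (f.toAlgHom x)) (by simp) ?_ ?_ x
  · intro x y hx hy
    rw [map_add, map_add, hx, hy, map_add, map_add]
  · intro j x hx
    by_cases h : j = i
    · subst h
      rw [gpr_of_mem _ hx, gpr_of_mem _ (f.map_gr _ _ hx)]
    · rw [gpr_of_mem_ne _ hx h, gpr_of_mem_ne _ (f.map_gr _ _ hx) h, map_zero]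

theorem Hom.Surjective.exists_mem {B : CDGA.{u}} {f : Hom A B} (hf : f.Surjective) {i : ℕ}
    {y : B.carrier} (hy : y ∈ B.gr i) : ∃ x ∈ A.gr i, f.toAlgHom x = y := by
  obtain ⟨x, rfl⟩ := hf y
  exact ⟨A.pr i x, A.pr_mem i x, by rw [f.map_pr, gpr_of_mem _ hy]⟩

theorem eq_zero_of_d_eq_of_mem_zero {x y : A.carrier} (hx : x ∈ A.gr 0) (h : A.d y = x) :
    x = 0 := by
  rw [← gpr_of_mem _ hx, ← h]
  exact A.pr_zero_d y

variable (A)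

/-- The identity morphism. -/
def Hom.id : Hom A A where
  toAlgHom := AlgHom.id ℚ A.carrier
  map_gr _ _ h := h
  map_d _ := rfl

/-- The algebra automorphism acting by `(-1) ^ i` in degree `i`. -/
noncomputable def sgn : A.carrier →ₗ[ℚ] A.carrier :=
  gsum A.gr fun i => ((-1 : ℚ) ^ i) • LinearMap.id

variable {A}

theorem sgn_of_mem {i : ℕ} {x : A.carrier} (hx : x ∈ A.gr i) : A.sgn x = ((-1 : ℚ) ^ i) • x :=
  gsum_of_mem A.gr _ hx

/-- The differential shifts the degree by one, hence the sign. This anticommutation is what makes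
`dualD` square to zero. -/
theorem d_sgn (x : A.carrier) : A.d (A.sgn x) = - A.sgn (A.d x) := by
  refine LinearMap.congr_fun (f := A.d ∘ₗ A.sgn) (g := - (A.sgn ∘ₗ A.d)) ?_ x
  refine graded_linearMap_ext A.gr fun i x hx => ?_
  simp only [LinearMap.comp_apply, LinearMap.neg_apply]
  rw [sgn_of_mem hx, sgn_of_mem (A.d_mem _ _ hx), map_smul, pow_succ]
  simp

/-! ### Connectedness -/

theorem IsConnected.one_ne_zero (h : A.IsConnected) : (1 : A.carrier) ≠ 0 := by
  intro h1
  obtain ⟨r, -, hr⟩ := h 0 (zero_mem _)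
  have h2 := hr 0 (map_zero _)
  have h3 := hr 1 (by simpa using h1)
  exact zero_ne_one (h2.trans h3.symm)

theorem IsConnected.exists_smul_one (h : A.IsConnected) {x : A.carrier} (hx : x ∈ A.gr 0) :
    ∃ r : ℚ, x = r • (1 : A.carrier) := by
  obtain ⟨r, hr, -⟩ := h x hx
  exact ⟨r, by rw [← hr]; exact Algebra.algebraMap_eq_smul_one r⟩

theorem isConnected_of_exists_smul_one (h1 : (1 : A.carrier) ≠ 0)
    (h : ∀ x ∈ A.gr 0, ∃ r : ℚ, x = r • (1 : A.carrier)) : A.IsConnected := by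
  intro x hx
  obtain ⟨r, rfl⟩ := h x hx
  refine ⟨r, Algebra.algebraMap_eq_smul_one r, fun s hs => ?_⟩
  change algebraMap ℚ A.carrier s = r • 1 at hs
  rw [Algebra.algebraMap_eq_smul_one, ← sub_eq_zero, ← sub_smul] at hs
  exact sub_eq_zero.1 ((smul_eq_zero_iff_left h1).1 hs)

end Basic

/-! ### Quasi-isomorphisms -/

section QuasiIso

variable {A B C : CDGA.{u}}

theorem cohomologyMk_surjective (A : CDGA.{u}) : Function.Surjective A.cohomologyMk :=
  Ideal.Quotient.mk_surjective

theorem Hom.cohomologyMap_mk (f : Hom A B) (z : A.cocycles) :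
    f.cohomologyMap.toAlgHom (A.cohomologyMk z) = B.cohomologyMk (f.cocyclesMap z) := rfl

theorem Hom.isQuasiIso_iff (f : Hom A B) : f.IsQuasiIso ↔
    (∀ x, A.d x = 0 → (∃ w, B.d w = f.toAlgHom x) → ∃ v, A.d v = x) ∧
    (∀ y, B.d y = 0 → ∃ x, A.d x = 0 ∧ ∃ w, B.d w = y - f.toAlgHom x) := by
  constructor
  · rintro ⟨hi, hs⟩
    constructor
    · rintro x hx ⟨w, hw⟩
      have h : f.cohomologyMap.toAlgHom (A.cohomologyMk ⟨x, hx⟩) = 0 := by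
        rw [f.cohomologyMap_mk]
        exact (B.cohomologyMk_eq_zero _).2 ⟨w, hw⟩
      exact (A.cohomologyMk_eq_zero ⟨x, hx⟩).1 (hi (h.trans (map_zero _).symm))
    · intro y hy
      obtain ⟨c, hc⟩ := hs (B.cohomologyMk ⟨y, hy⟩)
      obtain ⟨z, rfl⟩ := A.cohomologyMk_surjective c
      refine ⟨z, z.2, ?_⟩
      rw [f.cohomologyMap_mk] at hc
      exact (B.cohomologyMk_eq_zero (⟨y, hy⟩ - f.cocyclesMap z)).1
        ((map_sub B.cohomologyMk _ _).trans (sub_eq_zero.2 hc.symm))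
  · rintro ⟨hi, hs⟩
    constructor
    · rw [injective_iff_map_eq_zero]
      intro c hc
      obtain ⟨z, rfl⟩ := A.cohomologyMk_surjective c
      exact (A.cohomologyMk_eq_zero z).2 (hi z z.2 ((B.cohomologyMk_eq_zero _).1 hc))
    · intro c
      obtain ⟨y, rfl⟩ := B.cohomologyMk_surjective c
      obtain ⟨x, hx, w, hw⟩ := hs y y.2
      refine ⟨A.cohomologyMk ⟨x, hx⟩, ?_⟩
      rw [f.cohomologyMap_mk]
      refine (sub_eq_zero.1 ((map_sub B.cohomologyMk _ _).symm.trans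
        ((B.cohomologyMk_eq_zero (y - f.cocyclesMap ⟨x, hx⟩)).2 ⟨w, hw⟩))).symm

/-- Morphisms commute with the homogeneous projections and d shifts them by one, so primitives can
be found component by component. The component of degree 0 of a boundary is zero and takes the
primitive 0. -/
theorem Hom.isQuasiIso_of_homogeneous (f : Hom A B)
    (hi : ∀ i, ∀ x ∈ A.gr i, A.d x = 0 → (∃ w, B.d w = f.toAlgHom x) → ∃ v, A.d v = x)
    (hs : ∀ i, ∀ y ∈ B.gr i, B.d y = 0 → ∃ x, A.d x = 0 ∧ ∃ w, B.d w = y - f.toAlgHom x) :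
    f.IsQuasiIso := by
  rw [f.isQuasiIso_iff]
  constructor
  · rintro x hx ⟨w, hw⟩
    have key : ∀ i, ∃ v, A.d v = A.pr i x := by
      intro i
      refine hi i _ (A.pr_mem i x) (by rw [A.d_pr, hx, map_zero]) ?_
      rw [f.map_pr, ← hw]
      cases i with
      | zero => exact ⟨0, by rw [B.pr_zero_d, map_zero]⟩
      | succ i => exact ⟨B.pr i w, B.d_pr i w⟩
    choose v hv using key
    obtain ⟨s, hs⟩ := sum_gpr A.gr x
    refine ⟨∑ i ∈ s, v i, ?_⟩
    rw [map_sum]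
    conv_rhs => rw [hs]
    exact Finset.sum_congr rfl fun i _ => hv i
  · intro y hy
    have key : ∀ i, ∃ x, A.d x = 0 ∧ ∃ w, B.d w = B.pr i y - f.toAlgHom x := fun i =>
      hs i _ (B.pr_mem i y) (by rw [B.d_pr, hy, map_zero])
    choose x hx w hw using key
    obtain ⟨s, hs⟩ := sum_gpr B.gr y
    refine ⟨∑ i ∈ s, x i, ?_, ∑ i ∈ s, w i, ?_⟩
    · rw [map_sum]
      exact Finset.sum_eq_zero fun i _ => hx i
    · rw [map_sum, map_sum]
      conv_rhs => rw [hs]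
      rw [← Finset.sum_sub_distrib]
      exact Finset.sum_congr rfl fun i _ => hw i

theorem Hom.cohomologyMap_comp (g : Hom B C) (f : Hom A B) (c : A.cohomology.carrier) :
    (g.comp f).cohomologyMap.toAlgHom c =
      g.cohomologyMap.toAlgHom (f.cohomologyMap.toAlgHom c) := by
  obtain ⟨z, rfl⟩ := A.cohomologyMk_surjective c
  rfl

theorem Hom.isQuasiIso_id (A : CDGA.{u}) : (Hom.id A).IsQuasiIso := by
  rw [Hom.isQuasiIso_iff]
  exact ⟨fun x _ h => h, fun y hy => ⟨y, hy, 0, by simp [Hom.id]⟩⟩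

/-- A section of a quasi-isomorphism is a quasi-isomorphism. -/
theorem Hom.isQuasiIso_of_section {g : Hom B A} {f : Hom A B} (hg : g.IsQuasiIso)
    (h : g.comp f = Hom.id A) : f.IsQuasiIso := by
  have hid : Function.Bijective (g.comp f).cohomologyMap.toAlgHom := by
    rw [h]; exact Hom.isQuasiIso_id A
  have h' : ⇑(g.comp f).cohomologyMap.toAlgHom =
      ⇑g.cohomologyMap.toAlgHom ∘ ⇑f.cohomologyMap.toAlgHom := funext (g.cohomologyMap_comp f)
  rw [h'] at hid
  exact (Function.Bijective.of_comp_iff' hg _).1 hid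

end QuasiIso

/-! ### Transport along bijective morphisms -/

section Transport

variable {C D : CDGA.{u}} (φ : Hom C D)

theorem IsOneConnected.of_injective (hφ : Function.Injective φ.toAlgHom) (h : D.IsOneConnected) :
    C.IsOneConnected := by
  refine ⟨isConnected_of_exists_smul_one ?_ ?_, ?_⟩
  · intro h1
    apply h.1.one_ne_zero
    rw [← map_one φ.toAlgHom, h1, map_zero]
  · intro x hx
    obtain ⟨r, hr⟩ := h.1.exists_smul_one (φ.map_gr 0 x hx)
    exact ⟨r, hφ (by rw [hr, map_smul, map_one])⟩
  · rw [eq_bot_iff]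
    intro x hx
    have h1 := φ.map_gr 1 x hx
    rw [h.2, Submodule.mem_bot] at h1
    exact hφ (h1.trans (map_zero _).symm)

/-- The restriction of a morphism to the components of degree `i`. -/
def Hom.restrictGr (i : ℕ) : C.gr i →ₗ[ℚ] D.gr i :=
  φ.toAlgHom.toLinearMap.restrict (φ.map_gr i)

theorem IsFiniteType.of_injective (hφ : Function.Injective φ.toAlgHom) (h : D.IsFiniteType) :
    C.IsFiniteType := by
  intro i
  have := h i
  refine FiniteDimensional.of_injective (φ.restrictGr i) fun x y hxy => ?_
  exact Subtype.ext (hφ (congrArg Subtype.val hxy))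

theorem IsFiniteType.of_surjective (hφ : φ.Surjective) (h : C.IsFiniteType) :
    D.IsFiniteType := by
  intro i
  have := h i
  refine Module.Finite.of_surjective (φ.restrictGr i) ?_
  rintro ⟨y, hy⟩
  obtain ⟨x, hx, rfl⟩ := hφ.exists_mem hy
  exact ⟨⟨x, hx⟩, rfl⟩

theorem VanishesFrom.of_injective (hφ : Function.Injective φ.toAlgHom) {r : ℚ}
    (h : D.VanishesFrom r) : C.VanishesFrom r := by
  intro i hi
  rw [eq_bot_iff]
  intro x hx
  have h1 := φ.map_gr i x hx
  rw [h i hi, Submodule.mem_bot] at h1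
  exact hφ (h1.trans (map_zero _).symm)

theorem IsPoincareDuality.of_bijective (hφ : Function.Bijective φ.toAlgHom) {n : ℕ}
    (hC : C.IsConnected) (h : D.IsPoincareDuality n) : C.IsPoincareDuality n := by
  obtain ⟨-, hfin, ε, hdeg, hd, hdual, hvan⟩ := h
  refine ⟨hC, IsFiniteType.of_injective φ hφ.1 hfin, ε ∘ₗ φ.toAlgHom.toLinearMap, ?_, ?_, ?_, ?_⟩
  · intro i hi x hx
    exact hdeg i hi _ (φ.map_gr i x hx)
  · intro x
    change ε (φ.toAlgHom _) = 0
    rw [φ.map_d, hd]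
  · intro p q hpq
    have hb : ∀ i, Function.Bijective (φ.restrictGr i) := by
      intro i
      refine ⟨fun x y hxy => Subtype.ext (hφ.1 (congrArg Subtype.val hxy)), ?_⟩
      rintro ⟨y, hy⟩
      obtain ⟨x, hx, rfl⟩ := Hom.Surjective.exists_mem (f := φ) hφ.2 hy
      exact ⟨⟨x, hx⟩, rfl⟩
    let e := LinearEquiv.ofBijective (φ.restrictGr q) (hb q)
    have heq : ⇑(C.dualityMap (ε ∘ₗ φ.toAlgHom.toLinearMap) p q) =
        ⇑e.dualMap ∘ ⇑(D.dualityMap ε p q) ∘ ⇑(φ.restrictGr p) := by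
      funext x
      refine LinearMap.ext fun y => ?_
      change ε (φ.toAlgHom (x * y)) = ε (φ.toAlgHom x * φ.toAlgHom y)
      rw [map_mul]
    rw [heq]
    exact e.dualMap.bijective.comp ((hdual p q hpq).comp (hb p))
  · intro p hp
    rw [eq_bot_iff]
    intro x hx
    have h1 := φ.map_gr p x hx
    rw [hvan p hp, Submodule.mem_bot] at h1
    exact hφ.1 (h1.trans (map_zero _).symm)

end Transport

/-! ### Homogeneous subspaces -/

section Total

variable (A : CDGA.{u})

/-- The subspace of elements whose components of degree `k` lie in `W k`. -/
noncomputable def total (W : ℕ → Submodule ℚ A.carrier) : Submodule ℚ A.carrier :=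
  ⨅ k, (W k).comap (A.pr k)

variable {A} {W : ℕ → Submodule ℚ A.carrier}

theorem mem_total {x : A.carrier} : x ∈ A.total W ↔ ∀ k, A.pr k x ∈ W k := by
  simp [total, Submodule.mem_iInf]

theorem mem_total_of_mem (hW : ∀ k, W k ≤ A.gr k) {k : ℕ} {x : A.carrier} (hx : x ∈ W k) :
    x ∈ A.total W := by
  rw [mem_total]
  intro j
  by_cases h : k = j
  · subst h; rwa [gpr_of_mem _ (hW k hx)]
  · rw [gpr_of_mem_ne _ (hW k hx) h]; exact zero_mem _

theorem mem_of_mem_total {k : ℕ} {x : A.carrier} (hx : x ∈ A.total W) (hk : x ∈ A.gr k) :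
    x ∈ W k := by
  have := mem_total.1 hx k
  rwa [gpr_of_mem _ hk] at this

theorem pr_mem_total (hW : ∀ k, W k ≤ A.gr k) {x : A.carrier} (hx : x ∈ A.total W) (k : ℕ) :
    A.pr k x ∈ A.total W :=
  mem_total_of_mem hW (mem_total.1 hx k)

theorem total_induction {p : A.carrier → Prop} (h0 : p 0) (hadd : ∀ x y, p x → p y → p (x + y))
    (h : ∀ k, ∀ x ∈ W k, p x) {x : A.carrier} (hx : x ∈ A.total W) : p x := by
  obtain ⟨s, hs⟩ := sum_gpr A.gr x
  rw [hs]
  exact Finset.sum_induction _ p hadd h0 fun i _ => h i _ (mem_total.1 hx i)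

end Total

/-! ### Sub-CDGAs -/

section Sub

/-- The components of a sub-CDGA. -/
structure IsSub (A : CDGA.{u}) (W : ℕ → Submodule ℚ A.carrier) : Prop where
  le : ∀ k, W k ≤ A.gr k
  one_mem : 1 ∈ W 0
  mul_mem : ∀ i j, ∀ x ∈ W i, ∀ y ∈ W j, x * y ∈ W (i + j)
  d_mem : ∀ i, ∀ x ∈ W i, A.d x ∈ W (i + 1)

variable {A : CDGA.{u}} {W : ℕ → Submodule ℚ A.carrier} (hW : A.IsSub W)

/-- The underlying subalgebra of a sub-CDGA. -/
noncomputable def IsSub.subalgebra : Subalgebra ℚ A.carrier where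
  carrier := A.total W
  zero_mem' := zero_mem _
  one_mem' := mem_total_of_mem hW.le hW.one_mem
  add_mem' := add_mem
  mul_mem' {x y} hx hy := by
    change x * y ∈ A.total W
    refine total_induction (p := fun x => x * y ∈ A.total W) (by simp) ?_ ?_ hx
    · intro a b ha hb
      rw [add_mul]; exact add_mem ha hb
    · intro i a ha
      refine total_induction (p := fun y => a * y ∈ A.total W) (by simp) ?_ ?_ hy
      · intro b c hb hc
        rw [mul_add]; exact add_mem hb hc
      · intro j b hb
        exact mem_total_of_mem hW.le (hW.mul_mem i j a ha b hb)
  algebraMap_mem' r := by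
    rw [Algebra.algebraMap_eq_smul_one]
    exact (A.total W).smul_mem r (mem_total_of_mem hW.le hW.one_mem)

theorem IsSub.d_mem_total (hW : A.IsSub W) {x : A.carrier} (hx : x ∈ A.total W) :
    A.d x ∈ A.total W := by
  refine total_induction (p := fun x => A.d x ∈ A.total W) (by simp) ?_ ?_ hx
  · intro a b ha hb
    rw [map_add]; exact add_mem ha hb
  · intro i a ha
    exact mem_total_of_mem hW.le (hW.d_mem i a ha)

/-- The components of a sub-CDGA, as subspaces of it. -/
noncomputable def IsSub.subGr (k : ℕ) : Submodule ℚ hW.subalgebra :=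
  (A.gr k).comap hW.subalgebra.val.toLinearMap

theorem IsSub.subGr_isInternal : DirectSum.IsInternal hW.subGr := by
  refine isInternal_of_proj hW.subGr
    (fun k => (A.pr k).restrict (p := hW.subalgebra.toSubmodule) (q := hW.subalgebra.toSubmodule)
      fun x hx => pr_mem_total hW.le hx k) ?_ ?_ ?_
  · intro i x hx
    exact Subtype.ext (gpr_of_mem _ hx)
  · intro i j hij x hx
    exact Subtype.ext (gpr_of_mem_ne _ hx hij)
  · rintro ⟨x, hx⟩
    obtain ⟨s, hs⟩ := sum_gpr A.gr x
    have : (⟨x, hx⟩ : hW.subalgebra) =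
        ∑ i ∈ s, (⟨A.pr i x, pr_mem_total hW.le hx i⟩ : hW.subalgebra) := by
      apply Subtype.ext
      rw [AddSubmonoidClass.coe_finsetSum]
      exact hs
    rw [this]
    exact sum_mem fun i _ => Submodule.mem_iSup_of_mem i (A.pr_mem i x)

noncomputable instance : GradedAlgebra hW.subGr :=
  { hW.subGr_isInternal.chooseDecomposition with
    one_mem := A.one_mem_gr
    mul_mem := fun _ _ _ _ hx hy => A.mul_mem_gr hx hy }

/-- The sub-CDGA with given components. -/
noncomputable def IsSub.toCDGA : CDGA.{u} where
  carrier := hW.subalgebra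
  gr := hW.subGr
  d := A.d.restrict (p := hW.subalgebra.toSubmodule) (q := hW.subalgebra.toSubmodule)
    fun _ hx => hW.d_mem_total hx
  d_mem i x hx := A.d_mem i x hx
  d_d x := Subtype.ext (A.d_d x)
  leibniz i x y hx := Subtype.ext (A.leibniz i x y hx)
  gr_comm i j x y hx hy := Subtype.ext (A.gr_comm i j x y hx hy)

/-- The inclusion of a sub-CDGA. -/
noncomputable def IsSub.incl : Hom hW.toCDGA A where
  toAlgHom := hW.subalgebra.val
  map_gr _ _ hx := hx
  map_d _ := rfl

theorem IsSub.incl_injective : Function.Injective hW.incl.toAlgHom := Subtype.val_injective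

theorem IsSub.exists_incl_eq {k : ℕ} {x : A.carrier} (hx : x ∈ W k) :
    ∃ y ∈ hW.toCDGA.gr k, hW.incl.toAlgHom y = x :=
  ⟨⟨x, mem_total_of_mem hW.le hx⟩, hW.le k hx, rfl⟩

theorem IsSub.incl_mem {k : ℕ} {y : hW.toCDGA.carrier} (hy : y ∈ hW.toCDGA.gr k) :
    hW.incl.toAlgHom y ∈ W k :=
  mem_of_mem_total y.2 hy

end Sub

/-! ### Quotient CDGAs -/

section Quot

/-- The components of a differential homogeneous two-sided ideal. -/
structure IsDGIdeal (A : CDGA.{u}) (W : ℕ → Submodule ℚ A.carrier) : Prop where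
  le : ∀ k, W k ≤ A.gr k
  mul_mem_left : ∀ i j, ∀ x ∈ A.gr i, ∀ y ∈ W j, x * y ∈ W (i + j)
  d_mem : ∀ i, ∀ x ∈ W i, A.d x ∈ W (i + 1)

variable {A : CDGA.{u}} {W : ℕ → Submodule ℚ A.carrier} (hW : A.IsDGIdeal W)

theorem IsDGIdeal.mul_mem_right (hW : A.IsDGIdeal W) {i j : ℕ} {x y : A.carrier} (hx : x ∈ A.gr i) (hy : y ∈ W j) :
    y * x ∈ W (i + j) := by
  rw [A.gr_comm j i y x (hW.le j hy) hx]
  exact Submodule.smul_mem _ _ (hW.mul_mem_left i j x hx y hy)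

/-- The underlying ideal. -/
noncomputable def IsDGIdeal.ideal : Ideal A.carrier where
  carrier := A.total W
  zero_mem' := zero_mem _
  add_mem' := add_mem
  smul_mem' x y hy := by
    change x * y ∈ A.total W
    refine graded_induction A.gr (p := fun x => x * y ∈ A.total W) (by simp) ?_ ?_ x
    · intro a b ha hb
      rw [add_mul]; exact add_mem ha hb
    · intro i a ha
      refine total_induction (p := fun y => a * y ∈ A.total W) (by simp) ?_ ?_ hy
      · intro b c hb hc
        rw [mul_add]; exact add_mem hb hc
      · intro j b hb
        exact mem_total_of_mem hW.le (hW.mul_mem_left i j a ha b hb)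

instance : hW.ideal.IsTwoSided where
  mul_mem_of_left := by
    intro y x hy
    change y * x ∈ A.total W
    refine graded_induction A.gr (p := fun x => y * x ∈ A.total W) (by simp) ?_ ?_ x
    · intro a b ha hb
      rw [mul_add]; exact add_mem ha hb
    · intro i a ha
      refine total_induction (p := fun y => y * a ∈ A.total W) (by simp) ?_ ?_ hy
      · intro b c hb hc
        rw [add_mul]; exact add_mem hb hc
      · intro j b hb
        exact mem_total_of_mem hW.le (hW.mul_mem_right ha hb)

theorem IsDGIdeal.d_mem_total (hW : A.IsDGIdeal W) {x : A.carrier} (hx : x ∈ A.total W) : A.d x ∈ A.total W := by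
  refine total_induction (p := fun x => A.d x ∈ A.total W) (by simp) ?_ ?_ hx
  · intro a b ha hb
    rw [map_add]; exact add_mem ha hb
  · intro i a ha
    exact mem_total_of_mem hW.le (hW.d_mem i a ha)

/-- The projection to the quotient algebra. -/
noncomputable def IsDGIdeal.quotMk : A.carrier →ₐ[ℚ] A.carrier ⧸ hW.ideal :=
  Ideal.Quotient.mkₐ ℚ hW.ideal

theorem IsDGIdeal.quotMk_surjective : Function.Surjective hW.quotMk := Ideal.Quotient.mk_surjective

theorem IsDGIdeal.quotMk_eq_zero {x : A.carrier} : hW.quotMk x = 0 ↔ x ∈ A.total W :=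
  Ideal.Quotient.eq_zero_iff_mem

theorem IsDGIdeal.exists_lift (g : A.carrier →ₗ[ℚ] A.carrier)
    (hg : ∀ x ∈ A.total W, g x ∈ A.total W) :
    ∃ g' : A.carrier ⧸ hW.ideal →ₗ[ℚ] A.carrier ⧸ hW.ideal, ∀ x, g' (hW.quotMk x) = hW.quotMk (g x) :=
  exists_factor_of_surjective hW.quotMk.toLinearMap hW.quotMk_surjective (hW.quotMk.toLinearMap ∘ₗ g)
    fun x hx => hW.quotMk_eq_zero.2 (hg x (hW.quotMk_eq_zero.1 hx))

/-- The components of the quotient. -/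
noncomputable def IsDGIdeal.quotGr (k : ℕ) : Submodule ℚ (A.carrier ⧸ hW.ideal) :=
  (A.gr k).map hW.quotMk.toLinearMap

theorem IsDGIdeal.quotGr_isInternal : DirectSum.IsInternal hW.quotGr := by
  choose π hπ using fun k => hW.exists_lift (A.pr k) fun x hx => pr_mem_total hW.le hx k
  refine isInternal_of_proj hW.quotGr π ?_ ?_ ?_
  · rintro i _ ⟨x, hx, rfl⟩
    exact (hπ i x).trans (congrArg hW.quotMk (gpr_of_mem _ hx))
  · rintro i j hij _ ⟨x, hx, rfl⟩
    exact (hπ j x).trans ((congrArg hW.quotMk (gpr_of_mem_ne _ hx hij)).trans (map_zero hW.quotMk))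
  · intro y
    obtain ⟨x, rfl⟩ := hW.quotMk_surjective y
    obtain ⟨s, hs⟩ := sum_gpr A.gr x
    rw [hs, map_sum]
    exact sum_mem fun i _ => Submodule.mem_iSup_of_mem i ⟨_, A.pr_mem i x, rfl⟩

noncomputable instance : GradedAlgebra hW.quotGr :=
  { hW.quotGr_isInternal.chooseDecomposition with
    one_mem := ⟨1, A.one_mem_gr, map_one hW.quotMk⟩
    mul_mem := by
      rintro i j _ _ ⟨x, hx, rfl⟩ ⟨y, hy, rfl⟩
      exact ⟨x * y, A.mul_mem_gr hx hy, map_mul hW.quotMk x y⟩ }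

/-- The differential of the quotient. -/
noncomputable def IsDGIdeal.quotD : A.carrier ⧸ hW.ideal →ₗ[ℚ] A.carrier ⧸ hW.ideal :=
  (hW.exists_lift A.d fun _ hx => hW.d_mem_total hx).choose

theorem IsDGIdeal.quotD_mk (x : A.carrier) : hW.quotD (hW.quotMk x) = hW.quotMk (A.d x) :=
  (hW.exists_lift A.d fun _ hx => hW.d_mem_total hx).choose_spec x

/-- The quotient of a CDGA by a differential homogeneous ideal. -/
noncomputable def IsDGIdeal.quot : CDGA.{u} where
  carrier := A.carrier ⧸ hW.ideal
  gr := hW.quotGr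
  d := hW.quotD
  d_mem := by
    rintro i _ ⟨x, hx, rfl⟩
    exact ⟨A.d x, A.d_mem i x hx, (hW.quotD_mk x).symm⟩
  d_d := by
    intro y
    obtain ⟨x, rfl⟩ := hW.quotMk_surjective y
    rw [hW.quotD_mk, hW.quotD_mk, A.d_d, map_zero]
  leibniz := by
    rintro i _ y ⟨x, hx, rfl⟩
    obtain ⟨y, rfl⟩ := hW.quotMk_surjective y
    change hW.quotD (hW.quotMk x * hW.quotMk y) = hW.quotD (hW.quotMk x) * hW.quotMk y +
      ((-1 : ℚ) ^ i) • (hW.quotMk x * hW.quotD (hW.quotMk y))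
    rw [← map_mul, hW.quotD_mk, hW.quotD_mk, hW.quotD_mk, A.leibniz i x y hx, map_add, map_smul,
      map_mul, map_mul]
  gr_comm := by
    rintro i j _ _ ⟨x, hx, rfl⟩ ⟨y, hy, rfl⟩
    change hW.quotMk x * hW.quotMk y = ((-1 : ℚ) ^ (i * j)) • (hW.quotMk y * hW.quotMk x)
    rw [← map_mul, ← map_mul, ← map_smul, A.gr_comm i j x y hx hy]

/-- The projection to the quotient CDGA. -/
noncomputable def IsDGIdeal.proj : Hom A hW.quot where
  toAlgHom := hW.quotMk
  map_gr _ x hx := ⟨x, hx, rfl⟩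
  map_d x := (hW.quotD_mk x).symm

theorem IsDGIdeal.proj_surjective : hW.proj.Surjective := hW.quotMk_surjective

theorem IsDGIdeal.proj_eq_zero {x : A.carrier} : hW.proj.toAlgHom x = 0 ↔ x ∈ A.total W :=
  hW.quotMk_eq_zero

/-- The morphism induced on the quotient. -/
theorem IsDGIdeal.exists_desc {B : CDGA.{u}} (f : Hom A B)
    (hf : ∀ k, ∀ x ∈ W k, f.toAlgHom x = 0) : ∃ g : Hom hW.quot B, g.comp hW.proj = f := by
  have hf' : ∀ x ∈ A.total W, f.toAlgHom x = 0 := fun x hx =>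
    total_induction (p := fun x => f.toAlgHom x = 0) (map_zero _)
      (fun x y hx hy => by rw [map_add, hx, hy, add_zero]) hf hx
  refine ⟨{ toAlgHom := Ideal.Quotient.liftₐ hW.ideal f.toAlgHom hf', map_gr := ?_, map_d := ?_ },
    ?_⟩
  · rintro i _ ⟨x, hx, rfl⟩
    exact f.map_gr i x hx
  · intro y
    obtain ⟨x, rfl⟩ := hW.proj_surjective y
    rw [← hW.proj.map_d]
    exact f.map_d x
  · ext x
    rfl

/-- The quotient by an acyclic ideal is a quasi-isomorphism. -/
theorem IsDGIdeal.proj_isQuasiIso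
    (h : ∀ k, ∀ x ∈ W k, A.d x = 0 → ∃ y ∈ A.total W, A.d y = x) : hW.proj.IsQuasiIso := by
  have h' : ∀ x ∈ A.total W, A.d x = 0 → ∃ y ∈ A.total W, A.d y = x := by
    intro x hx hdx
    choose y hy hdy using fun k => h k _ (mem_total.1 hx k) (by rw [A.d_pr, hdx, map_zero])
    obtain ⟨s, hs⟩ := sum_gpr A.gr x
    refine ⟨∑ i ∈ s, y i, sum_mem fun i _ => hy i, ?_⟩
    rw [map_sum]
    conv_rhs => rw [hs]
    exact Finset.sum_congr rfl fun i _ => hdy i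
  rw [Hom.isQuasiIso_iff]
  constructor
  · rintro x hx ⟨w, hw⟩
    obtain ⟨w, rfl⟩ := hW.proj_surjective w
    rw [← hW.proj.map_d, ← sub_eq_zero, ← map_sub, hW.proj_eq_zero] at hw
    obtain ⟨y, -, hy⟩ := h' _ hw (by rw [map_sub, A.d_d, hx, sub_zero])
    exact ⟨w - y, by rw [map_sub, hy]; abel⟩
  · intro y hy
    obtain ⟨x, rfl⟩ := hW.proj_surjective y
    rw [← hW.proj.map_d, hW.proj_eq_zero] at hy
    obtain ⟨z, hz, hdz⟩ := h' _ hy (A.d_d x)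
    refine ⟨x - z, by rw [map_sub, hdz, sub_self], 0, ?_⟩
    rw [map_zero, map_sub, hW.proj_eq_zero.2 hz, sub_zero, sub_self]

end Quot

/-! ### Fibre products -/

section Pullback

variable {X Y B : CDGA.{u}} (f : Hom X B) (g : Hom Y B)

/-- The underlying algebra of the fibre product. -/
def pullbackAlg : Subalgebra ℚ (X.carrier × Y.carrier) :=
  AlgHom.equalizer (f.toAlgHom.comp (AlgHom.fst ℚ X.carrier Y.carrier))
    (g.toAlgHom.comp (AlgHom.snd ℚ X.carrier Y.carrier))

/-- The components of the fibre product. -/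
def pullbackGr (i : ℕ) : Submodule ℚ (pullbackAlg f g) :=
  ((X.gr i).prod (Y.gr i)).comap (pullbackAlg f g).val.toLinearMap

theorem mem_pullbackAlg {z : X.carrier × Y.carrier} :
    z ∈ pullbackAlg f g ↔ f.toAlgHom z.1 = g.toAlgHom z.2 := Iff.rfl

theorem pullback_pr_mem (i : ℕ) {z : X.carrier × Y.carrier} (hz : z ∈ pullbackAlg f g) :
    ((X.pr i).prodMap (Y.pr i)) z ∈ pullbackAlg f g := by
  rw [mem_pullbackAlg] at hz ⊢
  change f.toAlgHom (X.pr i z.1) = g.toAlgHom (Y.pr i z.2)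
  rw [f.map_pr, g.map_pr, hz]

theorem pullback_d_mem {z : X.carrier × Y.carrier} (hz : z ∈ pullbackAlg f g) :
    (X.d.prodMap Y.d) z ∈ pullbackAlg f g := by
  rw [mem_pullbackAlg] at hz ⊢
  change f.toAlgHom (X.d z.1) = g.toAlgHom (Y.d z.2)
  rw [f.map_d, g.map_d, hz]

theorem pullbackGr_isInternal : DirectSum.IsInternal (pullbackGr f g) := by
  refine isInternal_of_proj (pullbackGr f g)
    (fun i => ((X.pr i).prodMap (Y.pr i)).restrict (p := (pullbackAlg f g).toSubmodule)
      (q := (pullbackAlg f g).toSubmodule) fun x hx => pullback_pr_mem f g i hx) ?_ ?_ ?_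
  · intro i x hx
    exact Subtype.ext (Prod.ext (gpr_of_mem _ hx.1) (gpr_of_mem _ hx.2))
  · intro i j hij x hx
    exact Subtype.ext (Prod.ext (gpr_of_mem_ne _ hx.1 hij) (gpr_of_mem_ne _ hx.2 hij))
  · rintro ⟨⟨x, y⟩, hz⟩
    classical
    have hx := DirectSum.sum_support_decompose X.gr x
    have hy := DirectSum.sum_support_decompose Y.gr y
    let s := (DirectSum.decompose X.gr x).support ∪ (DirectSum.decompose Y.gr y).support
    have hx' : x = ∑ i ∈ s, X.pr i x := by
      conv_lhs => rw [← hx]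
      refine Finset.sum_subset Finset.subset_union_left fun i _ hi => ?_
      simpa using hi
    have hy' : y = ∑ i ∈ s, Y.pr i y := by
      conv_lhs => rw [← hy]
      refine Finset.sum_subset Finset.subset_union_right fun i _ hi => ?_
      simpa using hi
    have : (⟨(x, y), hz⟩ : pullbackAlg f g) =
        ∑ i ∈ s, (⟨(X.pr i x, Y.pr i y), pullback_pr_mem f g i hz⟩ : pullbackAlg f g) := by
      apply Subtype.ext
      rw [AddSubmonoidClass.coe_finsetSum]
      refine Prod.ext ?_ ?_
      · rw [Prod.fst_sum]; exact hx'
      · rw [Prod.snd_sum]; exact hy'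
    rw [this]
    exact sum_mem fun i _ => Submodule.mem_iSup_of_mem i ⟨X.pr_mem i x, Y.pr_mem i y⟩

noncomputable instance : GradedAlgebra (pullbackGr f g) :=
  { (pullbackGr_isInternal f g).chooseDecomposition with
    one_mem := ⟨X.one_mem_gr, Y.one_mem_gr⟩
    mul_mem := fun _ _ _ _ hx hy => ⟨X.mul_mem_gr hx.1 hy.1, Y.mul_mem_gr hx.2 hy.2⟩ }

/-- The fibre product of CDGAs. -/
noncomputable def pullback : CDGA.{u} where
  carrier := pullbackAlg f g
  gr := pullbackGr f g
  d := (X.d.prodMap Y.d).restrict (p := (pullbackAlg f g).toSubmodule)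
    (q := (pullbackAlg f g).toSubmodule) fun _ hx => pullback_d_mem f g hx
  d_mem i _ hx := ⟨X.d_mem i _ hx.1, Y.d_mem i _ hx.2⟩
  d_d _ := Subtype.ext (Prod.ext (X.d_d _) (Y.d_d _))
  leibniz i _ _ hx := Subtype.ext (Prod.ext (X.leibniz i _ _ hx.1) (Y.leibniz i _ _ hx.2))
  gr_comm i j _ _ hx hy :=
    Subtype.ext (Prod.ext (X.gr_comm i j _ _ hx.1 hy.1) (Y.gr_comm i j _ _ hx.2 hy.2))

/-- The first projection of a fibre product. -/
noncomputable def pullbackFst : Hom (pullback f g) X where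
  toAlgHom := (AlgHom.fst ℚ X.carrier Y.carrier).comp (pullbackAlg f g).val
  map_gr _ _ hx := hx.1
  map_d _ := rfl

/-- The second projection of a fibre product. -/
noncomputable def pullbackSnd : Hom (pullback f g) Y where
  toAlgHom := (AlgHom.snd ℚ X.carrier Y.carrier).comp (pullbackAlg f g).val
  map_gr _ _ hx := hx.2
  map_d _ := rfl

/-- The pair of two elements with the same image. -/
def pullbackPair (x : X.carrier) (y : Y.carrier) (h : f.toAlgHom x = g.toAlgHom y) :
    (pullback f g).carrier := ⟨(x, y), h⟩

theorem pullback_comm : f.comp (pullbackFst f g) = g.comp (pullbackSnd f g) := by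
  ext x
  exact x.2

theorem pullback_ext {x y : (pullback f g).carrier}
    (h1 : (pullbackFst f g).toAlgHom x = (pullbackFst f g).toAlgHom y)
    (h2 : (pullbackSnd f g).toAlgHom x = (pullbackSnd f g).toAlgHom y) : x = y :=
  Subtype.ext (Prod.ext h1 h2)

/-- The morphism to a fibre product given by its components. -/
noncomputable def pullbackLift {Z : CDGA.{u}} (a : Hom Z X) (b : Hom Z Y)
    (h : f.comp a = g.comp b) : Hom Z (pullback f g) where
  toAlgHom := AlgHom.codRestrict (a.toAlgHom.prod b.toAlgHom) (pullbackAlg f g)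
    fun z => congrArg (fun k : Hom Z B => k.toAlgHom z) h
  map_gr i z hz := ⟨a.map_gr i z hz, b.map_gr i z hz⟩
  map_d z := Subtype.ext (Prod.ext (a.map_d z) (b.map_d z))

/-- The base change of a quasi-isomorphism is a quasi-isomorphism if the two morphisms are
jointly surjective. -/
theorem pullbackFst_isQuasiIso (hg : g.IsQuasiIso)
    (h : ∀ b, ∃ x y, b = f.toAlgHom x - g.toAlgHom y) : (pullbackFst f g).IsQuasiIso := by
  obtain ⟨hi, hs⟩ := g.isQuasiIso_iff.1 hg
  rw [Hom.isQuasiIso_iff]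
  constructor
  · rintro ⟨⟨x, y⟩, hxy⟩ hd ⟨x', hx'⟩
    change X.d x' = x at hx'
    have hxy' : f.toAlgHom x = g.toAlgHom y := hxy
    have hdy : Y.d y = 0 := congrArg (fun z : (pullback f g).carrier => z.1.2) hd
    obtain ⟨y', hy'⟩ := hi y hdy ⟨f.toAlgHom x', by rw [← f.map_d, hx', hxy']⟩
    -- The two primitives x' and y' need not agree in B. Their difference is a cocycle, equal to g
    -- y'' up to d b; splitting b as f x1 - g y1 absorbs the error into boundaries, which do not
    -- affect the differentials of the corrected pair.
    obtain ⟨y'', hdy'', b, hb⟩ := hs (f.toAlgHom x' - g.toAlgHom y')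
      (by rw [map_sub, ← f.map_d, ← g.map_d, hx', hy', hxy', sub_self])
    obtain ⟨x1, y1, rfl⟩ := h b
    rw [map_sub, ← f.map_d, ← g.map_d] at hb
    refine ⟨pullbackPair f g (x' - X.d x1) (y' + y'' - Y.d y1) ?_, ?_⟩
    · rw [map_sub, map_sub, map_add]
      rw [← sub_eq_zero, ← neg_eq_zero, ← sub_eq_zero.2 hb]; abel
    · refine pullback_ext f g ?_ ?_
      · change X.d (x' - X.d x1) = x
        rw [map_sub, X.d_d, sub_zero, hx']
      · change Y.d (y' + y'' - Y.d y1) = y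
        rw [map_sub, map_add, Y.d_d, hy', hdy'', add_zero, sub_zero]
  · intro x hx
    obtain ⟨y, hy, b, hb⟩ := hs (f.toAlgHom x) (by rw [← f.map_d, hx, map_zero])
    obtain ⟨x1, y1, rfl⟩ := h b
    rw [map_sub, ← f.map_d, ← g.map_d] at hb
    refine ⟨pullbackPair f g (x - X.d x1) (y - Y.d y1) ?_, ?_, x1, ?_⟩
    · rw [map_sub, map_sub]
      rw [← sub_eq_zero, ← neg_eq_zero, ← sub_eq_zero.2 hb]; abel
    · refine pullback_ext f g ?_ ?_
      · change X.d (x - X.d x1) = 0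
        rw [map_sub, X.d_d, hx, sub_zero]
      · change Y.d (y - Y.d y1) = 0
        rw [map_sub, Y.d_d, hy, sub_zero]
    · change X.d x1 = x - (x - X.d x1)
      abel

end Pullback

/-! ### Square-zero extensions -/

/-- A right differential graded module over a CDGA, with a derivation into it which anticommutes
with the differentials. -/
structure DGModule (A : CDGA.{u}) where
  carrier : Type u
  [addCommGroup : AddCommGroup carrier]
  [module : Module ℚ carrier]
  gr : ℕ → Submodule ℚ carrier
  [decomposition : DirectSum.Decomposition gr]
  act : carrier →ₗ[ℚ] A.carrier →ₗ[ℚ] carrier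
  act_one : ∀ m, act m 1 = m
  act_mul : ∀ m a b, act m (a * b) = act (act m a) b
  act_mem : ∀ i j, ∀ m ∈ gr i, ∀ a ∈ A.gr j, act m a ∈ gr (i + j)
  d : carrier →ₗ[ℚ] carrier
  d_mem : ∀ i, ∀ m ∈ gr i, d m ∈ gr (i + 1)
  d_d : ∀ m, d (d m) = 0
  leibniz : ∀ j, ∀ m ∈ gr j, ∀ a, d (act m a) = act (d m) a + ((-1 : ℚ) ^ j) • act m (A.d a)
  -- This term twists the differential of the square-zero extension: it is d/dt for the path object
  -- and 0 for the shifted dual.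
  der : A.carrier →ₗ[ℚ] carrier
  der_mem : ∀ i, ∀ a ∈ A.gr i, der a ∈ gr (i + 1)
  der_mul : ∀ i j, ∀ a ∈ A.gr i, ∀ b ∈ A.gr j,
    der (a * b) = act (der a) b + ((-1 : ℚ) ^ (i * j)) • act (der b) a
  der_d : ∀ a, der (A.d a) + d (der a) = 0

namespace DGModule

attribute [instance] DGModule.addCommGroup DGModule.module DGModule.decomposition

variable {A : CDGA.{u}} (M : A.DGModule)

/-- The left action `a ⬝ m = (-1) ^ (|a| |m|) m ⬝ a`. -/
noncomputable def lact : A.carrier →ₗ[ℚ] M.carrier →ₗ[ℚ] M.carrier :=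
  gsum A.gr fun i => M.act.flip.compl₂ (gsum M.gr fun j => ((-1 : ℚ) ^ (i * j)) • LinearMap.id)

theorem lact_of_mem {i j : ℕ} {a : A.carrier} {m : M.carrier} (ha : a ∈ A.gr i)
    (hm : m ∈ M.gr j) : M.lact a m = ((-1 : ℚ) ^ (i * j)) • M.act m a := by
  rw [lact, gsum_of_mem A.gr _ ha, LinearMap.compl₂_apply, gsum_of_mem M.gr _ hm]
  simp

theorem lact_mem {i j : ℕ} {a : A.carrier} {m : M.carrier} (ha : a ∈ A.gr i)
    (hm : m ∈ M.gr j) : M.lact a m ∈ M.gr (i + j) := by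
  rw [M.lact_of_mem ha hm, add_comm]
  exact Submodule.smul_mem _ _ (M.act_mem j i m hm a ha)

theorem lact_one (m : M.carrier) : M.lact 1 m = m := by
  refine graded_induction M.gr (p := fun m => M.lact 1 m = m) (by simp) ?_ ?_ m
  · intro x y hx hy
    rw [map_add, hx, hy]
  · intro j x hx
    rw [M.lact_of_mem A.one_mem_gr hx, M.act_one]
    simp

theorem lact_act (a b : A.carrier) (m : M.carrier) :
    M.lact a (M.act m b) = M.act (M.lact a m) b := by
  refine graded_induction A.gr (p := fun a => M.lact a (M.act m b) = M.act (M.lact a m) b)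
    (by simp) ?_ ?_ a
  · intro x y hx hy
    simp only [map_add, LinearMap.add_apply, hx, hy]
  intro i a ha
  refine graded_induction A.gr (p := fun b => M.lact a (M.act m b) = M.act (M.lact a m) b)
    (by simp) ?_ ?_ b
  · intro x y hx hy
    simp only [map_add, hx, hy]
  intro j b hb
  refine graded_induction M.gr (p := fun m => M.lact a (M.act m b) = M.act (M.lact a m) b)
    (by simp) ?_ ?_ m
  · intro x y hx hy
    simp only [map_add, LinearMap.add_apply, hx, hy]
  intro k m hm
  rw [M.lact_of_mem ha hm, M.lact_of_mem ha (M.act_mem k j m hm b hb), ← M.act_mul,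
    A.gr_comm j i b a hb ha, map_smul, map_smul, LinearMap.smul_apply, M.act_mul, smul_smul,
    ← pow_add]
  congr 1
  rw [show i * (k + j) + j * i = i * k + 2 * (i * j) by ring, pow_add, pow_mul (-1 : ℚ) 2]
  simp

theorem lact_mul (a b : A.carrier) (m : M.carrier) :
    M.lact (a * b) m = M.lact a (M.lact b m) := by
  refine graded_induction A.gr (p := fun a => M.lact (a * b) m = M.lact a (M.lact b m))
    (by simp) ?_ ?_ a
  · intro x y hx hy
    simp only [add_mul, map_add, LinearMap.add_apply, hx, hy]
  intro i a ha
  refine graded_induction A.gr (p := fun b => M.lact (a * b) m = M.lact a (M.lact b m))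
    (by simp) ?_ ?_ b
  · intro x y hx hy
    simp only [mul_add, map_add, LinearMap.add_apply, hx, hy]
  intro j b hb
  refine graded_induction M.gr (p := fun m => M.lact (a * b) m = M.lact a (M.lact b m))
    (by simp) ?_ ?_ m
  · intro x y hx hy
    simp only [map_add, hx, hy]
  intro k m hm
  rw [M.lact_of_mem (A.mul_mem_gr ha hb) hm, M.lact_of_mem hb hm, map_smul,
    M.lact_of_mem ha (M.act_mem k j m hm b hb), ← M.act_mul,
    A.gr_comm j i b a hb ha, map_smul, smul_smul, smul_smul, ← pow_add, ← pow_add]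
  congr 1
  rw [show j * k + i * (k + j) + j * i = (i + j) * k + 2 * (i * j) by ring, pow_add _ _ (2 * _),
    pow_mul (-1 : ℚ) 2]
  simp

/-- The underlying vector space of the square-zero extension. -/
@[ext]
structure Ext where
  fst : A.carrier
  snd : M.carrier

/-- The elements of the square-zero extension are pairs. -/
def extEquiv : M.Ext ≃ A.carrier × M.carrier where
  toFun x := (x.fst, x.snd)
  invFun x := ⟨x.1, x.2⟩
  left_inv _ := rfl
  right_inv _ := rfl

noncomputable instance : AddCommGroup M.Ext := M.extEquiv.addCommGroup

noncomputable instance : Module ℚ M.Ext := M.extEquiv.module ℚ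

noncomputable instance : Mul M.Ext where
  mul x y := ⟨x.fst * y.fst, M.act x.snd y.fst + M.lact x.fst y.snd⟩

noncomputable instance : One M.Ext where
  one := ⟨1, 0⟩

@[simp] theorem Ext.fst_mul (x y : M.Ext) : (x * y).fst = x.fst * y.fst := rfl
@[simp] theorem Ext.snd_mul (x y : M.Ext) :
    (x * y).snd = M.act x.snd y.fst + M.lact x.fst y.snd := rfl
@[simp] theorem Ext.fst_one : (1 : M.Ext).fst = 1 := rfl
@[simp] theorem Ext.snd_one : (1 : M.Ext).snd = 0 := rfl
@[simp] theorem Ext.fst_zero : (0 : M.Ext).fst = 0 := rfl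
@[simp] theorem Ext.snd_zero : (0 : M.Ext).snd = 0 := rfl
@[simp] theorem Ext.fst_add (x y : M.Ext) : (x + y).fst = x.fst + y.fst := rfl
@[simp] theorem Ext.snd_add (x y : M.Ext) : (x + y).snd = x.snd + y.snd := rfl
@[simp] theorem Ext.fst_smul (r : ℚ) (x : M.Ext) : (r • x).fst = r • x.fst := rfl
@[simp] theorem Ext.snd_smul (r : ℚ) (x : M.Ext) : (r • x).snd = r • x.snd := rfl

noncomputable instance : Ring M.Ext :=
  { (inferInstance : AddCommGroup M.Ext), (inferInstance : Mul M.Ext),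
    (inferInstance : One M.Ext) with
    mul_assoc := fun x y z => by
      ext
      · simp [mul_assoc]
      · simp only [Ext.snd_mul, Ext.fst_mul, map_add, LinearMap.add_apply, M.act_mul, M.lact_act,
          M.lact_mul]
        abel
    one_mul := fun x => by ext <;> simp [M.lact_one]
    mul_one := fun x => by ext <;> simp [M.act_one]
    left_distrib := fun x y z => by
      ext
      · simp [mul_add]
      · simp only [Ext.snd_mul, Ext.fst_add, Ext.snd_add, map_add]
        abel
    right_distrib := fun x y z => by
      ext
      · simp [add_mul]
      · simp only [Ext.snd_mul, Ext.fst_add, Ext.snd_add, map_add, LinearMap.add_apply]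
        abel
    zero_mul := fun x => by ext <;> simp
    mul_zero := fun x => by ext <;> simp
    zsmul := (inferInstance : AddCommGroup M.Ext).zsmul }

noncomputable instance : Algebra ℚ M.Ext :=
  Algebra.ofModule
    (fun r x y => by ext <;> simp)
    (fun r x y => by ext <;> simp)

/-- The first projection. -/
noncomputable def extFstₗ : M.Ext →ₗ[ℚ] A.carrier where
  toFun x := x.fst
  map_add' _ _ := rfl
  map_smul' _ _ := rfl

/-- The second projection. -/
noncomputable def extSndₗ : M.Ext →ₗ[ℚ] M.carrier where
  toFun x := x.snd
  map_add' _ _ := rfl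
  map_smul' _ _ := rfl

/-- The linear map to the square-zero extension with given components. -/
noncomputable def extPair {V : Type*} [AddCommGroup V] [Module ℚ V] (f : V →ₗ[ℚ] A.carrier)
    (g : V →ₗ[ℚ] M.carrier) : V →ₗ[ℚ] M.Ext where
  toFun x := ⟨f x, g x⟩
  map_add' x y := by ext <;> simp
  map_smul' r x := by ext <;> simp

/-- The components of the square-zero extension. -/
noncomputable def extGr (i : ℕ) : Submodule ℚ M.Ext :=
  (A.gr i).comap M.extFstₗ ⊓ (M.gr i).comap M.extSndₗ

theorem extGr_isInternal : DirectSum.IsInternal M.extGr := by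
  refine isInternal_of_proj M.extGr
    (fun i => M.extPair (A.pr i ∘ₗ M.extFstₗ) (gpr M.gr i ∘ₗ M.extSndₗ)) ?_ ?_ ?_
  · intro i x hx
    exact Ext.ext (gpr_of_mem _ hx.1) (gpr_of_mem _ hx.2)
  · intro i j hij x hx
    exact Ext.ext (gpr_of_mem_ne _ hx.1 hij) (gpr_of_mem_ne _ hx.2 hij)
  · intro x
    have h1 : M.extPair LinearMap.id 0 x.fst ∈ ⨆ i, M.extGr i := by
      obtain ⟨s, hs⟩ := sum_gpr A.gr x.fst
      rw [hs, map_sum]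
      exact sum_mem fun i _ => Submodule.mem_iSup_of_mem i ⟨A.pr_mem i x.fst, zero_mem (M.gr i)⟩
    have h2 : M.extPair 0 LinearMap.id x.snd ∈ ⨆ i, M.extGr i := by
      obtain ⟨s, hs⟩ := sum_gpr M.gr x.snd
      rw [hs, map_sum]
      exact sum_mem fun i _ => Submodule.mem_iSup_of_mem i
        ⟨zero_mem (A.gr i), gpr_mem M.gr i x.snd⟩
    have h3 : x = M.extPair LinearMap.id 0 x.fst + M.extPair 0 LinearMap.id x.snd :=
      Ext.ext (add_zero x.fst).symm (zero_add x.snd).symm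
    rw [h3]
    exact add_mem h1 h2

noncomputable instance : GradedAlgebra M.extGr :=
  { M.extGr_isInternal.chooseDecomposition with
    one_mem := ⟨A.one_mem_gr, zero_mem (M.gr 0)⟩
    mul_mem := fun i j _ _ hx hy => ⟨A.mul_mem_gr hx.1 hy.1,
      add_mem (M.act_mem i j _ hx.2 _ hy.1) (M.lact_mem hx.1 hy.2)⟩ }

/-- The differential of the square-zero extension, `(a, m) ↦ (d a, der a + d m)`. -/
noncomputable def extD : M.Ext →ₗ[ℚ] M.Ext :=
  M.extPair (A.d ∘ₗ M.extFstₗ) (M.der ∘ₗ M.extFstₗ + M.d ∘ₗ M.extSndₗ)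

@[simp] theorem extD_fst (x : M.Ext) : (M.extD x).fst = A.d x.fst := rfl
@[simp] theorem extD_snd (x : M.Ext) : (M.extD x).snd = M.der x.fst + M.d x.snd := rfl

/-- Both factors are homogeneous because the left action is defined through signs; `ext` extends the
rule to all y by additivity. -/
theorem ext_leibniz (i j : ℕ) (x y : M.Ext) (hx : x ∈ M.extGr i) (hy : y ∈ M.extGr j) :
    M.extD (x * y) = M.extD x * y + ((-1 : ℚ) ^ i) • (x * M.extD y) := by
  obtain ⟨a, m⟩ := x
  obtain ⟨b, p⟩ := y
  obtain ⟨ha, hm⟩ : a ∈ A.gr i ∧ m ∈ M.gr i := hx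
  obtain ⟨hb, hp⟩ : b ∈ A.gr j ∧ p ∈ M.gr j := hy
  refine Ext.ext (A.leibniz i a b ha) ?_
  simp only [extD_fst, extD_snd, Ext.fst_mul, Ext.snd_mul, Ext.snd_add, Ext.snd_smul]
  rw [map_add M.d, M.der_mul i j a ha b hb, M.leibniz i m hm, M.lact_of_mem ha hp, map_smul,
    M.leibniz j p hp, M.lact_of_mem (A.d_mem _ _ ha) hp,
    M.lact_of_mem ha (add_mem (M.der_mem _ _ hb) (M.d_mem _ _ hp))]
  have e1 : ((-1 : ℚ) ^ ((i + 1) * j)) = (-1) ^ (i * j) * (-1) ^ j := by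
    rw [← pow_add]; ring_nf
  have e2 : ((-1 : ℚ) ^ i) * (-1) ^ (i * (j + 1)) = (-1) ^ (i * j) := by
    rw [← pow_add, show i + i * (j + 1) = i * j + 2 * i by ring, pow_add, pow_mul (-1 : ℚ) 2]
    simp
  rw [smul_add ((-1 : ℚ) ^ i), smul_smul _ _ (M.act (M.der b + M.d p) a), e1, e2]
  simp only [map_add, LinearMap.add_apply, smul_add, smul_smul]
  abel

/-- The square-zero extension of a CDGA by a module. -/
noncomputable def ext : CDGA.{u} where
  carrier := M.Ext
  gr := M.extGr
  d := M.extD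
  d_mem i x hx := ⟨A.d_mem i _ hx.1, add_mem (M.der_mem i _ hx.1) (M.d_mem i _ hx.2)⟩
  d_d x := by
    ext
    · simp [A.d_d]
    · simp [M.d_d, M.der_d]
  leibniz i x y hx := by
    refine graded_induction M.extGr (p := fun y =>
      M.extD (x * y) = M.extD x * y + ((-1 : ℚ) ^ i) • (x * M.extD y)) (by simp) ?_ ?_ y
    · intro y z hy hz
      rw [mul_add, map_add, hy, hz, map_add, mul_add, mul_add, smul_add]
      abel
    · intro j y hy
      exact M.ext_leibniz i j x y hx hy
  gr_comm i j x y hx hy := by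
    refine Ext.ext (A.gr_comm i j _ _ hx.1 hy.1) ?_
    simp only [Ext.snd_mul, Ext.snd_smul]
    rw [M.lact_of_mem (show x.fst ∈ A.gr i from hx.1) (show y.snd ∈ M.gr j from hy.2),
      M.lact_of_mem (show y.fst ∈ A.gr j from hy.1) (show x.snd ∈ M.gr i from hx.2), smul_add,
      mul_comm j i,
      neg_one_pow_smul_smul, add_comm]

/-- The projection of the square-zero extension. -/
noncomputable def extFst : Hom M.ext A where
  toAlgHom := AlgHom.ofLinearMap M.extFstₗ rfl fun _ _ => rfl
  map_gr _ _ hx := hx.1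
  map_d _ := rfl

/-- The morphism to the square-zero extension given by a morphism killed by the derivation. -/
noncomputable def extInl {X : CDGA.{u}} (f : Hom X A) (h : ∀ x, M.der (f.toAlgHom x) = 0) :
    Hom X M.ext where
  toAlgHom := AlgHom.ofLinearMap (M.extPair f.toAlgHom.toLinearMap 0)
    (Ext.ext (map_one f.toAlgHom) rfl) fun x y => by
      refine Ext.ext (map_mul f.toAlgHom x y) ?_
      change (0 : M.carrier) = M.act 0 _ + M.lact _ 0
      simp
  map_gr i x hx := ⟨f.map_gr i x hx, zero_mem (M.gr i)⟩
  map_d x := by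
    refine Ext.ext (f.map_d x) ?_
    change (0 : M.carrier) = M.der (f.toAlgHom x) + M.d 0
    rw [h, map_zero, add_zero]

end DGModule

/-! ### Polynomial paths -/

section Path

open Polynomial

/-- Application of a linear map to all coefficients. -/
noncomputable def coeffMap {R : Type*} [Ring R] [Algebra ℚ R] (L : R →ₗ[ℚ] R) :
    R[X] →ₗ[ℚ] R[X] :=
  Polynomial.lsum fun n => (Polynomial.monomial n).restrictScalars ℚ ∘ₗ L

theorem coeff_coeffMap {R : Type*} [Ring R] [Algebra ℚ R] (L : R →ₗ[ℚ] R) (p : R[X]) (n : ℕ) :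
    (coeffMap L p).coeff n = L (p.coeff n) := by
  induction p using Polynomial.induction_on' with
  | add p q hp hq => rw [map_add, coeff_add, hp, hq, coeff_add, map_add]
  | monomial m a =>
    rw [coeffMap, Polynomial.lsum_apply, Polynomial.sum_monomial_index _ _ (by simp)]
    simp only [LinearMap.comp_apply, LinearMap.restrictScalars_apply, coeff_monomial]
    split_ifs <;> simp

/-- The formal antiderivative. -/
noncomputable def antideriv {R : Type*} [Ring R] [Algebra ℚ R] : R[X] →ₗ[ℚ] R[X] :=
  Polynomial.lsum fun n => ((n + 1 : ℚ)⁻¹) • (Polynomial.monomial (n + 1)).restrictScalars ℚ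

theorem coeff_antideriv_succ {R : Type*} [Ring R] [Algebra ℚ R] (p : R[X]) (n : ℕ) :
    (antideriv p).coeff (n + 1) = ((n + 1 : ℚ)⁻¹) • p.coeff n := by
  induction p using Polynomial.induction_on' with
  | add p q hp hq => rw [map_add, coeff_add, hp, hq, coeff_add, smul_add]
  | monomial m a =>
    rw [antideriv, Polynomial.lsum_apply, Polynomial.sum_monomial_index _ _ (by simp)]
    simp only [LinearMap.smul_apply, LinearMap.restrictScalars_apply, coeff_smul, coeff_monomial,
      add_left_inj]
    split_ifs with h
    · rw [h]
    · simp

theorem coeff_antideriv_zero {R : Type*} [Ring R] [Algebra ℚ R] (p : R[X]) :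
    (antideriv p).coeff 0 = 0 := by
  induction p using Polynomial.induction_on' with
  | add p q hp hq => rw [map_add, coeff_add, hp, hq, add_zero]
  | monomial m a =>
    rw [antideriv, Polynomial.lsum_apply, Polynomial.sum_monomial_index _ _ (by simp)]
    simp [coeff_monomial]

theorem derivative_antideriv {R : Type*} [Ring R] [Algebra ℚ R] (p : R[X]) :
    derivative (antideriv p) = p := by
  ext n
  rw [coeff_derivative, coeff_antideriv_succ]
  have h : ((n : R) + 1) = algebraMap ℚ R (n + 1) := by simp
  rw [h, ← Algebra.commutes, ← Algebra.smul_def, smul_smul, mul_inv_cancel₀ (by positivity),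
    one_smul]

variable (B : CDGA.{u})

/-- The polynomials with coefficients of degree `i`. -/
noncomputable def polyGr (i : ℕ) : Submodule ℚ B.carrier[X] :=
  ⨅ n, (B.gr i).comap ((Polynomial.lcoeff B.carrier n).restrictScalars ℚ)

theorem mem_polyGr {i : ℕ} {p : B.carrier[X]} : p ∈ B.polyGr i ↔ ∀ n, p.coeff n ∈ B.gr i := by
  simp [polyGr, Submodule.mem_iInf]

theorem polyGr_isInternal : DirectSum.IsInternal B.polyGr := by
  refine isInternal_of_proj B.polyGr (fun i => coeffMap (B.pr i)) ?_ ?_ ?_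
  · intro i p hp
    ext n
    rw [coeff_coeffMap, gpr_of_mem _ (B.mem_polyGr.1 hp n)]
  · intro i j hij p hp
    ext n
    rw [coeff_coeffMap, gpr_of_mem_ne _ (B.mem_polyGr.1 hp n) hij, coeff_zero]
  · intro p
    induction p using Polynomial.induction_on' with
    | add p q hp hq => exact add_mem hp hq
    | monomial m a =>
      obtain ⟨s, hs⟩ := sum_gpr B.gr a
      rw [hs, map_sum]
      refine sum_mem fun i _ => Submodule.mem_iSup_of_mem i (B.mem_polyGr.2 fun n => ?_)
      rw [coeff_monomial]
      split_ifs
      · exact B.pr_mem i a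
      · exact zero_mem _

theorem polyGr_mul_mem {i j : ℕ} {p q : B.carrier[X]} (hp : p ∈ B.polyGr i)
    (hq : q ∈ B.polyGr j) : p * q ∈ B.polyGr (i + j) := by
  rw [mem_polyGr] at *
  intro n
  rw [coeff_mul]
  exact sum_mem fun k _ => B.mul_mem_gr (hp k.1) (hq k.2)

noncomputable instance : GradedAlgebra B.polyGr :=
  { B.polyGr_isInternal.chooseDecomposition with
    one_mem := B.mem_polyGr.2 fun n => by
      rw [coeff_one]
      split_ifs
      · exact B.one_mem_gr
      · exact zero_mem _
    mul_mem := fun _ _ _ _ hx hy => B.polyGr_mul_mem hx hy }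

theorem poly_leibniz {i : ℕ} {p q : B.carrier[X]} (hp : p ∈ B.polyGr i) :
    coeffMap B.d (p * q) = coeffMap B.d p * q + ((-1 : ℚ) ^ i) • (p * coeffMap B.d q) := by
  ext n
  rw [coeff_coeffMap, coeff_add, coeff_smul, coeff_mul, coeff_mul, coeff_mul, map_sum,
    Finset.smul_sum, ← Finset.sum_add_distrib]
  refine Finset.sum_congr rfl fun k _ => ?_
  rw [B.leibniz i _ _ (B.mem_polyGr.1 hp k.1), coeff_coeffMap, coeff_coeffMap]

theorem poly_gr_comm {i j : ℕ} {p q : B.carrier[X]} (hp : p ∈ B.polyGr i)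
    (hq : q ∈ B.polyGr j) : p * q = ((-1 : ℚ) ^ (i * j)) • (q * p) := by
  ext n
  rw [coeff_smul, coeff_mul, coeff_mul, ← Finset.Nat.sum_antidiagonal_swap, Finset.smul_sum]
  refine Finset.sum_congr rfl fun k _ => ?_
  exact B.gr_comm i j _ _ (B.mem_polyGr.1 hp _) (B.mem_polyGr.1 hq _)

theorem coeffMap_d_mem {i : ℕ} {p : B.carrier[X]} (hp : p ∈ B.polyGr i) :
    coeffMap B.d p ∈ B.polyGr (i + 1) := by
  rw [mem_polyGr] at *
  intro n
  rw [coeff_coeffMap]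
  exact B.d_mem i _ (hp n)

theorem coeffMap_d_d (p : B.carrier[X]) : coeffMap B.d (coeffMap B.d p) = 0 := by
  ext n
  rw [coeff_coeffMap, coeff_coeffMap, B.d_d, coeff_zero]

/-- The CDGA `B[t]`. -/
noncomputable def poly : CDGA.{u} where
  carrier := B.carrier[X]
  gr := B.polyGr
  d := coeffMap B.d
  d_mem _ _ hx := B.coeffMap_d_mem hx
  d_d := B.coeffMap_d_d
  leibniz _ _ _ hx := B.poly_leibniz hx
  gr_comm _ _ _ _ hx hy := B.poly_gr_comm hx hy

/-- The components of `dt B[t]`. -/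
noncomputable def pathModuleGr : ℕ → Submodule ℚ B.carrier[X]
  -- The factor dt has degree one, hence the shift by one.
  | 0 => ⊥
  | i + 1 => B.polyGr i

theorem pathModuleGr_isInternal : DirectSum.IsInternal B.pathModuleGr := by
  refine isInternal_of_proj B.pathModuleGr
    (fun i => match i with
      | 0 => 0
      | i + 1 => coeffMap (B.pr i)) ?_ ?_ ?_
  · rintro (_ | i) p hp
    · rw [(Submodule.mem_bot ℚ).1 hp, map_zero]
    · ext n
      simp only
      rw [coeff_coeffMap, gpr_of_mem _ (B.mem_polyGr.1 hp n)]
  · rintro (_ | i) (_ | j) hij p hp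
    · exact absurd rfl hij
    · rw [(Submodule.mem_bot ℚ).1 hp, map_zero]
    · rfl
    · ext n
      simp only
      rw [coeff_coeffMap, gpr_of_mem_ne _ (B.mem_polyGr.1 hp n) (by omega), coeff_zero]
  · intro p
    have h : ⨆ i, B.polyGr i ≤ ⨆ i, B.pathModuleGr i :=
      iSup_le fun i => le_iSup B.pathModuleGr (i + 1)
    refine h ?_
    rw [B.polyGr_isInternal.submodule_iSup_eq_top]
    exact Submodule.mem_top

noncomputable instance : DirectSum.Decomposition B.pathModuleGr :=
  B.pathModuleGr_isInternal.chooseDecomposition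

theorem derivative_mem_polyGr {i : ℕ} {p : B.carrier[X]} (hp : p ∈ B.polyGr i) :
    derivative p ∈ B.polyGr i := by
  rw [mem_polyGr] at *
  intro n
  rw [coeff_derivative]
  have h : ((n : B.carrier) + 1) = algebraMap ℚ B.carrier (n + 1) := by simp
  rw [h, ← Algebra.commutes, ← Algebra.smul_def]
  exact Submodule.smul_mem _ _ (hp _)

theorem derivative_coeffMap_d (p : B.carrier[X]) :
    derivative (coeffMap B.d p) = coeffMap B.d (derivative p) := by
  ext n
  rw [coeff_derivative, coeff_coeffMap, coeff_coeffMap, coeff_derivative]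
  have h : ((n : B.carrier) + 1) = algebraMap ℚ B.carrier (n + 1) := by simp
  rw [h, ← Algebra.commutes, ← Algebra.smul_def, ← Algebra.commutes, ← Algebra.smul_def, map_smul]

/-- The module `dt B[t]` over `B[t]`, with the derivation `p ↦ dt p'`. -/
noncomputable def pathModule : B.poly.DGModule where
  carrier := B.carrier[X]
  gr := B.pathModuleGr
  act := LinearMap.mul ℚ B.carrier[X]
  act_one m := mul_one m
  act_mul m a b := (mul_assoc m a b).symm
  act_mem := by
    rintro (_ | i) j m hm (a : B.carrier[X]) ha
    · change (m * a : B.carrier[X]) ∈ _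
      rw [(Submodule.mem_bot ℚ).1 hm, zero_mul]
      exact zero_mem _
    · rw [Nat.add_right_comm]
      exact B.polyGr_mul_mem hm ha
  -- The sign is that of d (dt p) = - dt (d p). With dt written on the left, the derivation p ↦ dt
  -- p' needs no sign.
  d := - coeffMap B.d
  d_mem := by
    rintro (_ | i) m hm
    · rw [(Submodule.mem_bot ℚ).1 hm, map_zero]
      exact zero_mem _
    · exact neg_mem (B.coeffMap_d_mem hm)
  d_d m := by
    rw [LinearMap.neg_apply, LinearMap.neg_apply, map_neg, B.coeffMap_d_d, neg_zero, neg_zero]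
  leibniz := by
    rintro (_ | i) m hm (a : B.carrier[X])
    · change -coeffMap B.d (m * a) = -coeffMap B.d m * a + ((-1 : ℚ) ^ 0) • (m * coeffMap B.d a)
      rw [(Submodule.mem_bot ℚ).1 hm]
      simp
    · change -coeffMap B.d (m * a) = -coeffMap B.d m * a + ((-1 : ℚ) ^ (i + 1)) •
        (m * coeffMap B.d a)
      rw [B.poly_leibniz hm, pow_succ, neg_add, neg_mul]
      simp
  der := (derivative : B.carrier[X] →ₗ[B.carrier] B.carrier[X]).restrictScalars ℚ
  der_mem i a ha := B.derivative_mem_polyGr ha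
  der_mul := by
    intro i j (a : B.carrier[X]) ha (b : B.carrier[X]) hb
    change derivative (a * b) = derivative a * b + ((-1 : ℚ) ^ (i * j)) • (derivative b * a)
    rw [derivative_mul, ← B.poly_gr_comm ha (B.derivative_mem_polyGr hb)]
  der_d := by
    intro (a : B.carrier[X])
    change derivative (coeffMap B.d a) + -coeffMap B.d (derivative a) = 0
    rw [B.derivative_coeffMap_d, add_neg_cancel]

/-- Evaluation of polynomials at a rational number. -/
noncomputable def polyEvalAlg (r : ℚ) : B.carrier[X] →ₐ[ℚ] B.carrier :=
  Polynomial.eval₂AlgHom (AlgHom.id ℚ B.carrier) (algebraMap ℚ B.carrier r)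
    fun a => (Algebra.commutes r a).symm

theorem polyEvalAlg_monomial (r : ℚ) (n : ℕ) (a : B.carrier) :
    B.polyEvalAlg r (monomial n a) = (r ^ n) • a := by
  change Polynomial.eval₂ _ _ _ = _
  rw [eval₂_monomial, ← map_pow, ← Algebra.commutes, ← Algebra.smul_def]
  rfl

theorem polyEvalAlg_C (r : ℚ) (a : B.carrier) : B.polyEvalAlg r (C a) = a := by
  rw [← monomial_zero_left, polyEvalAlg_monomial, pow_zero, one_smul]

/-- Evaluation `B[t] → B` at a rational number. -/
noncomputable def polyEval (r : ℚ) : Hom B.poly B where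
  toAlgHom := B.polyEvalAlg r
  map_gr := by
    intro i (p : B.carrier[X]) hp
    change B.polyEvalAlg r p ∈ _
    have h : B.polyEvalAlg r p = ∑ n ∈ p.support, (r ^ n) • p.coeff n := by
      conv_lhs => rw [p.as_sum_support]
      rw [map_sum]
      exact Finset.sum_congr rfl fun n _ => B.polyEvalAlg_monomial r n _
    rw [h]
    exact sum_mem fun n _ => Submodule.smul_mem _ _ (B.mem_polyGr.1 hp n)
  map_d := by
    intro (p : B.carrier[X])
    change B.polyEvalAlg r (coeffMap B.d p) = B.d (B.polyEvalAlg r p)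
    induction p using Polynomial.induction_on' with
    | add p q hp hq => rw [map_add, map_add, hp, hq, map_add, map_add]
    | monomial m a =>
      have h : coeffMap B.d (monomial m a) = monomial m (B.d a) := by
        ext n
        rw [coeff_coeffMap, coeff_monomial, coeff_monomial]
        split_ifs <;> simp
      rw [h, polyEvalAlg_monomial, polyEvalAlg_monomial, map_smul]

/-- The inclusion of the constant polynomials. -/
noncomputable def polyC : Hom B B.poly where
  toAlgHom := Polynomial.CAlgHom
  map_gr i b hb := B.mem_polyGr.2 fun n => by
    change (C b).coeff n ∈ _
    rw [coeff_C]
    split_ifs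
    · exact hb
    · exact zero_mem _
  map_d b := by
    change C (B.d b) = coeffMap B.d (C b)
    ext n
    rw [coeff_coeffMap, coeff_C, coeff_C]
    split_ifs <;> simp

/-- The path object `B[t, dt]`. -/
noncomputable def path : CDGA.{u} := B.pathModule.ext

/-- Evaluation of paths at a rational number. -/
noncomputable def pathEval (r : ℚ) : Hom B.path B := (B.polyEval r).comp B.pathModule.extFst

/-- The constant paths. -/
noncomputable def pathConst : Hom B B.path :=
  B.pathModule.extInl B.polyC fun b => derivative_C (R := B.carrier) (a := b)

theorem pathEval_const (r : ℚ) (b : B.carrier) :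
    (B.pathEval r).toAlgHom (B.pathConst.toAlgHom b) = b := B.polyEvalAlg_C r b

theorem polyEvalAlg_zero (p : B.carrier[X]) : B.polyEvalAlg 0 p = p.coeff 0 := by
  induction p using Polynomial.induction_on' with
  | add p q hp hq => rw [map_add, hp, hq, coeff_add]
  | monomial m a =>
    rw [polyEvalAlg_monomial, coeff_monomial]
    split_ifs with h
    · rw [h, pow_zero, one_smul]
    · rw [zero_pow h, zero_smul]

/-- Poincaré lemma for the interval: closedness of p + dt q gives p' = d q, so if p(0) = d w then
the primitive is w plus the integral of q from 0. -/
theorem pathEval_zero_isQuasiIso : (B.pathEval 0).IsQuasiIso := by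
  rw [Hom.isQuasiIso_iff]
  constructor
  · rintro ⟨(p : B.carrier[X]), (q : B.carrier[X])⟩ hd ⟨w, hw⟩
    replace hw : B.d w = B.polyEvalAlg 0 p := hw
    have hd2 : derivative p + -coeffMap B.d q = 0 := congrArg DGModule.Ext.snd hd
    refine ⟨⟨antideriv q + C w, (0 : B.carrier[X])⟩, ?_⟩
    refine DGModule.Ext.ext ?_ ?_
    · change coeffMap B.d (antideriv q + C w) = p
      ext n
      rw [coeff_coeffMap, coeff_add, coeff_C]
      rcases n with _ | n
      · rw [coeff_antideriv_zero, zero_add, if_pos rfl, hw, polyEvalAlg_zero]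
      · rw [coeff_antideriv_succ, if_neg (Nat.succ_ne_zero n), add_zero, map_smul,
          ← coeff_coeffMap, ← eq_of_sub_eq_zero ((sub_eq_add_neg _ _).trans hd2), coeff_derivative]
        have h : ((n : B.carrier) + 1) = algebraMap ℚ B.carrier (n + 1) := by simp
        rw [h, ← Algebra.commutes, ← Algebra.smul_def, smul_smul, inv_mul_cancel₀ (by positivity),
          one_smul]
    · change derivative (antideriv q + C w) + -coeffMap B.d 0 = q
      rw [map_zero, neg_zero, add_zero, map_add, derivative_antideriv, derivative_C, add_zero]
  · intro y hy
    refine ⟨B.pathConst.toAlgHom y, ?_, 0, ?_⟩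
    · rw [← B.pathConst.map_d, hy, map_zero]
    · rw [pathEval_const, sub_self, map_zero]

theorem exists_path (b : B.carrier) :
    ∃ γ, (B.pathEval 0).toAlgHom γ = 0 ∧ (B.pathEval 1).toAlgHom γ = b := by
  refine ⟨⟨monomial 1 b, (0 : B.carrier[X])⟩, ?_, ?_⟩
  · change B.polyEvalAlg 0 (monomial 1 b) = 0
    rw [polyEvalAlg_monomial]; simp
  · change B.polyEvalAlg 1 (monomial 1 b) = b
    rw [polyEvalAlg_monomial]; simp

/-- Every morphism factors as a section of a quasi-isomorphism followed by a surjection. -/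
theorem exists_surjective_factorization {A B : CDGA.{u}} (ψ : Hom A B) :
    ∃ (X : CDGA.{u}) (i : Hom A X) (r : Hom X A) (φ : Hom X B),
      i.IsQuasiIso ∧ r.IsQuasiIso ∧ φ.Surjective ∧ φ.comp i = ψ := by
  -- The intermediate object consists of pairs (a, γ) with γ a path in B starting at ψ a. Its map to
  -- B is the endpoint of γ, which is onto because the path t b starts at 0 and ends at b.
  have hr : (pullbackFst ψ (B.pathEval 0)).IsQuasiIso := by
    refine pullbackFst_isQuasiIso _ _ B.pathEval_zero_isQuasiIso fun b => ?_
    refine ⟨0, B.pathConst.toAlgHom (-b), ?_⟩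
    rw [pathEval_const, map_zero, zero_sub, neg_neg]
  have hc : ψ.comp (Hom.id A) = (B.pathEval 0).comp (B.pathConst.comp ψ) := by
    ext x
    exact (B.pathEval_const 0 _).symm
  refine ⟨pullback ψ (B.pathEval 0), pullbackLift _ _ (Hom.id A) (B.pathConst.comp ψ) hc,
    pullbackFst _ _, (B.pathEval 1).comp (pullbackSnd _ _), ?_, hr, ?_, ?_⟩
  · refine Hom.isQuasiIso_of_section hr ?_
    ext x
    rfl
  · intro b
    obtain ⟨γ, h0, h1⟩ := B.exists_path b
    exact ⟨pullbackPair _ _ 0 γ (by rw [h0, map_zero]), h1⟩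
  · ext x
    exact B.pathEval_const 1 _

end Path

/-! ### Contractions -/

/-- A contraction of a CDGA onto a space of representatives of its cohomology. -/
structure Contraction (A : CDGA.{u}) where
  h : A.carrier →ₗ[ℚ] A.carrier
  h_mem : ∀ i, ∀ x ∈ A.gr (i + 1), h x ∈ A.gr i
  h_zero : ∀ x ∈ A.gr 0, h x = 0
  -- By the last three identities d h, h d and id - d h - h d are complementary projections, so A is
  -- the direct sum of im d, im h and ker d ∩ ker h.
  d_h_d : ∀ x, A.d (h (A.d x)) = A.d x
  h_d_h : ∀ x, h (A.d (h x)) = h x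
  h_h : ∀ x, h (h x) = 0

/-- Any linear g with d g d = d works after three corrections: `h1` keeps the part of g of degree
-1, `h2` = h1 d h1 satisfies h2 d h2 = h2, and `h3` = h2 - h2 h2 d moreover squares to zero. -/
theorem exists_contraction (A : CDGA.{u}) : Nonempty A.Contraction := by
  obtain ⟨s, hs⟩ := A.d.rangeRestrict.exists_rightInverse_of_surjective A.d.range_rangeRestrict
  obtain ⟨g, hg⟩ := LinearMap.exists_extend s
  have hg' : ∀ x, A.d (g (A.d x)) = A.d x := by
    intro x
    have h1 := LinearMap.congr_fun hg ⟨A.d x, x, rfl⟩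
    have h2 := congrArg Subtype.val (LinearMap.congr_fun hs ⟨A.d x, x, rfl⟩)
    simp only [LinearMap.comp_apply, Submodule.subtype_apply] at h1
    rw [h1]
    exact h2
  let h1 : A.carrier →ₗ[ℚ] A.carrier := gsum A.gr fun i => match i with
    | 0 => 0
    | i + 1 => A.pr i ∘ₗ g
  have h1_zero : ∀ x ∈ A.gr 0, h1 x = 0 := fun x hx => gsum_of_mem A.gr _ hx
  have h1_succ : ∀ i, ∀ x ∈ A.gr (i + 1), h1 x = A.pr i (g x) := fun i x hx =>
    gsum_of_mem A.gr _ hx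
  have h1_mem : ∀ i, ∀ x ∈ A.gr (i + 1), h1 x ∈ A.gr i := by
    intro i x hx
    rw [h1_succ i x hx]
    exact A.pr_mem i _
  have h1_d : ∀ x, A.d (h1 (A.d x)) = A.d x := by
    intro x
    refine LinearMap.congr_fun (f := A.d ∘ₗ h1 ∘ₗ A.d) (g := A.d) ?_ x
    refine graded_linearMap_ext A.gr fun i x hx => ?_
    simp only [LinearMap.comp_apply]
    rw [h1_succ i _ (A.d_mem i x hx), A.d_pr, hg', gpr_of_mem _ (A.d_mem i x hx)]
  let h2 : A.carrier →ₗ[ℚ] A.carrier := h1 ∘ₗ A.d ∘ₗ h1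
  have h2_apply : ∀ x, h2 x = h1 (A.d (h1 x)) := fun _ => rfl
  have h2_zero : ∀ x ∈ A.gr 0, h2 x = 0 := fun x hx => by
    rw [h2_apply, h1_zero x hx, map_zero, map_zero]
  have h2_mem : ∀ i, ∀ x ∈ A.gr (i + 1), h2 x ∈ A.gr i := fun i x hx =>
    h1_mem i _ (A.d_mem i _ (h1_mem i x hx))
  have h2_d : ∀ x, A.d (h2 (A.d x)) = A.d x := fun x => by rw [h2_apply, h1_d, h1_d]
  have h2_h2 : ∀ x, h2 (A.d (h2 x)) = h2 x := fun x => by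
    simp only [h2_apply, h1_d]
  let h3 : A.carrier →ₗ[ℚ] A.carrier := h2 - h2 ∘ₗ h2 ∘ₗ A.d
  have h3_apply : ∀ x, h3 x = h2 x - h2 (h2 (A.d x)) := fun _ => rfl
  refine ⟨⟨h3, ?_, ?_, ?_, ?_, ?_⟩⟩
  · intro i x hx
    exact sub_mem (h2_mem i x hx) (h2_mem i _ (h2_mem (i + 1) _ (A.d_mem _ x hx)))
  · intro x hx
    rw [h3_apply, h2_zero x hx, h2_zero _ (h2_mem 0 _ (A.d_mem 0 x hx)), sub_zero]
  · intro x
    rw [h3_apply, A.d_d, map_zero, map_zero, sub_zero, h2_d]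
  · intro x
    simp only [h3_apply, map_sub, h2_h2, A.d_d, map_zero, sub_zero]
  · intro x
    simp only [h3_apply, map_sub, h2_h2]
    abel

namespace Contraction

variable {A : CDGA.{u}} (c : A.Contraction)

/-- The contraction picks a primitive of every boundary. Hence a boundary lying in a subspace stable
under h has a primitive in that subspace. -/
theorem d_h_eq {x y : A.carrier} (h : A.d y = x) : A.d (c.h x) = x := by
  rw [← h, c.d_h_d]

/-- The representatives of the cohomology classes of degree `k`. -/
noncomputable def harmonic (k : ℕ) : Submodule ℚ A.carrier :=
  A.gr k ⊓ LinearMap.ker A.d ⊓ LinearMap.ker c.h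

theorem mem_harmonic {k : ℕ} {x : A.carrier} :
    x ∈ c.harmonic k ↔ x ∈ A.gr k ∧ A.d x = 0 ∧ c.h x = 0 := by
  simp [harmonic, and_assoc]

theorem d_h_mem {k : ℕ} {x : A.carrier} (hx : x ∈ A.gr k) : A.d (c.h x) ∈ A.gr k := by
  cases k with
  | zero => rw [c.h_zero x hx, map_zero]; exact zero_mem _
  | succ k => exact A.d_mem k _ (c.h_mem k x hx)

theorem h_d_mem {k : ℕ} {x : A.carrier} (hx : x ∈ A.gr k) : c.h (A.d x) ∈ A.gr k :=
  c.h_mem k _ (A.d_mem k x hx)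

theorem sub_d_h_mem_harmonic {k : ℕ} {x : A.carrier} (hx : x ∈ A.gr k) (hd : A.d x = 0) :
    x - A.d (c.h x) ∈ c.harmonic k := by
  rw [mem_harmonic]
  refine ⟨sub_mem hx (c.d_h_mem hx), ?_, ?_⟩
  · rw [map_sub, hd, A.d_d, sub_zero]
  · rw [map_sub, c.h_d_h, sub_self]

/-- Representatives inject into cohomology: if x = d w then x = d (h x) = 0. -/
theorem harmonic_fg (hfin : A.cohomology.IsFiniteType) (k : ℕ) : (c.harmonic k).FG := by
  have := hfin k
  let f : c.harmonic k →ₗ[ℚ] A.cohomology.gr k :=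
    { toFun := fun x => ⟨A.cohomologyMk ⟨x, (c.mem_harmonic.1 x.2).2.1⟩,
        A.mk_mem_cohomologyGr k _ (c.mem_harmonic.1 x.2).1⟩
      map_add' := fun x y => Subtype.ext (map_add A.cohomologyMk
        ⟨x, (c.mem_harmonic.1 x.2).2.1⟩ ⟨y, (c.mem_harmonic.1 y.2).2.1⟩)
      map_smul' := fun r x => Subtype.ext (map_smul A.cohomologyMk r
        ⟨x, (c.mem_harmonic.1 x.2).2.1⟩) }
  have hf : Function.Injective f := by
    rw [injective_iff_map_eq_zero]
    rintro ⟨x, hx⟩ h0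
    have h1 := congrArg Subtype.val h0
    obtain ⟨w, hw⟩ := (A.cohomologyMk_eq_zero ⟨x, (c.mem_harmonic.1 hx).2.1⟩).1 h1
    apply Subtype.ext
    change x = 0
    change A.d w = x at hw
    rw [← c.d_h_eq hw, (c.mem_harmonic.1 hx).2.2, map_zero]
  rw [← Module.Finite.iff_fg]
  exact FiniteDimensional.of_injective f hf

end Contraction

/-! ### Sub-CDGAs of finite type -/

section FiniteModel

variable {X : CDGA.{u}} (c : X.Contraction) (S : ℕ → Submodule ℚ X.carrier)

/-- The elements of degree `k` to be contained in the model: prescribed elements, representatives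
of the cohomology and products. -/
noncomputable def modelGen (F : ℕ → Submodule ℚ X.carrier) (k : ℕ) : Submodule ℚ X.carrier :=
  -- Products with a factor of degree 0 or 1 bring nothing new, since the model is ℚ in degree 0 and
  -- zero in degree 1.
  if k < 2 then ⊥ else S k ⊔ c.harmonic k ⊔
    (Finset.HasAntidiagonal.antidiagonal k).sup fun p => if 2 ≤ p.1 ∧ 2 ≤ p.2 then F p.1 * F p.2 else ⊥

/-- The closure of the generators under the differential and the contraction. -/
noncomputable def modelStep (F : ℕ → Submodule ℚ X.carrier) : ℕ → Submodule ℚ X.carrier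
  | 0 => Submodule.span ℚ {1}
  | 1 => ⊥
  -- Applying id, d, h, d h and h d suffices for stability under d and h: longer words reduce by d d
  -- = 0, h h = 0, d h d = d and h d h = h.
  | k + 2 => modelGen c S F (k + 2) ⊔ (modelGen c S F (k + 1)).map X.d ⊔
      (modelGen c S F (k + 2)).map (X.d ∘ₗ c.h) ⊔ (modelGen c S F (k + 2)).map (c.h ∘ₗ X.d) ⊔
      (modelGen c S F (k + 3)).map c.h

theorem modelGen_mono (k : ℕ) : Monotone fun F => modelGen c S F k := by
  intro F F' h
  simp only [modelGen]
  split_ifs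
  · exact le_rfl
  · refine sup_le_sup_left (Finset.sup_mono_fun fun p _ => ?_) _
    split_ifs
    · exact mul_le_mul' (h _) (h _)
    · exact le_rfl

theorem modelStep_mono : Monotone (modelStep c S) := by
  intro F F' h k
  have := fun k => modelGen_mono c S k h
  rcases k with _ | _ | k
  · exact le_rfl
  · exact le_rfl
  · exact sup_le_sup (sup_le_sup (sup_le_sup (sup_le_sup (this _) (Submodule.map_mono (this _)))
      (Submodule.map_mono (this _))) (Submodule.map_mono (this _))) (Submodule.map_mono (this _))

/-- The components of the model. -/
noncomputable def model : ℕ → Submodule ℚ X.carrier :=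
  OrderHom.lfp ⟨modelStep c S, modelStep_mono c S⟩

theorem model_eq : modelStep c S (model c S) = model c S :=
  OrderHom.map_lfp ⟨modelStep c S, modelStep_mono c S⟩

theorem model_zero : model c S 0 = Submodule.span ℚ {1} := by rw [← model_eq]; rfl

theorem model_one : model c S 1 = ⊥ := by rw [← model_eq]; rfl

theorem model_add_two (k : ℕ) : model c S (k + 2) =
    modelGen c S (model c S) (k + 2) ⊔ (modelGen c S (model c S) (k + 1)).map X.d ⊔
      (modelGen c S (model c S) (k + 2)).map (X.d ∘ₗ c.h) ⊔
      (modelGen c S (model c S) (k + 2)).map (c.h ∘ₗ X.d) ⊔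
      (modelGen c S (model c S) (k + 3)).map c.h := by
  conv_lhs => rw [← model_eq]
  rfl

variable {S}

theorem modelGen_le_gr (hS : ∀ k, S k ≤ X.gr k) {F : ℕ → Submodule ℚ X.carrier}
    (hF : ∀ k, F k ≤ X.gr k) (k : ℕ) : modelGen c S F k ≤ X.gr k := by
  rw [modelGen]
  split_ifs
  · exact bot_le
  · refine sup_le (sup_le (hS k) fun x hx => (c.mem_harmonic.1 hx).1) (Finset.sup_le ?_)
    rintro ⟨i, j⟩ hp
    rw [Finset.HasAntidiagonal.mem_antidiagonal] at hp
    split_ifs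
    · rw [Submodule.mul_le]
      intro x hx y hy
      rw [← hp]
      exact X.mul_mem_gr (hF _ hx) (hF _ hy)
    · exact bot_le

theorem model_le_gr (hS : ∀ k, S k ≤ X.gr k) : ∀ k, model c S k ≤ X.gr k := by
  refine OrderHom.lfp_le (f := ⟨modelStep c S, modelStep_mono c S⟩) (a := X.gr) ?_
  have hG := modelGen_le_gr c hS (F := X.gr) fun _ => le_rfl
  rintro (_ | _ | k)
  · exact (Submodule.span_singleton_le_iff_mem _ _).2 X.one_mem_gr
  · exact bot_le
  · refine sup_le (sup_le (sup_le (sup_le (hG _) ?_) ?_) ?_) ?_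
    · exact Submodule.map_le_iff_le_comap.2 fun x hx => X.d_mem _ x (hG _ hx)
    · exact Submodule.map_le_iff_le_comap.2 fun x hx => c.d_h_mem (hG _ hx)
    · exact Submodule.map_le_iff_le_comap.2 fun x hx => c.h_d_mem (hG _ hx)
    · exact Submodule.map_le_iff_le_comap.2 fun x hx => c.h_mem _ x (hG _ hx)

theorem modelGen_le_model (k : ℕ) : modelGen c S (model c S) k ≤ model c S k := by
  rcases k with _ | _ | k
  · simp [modelGen]
  · simp [modelGen]
  · rw [model_add_two]
    exact le_sup_of_le_left (le_sup_of_le_left (le_sup_of_le_left le_sup_left))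

theorem mem_model_of_mem {k : ℕ} (hk : 2 ≤ k) {x : X.carrier} (hx : x ∈ S k) :
    x ∈ model c S k := by
  apply modelGen_le_model c
  rw [modelGen, if_neg (by omega)]
  exact Submodule.mem_sup_left (Submodule.mem_sup_left hx)

theorem harmonic_le_model {k : ℕ} (hk : 2 ≤ k) : c.harmonic k ≤ model c S k := by
  refine le_trans ?_ (modelGen_le_model c k)
  rw [modelGen, if_neg (by omega)]
  exact le_sup_of_le_left le_sup_right

theorem d_mem_model {k : ℕ} {x : X.carrier} (hx : x ∈ model c S k) :
    X.d x ∈ model c S (k + 1) := by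
  rcases k with _ | _ | k
  · rw [model_zero, Submodule.mem_span_singleton] at hx
    obtain ⟨r, rfl⟩ := hx
    rw [map_smul, X.d_one, smul_zero]
    exact zero_mem _
  · rw [model_one, Submodule.mem_bot] at hx
    rw [hx, map_zero]
    exact zero_mem _
  · revert x
    change model c S (k + 2) ≤ (model c S (k + 3)).comap X.d
    rw [model_add_two c S k]
    refine sup_le (sup_le (sup_le (sup_le ?_ ?_) ?_) ?_) ?_
    · rw [model_add_two c S (k + 1)]
      exact fun x hx => Submodule.mem_sup_left (Submodule.mem_sup_left (Submodule.mem_sup_left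
        (Submodule.mem_sup_right ⟨x, hx, rfl⟩)))
    · rintro _ ⟨x, hx, rfl⟩
      simp [X.d_d]
    · rintro _ ⟨x, hx, rfl⟩
      simp [X.d_d]
    · rintro _ ⟨x, hx, rfl⟩
      rw [Submodule.mem_comap, LinearMap.comp_apply, c.d_h_d, model_add_two c S (k + 1)]
      exact Submodule.mem_sup_left (Submodule.mem_sup_left (Submodule.mem_sup_left
        (Submodule.mem_sup_right ⟨x, hx, rfl⟩)))
    · rintro _ ⟨x, hx, rfl⟩
      rw [Submodule.mem_comap, model_add_two c S (k + 1)]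
      exact Submodule.mem_sup_left (Submodule.mem_sup_left
        (Submodule.mem_sup_right ⟨x, hx, rfl⟩))

/-- The model vanishes in degree 1, so h has to kill its degree 2. Among the generators only the
prescribed ones could fail this, as products start in degree 4. -/
theorem h_modelGen_two (hS2 : ∀ x ∈ S 2, c.h x = 0) {F : ℕ → Submodule ℚ X.carrier} :
    modelGen c S F 2 ≤ LinearMap.ker c.h := by
  rw [modelGen, if_neg (by omega)]
  refine sup_le (sup_le hS2 fun x hx => (c.mem_harmonic.1 hx).2.2) (Finset.sup_le ?_)
  rintro ⟨i, j⟩ hp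
  rw [Finset.HasAntidiagonal.mem_antidiagonal] at hp
  rw [if_neg (by simp only at hp ⊢; omega)]
  exact bot_le

theorem h_mem_model (hS2 : ∀ x ∈ S 2, c.h x = 0) {k : ℕ} {x : X.carrier}
    (hx : x ∈ model c S (k + 1)) : c.h x ∈ model c S k := by
  rcases k with _ | k
  · rw [zero_add, model_one, Submodule.mem_bot] at hx
    rw [hx, map_zero]
    exact zero_mem _
  revert x
  change model c S (k + 2) ≤ (model c S (k + 1)).comap c.h
  have hG : ∀ x ∈ modelGen c S (model c S) (k + 2), c.h x ∈ model c S (k + 1) := by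
    intro x hx
    rcases k with _ | k
    · rw [LinearMap.mem_ker.1 (h_modelGen_two c hS2 hx)]
      exact zero_mem _
    · rw [model_add_two]
      exact Submodule.mem_sup_right ⟨x, hx, rfl⟩
  rw [model_add_two c S k]
  refine sup_le (sup_le (sup_le (sup_le ?_ ?_) ?_) ?_) ?_
  · exact hG
  · rintro _ ⟨x, hx, rfl⟩
    rcases k with _ | k
    · rw [SetLike.mem_coe, modelGen, if_pos (by omega), Submodule.mem_bot] at hx
      rw [hx, map_zero]
      exact zero_mem _
    · rw [Submodule.mem_comap, model_add_two]
      exact Submodule.mem_sup_left (Submodule.mem_sup_right ⟨x, hx, rfl⟩)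
  · rintro _ ⟨x, hx, rfl⟩
    rw [Submodule.mem_comap, LinearMap.comp_apply, c.h_d_h]
    exact hG x hx
  · rintro _ ⟨x, hx, rfl⟩
    rw [Submodule.mem_comap, LinearMap.comp_apply, c.h_h]
    exact zero_mem _
  · rintro _ ⟨x, hx, rfl⟩
    rw [Submodule.mem_comap, c.h_h]
    exact zero_mem _

theorem model_isSub (hS : ∀ k, S k ≤ X.gr k) : X.IsSub (model c S) where
  le := model_le_gr c hS
  one_mem := by rw [model_zero]; exact Submodule.mem_span_singleton_self 1
  d_mem _ _ hx := d_mem_model c hx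
  mul_mem := by
    intro i j x hx y hy
    rcases i with _ | _ | i
    · rw [model_zero, Submodule.mem_span_singleton] at hx
      obtain ⟨r, rfl⟩ := hx
      rw [smul_one_mul, zero_add]
      exact Submodule.smul_mem _ _ hy
    · rw [zero_add, model_one, Submodule.mem_bot] at hx
      rw [hx, zero_mul]
      exact zero_mem _
    rcases j with _ | _ | j
    · rw [model_zero, Submodule.mem_span_singleton] at hy
      obtain ⟨r, rfl⟩ := hy
      rw [mul_smul_one, add_zero]
      exact Submodule.smul_mem _ _ hx
    · rw [zero_add, model_one, Submodule.mem_bot] at hy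
      rw [hy, mul_zero]
      exact zero_mem _
    apply modelGen_le_model c
    rw [modelGen, if_neg (by omega)]
    refine Submodule.mem_sup_right ?_
    have h := Finset.le_sup (f := fun p : ℕ × ℕ => if 2 ≤ p.1 ∧ 2 ≤ p.2 then
      model c S p.1 * model c S p.2 else ⊥) (Finset.HasAntidiagonal.mem_antidiagonal.2
        (rfl : (i + 2, j + 2).1 + (i + 2, j + 2).2 = (i + 2) + (j + 2)))
    refine h ?_
    simp only [le_add_iff_nonneg_left, zero_le, and_self, if_true]
    exact Submodule.mul_mem_mul hx hy

/-- Both factors of a product of degree k have degree at most k - 2. So even the generators of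
degree k + 3, which enter degree k + 2 through h, only involve components of degree at most k + 1;
this drives the strong induction in `model_fg`. -/
theorem modelGen_fg (hfin : ∀ k, (c.harmonic k).FG) (hSfg : ∀ k, (S k).FG)
    {F : ℕ → Submodule ℚ X.carrier} (k : ℕ) (hF : ∀ i, i + 2 ≤ k → (F i).FG) :
    (modelGen c S F k).FG := by
  rw [modelGen]
  split_ifs
  · exact Submodule.fg_bot
  · refine ((hSfg k).sup (hfin k)).sup (Submodule.fg_finset_sup _ _ ?_)
    rintro ⟨i, j⟩ hp
    rw [Finset.HasAntidiagonal.mem_antidiagonal] at hp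
    simp only at hp ⊢
    split_ifs
    · exact (hF i (by omega)).mul (hF j (by omega))
    · exact Submodule.fg_bot

theorem model_fg (hfin : ∀ k, (c.harmonic k).FG) (hSfg : ∀ k, (S k).FG) (k : ℕ) :
    (model c S k).FG := by
  induction k using Nat.strong_induction_on with
  | _ k ih =>
    rcases k with _ | _ | k
    · rw [model_zero]
      exact Submodule.fg_span_singleton 1
    · rw [zero_add, model_one]
      exact Submodule.fg_bot
    · have hG : ∀ l, l ≤ k + 3 → (modelGen c S (model c S) l).FG := fun l hl =>
        modelGen_fg c hfin hSfg l fun i hi => ih i (by omega)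
      rw [model_add_two]
      exact ((((hG _ (by omega)).sup ((hG _ (by omega)).map _)).sup ((hG _ (by omega)).map _)).sup
        ((hG _ (by omega)).map _)).sup ((hG _ (by omega)).map _)

/-- Products start in degree 4, so with nothing prescribed in degrees 2 and 3 all generators there
are harmonic. This serves the case n = 4 of `gr_le_lagr_of_add_one_eq`. -/
theorem d_model_two (hS2 : S 2 = ⊥) (hS3 : S 3 = ⊥) {x : X.carrier} (hx : x ∈ model c S 2) :
    X.d x = 0 := by
  have hG : ∀ k, S k = ⊥ → k < 4 → modelGen c S (model c S) k ≤ c.harmonic k := by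
    intro k hk hk4
    rw [modelGen]
    split_ifs
    · exact bot_le
    · rw [hk, bot_sup_eq]
      refine sup_le le_rfl (Finset.sup_le ?_)
      rintro ⟨i, j⟩ hp
      rw [Finset.HasAntidiagonal.mem_antidiagonal] at hp
      rw [if_neg (by simp only at hp ⊢; omega)]
      exact bot_le
  have h2 := hG 2 hS2 (by omega)
  have h3 := hG 3 hS3 (by omega)
  revert x
  change model c S 2 ≤ LinearMap.ker X.d
  rw [model_add_two c S 0]
  refine sup_le (sup_le (sup_le (sup_le ?_ ?_) ?_) ?_) ?_
  · exact fun x hx => (c.mem_harmonic.1 (h2 hx)).2.1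
  · rintro _ ⟨x, hx, rfl⟩
    exact X.d_d x
  · rintro _ ⟨x, hx, rfl⟩
    exact X.d_d _
  · rintro _ ⟨x, hx, rfl⟩
    rw [LinearMap.mem_ker, LinearMap.comp_apply, (c.mem_harmonic.1 (h2 hx)).2.1, map_zero,
      map_zero]
  · rintro _ ⟨x, hx, rfl⟩
    rw [LinearMap.mem_ker, (c.mem_harmonic.1 (h3 hx)).2.2, map_zero]

theorem total_model_h_mem (hS : ∀ k, S k ≤ X.gr k) (hS2 : ∀ x ∈ S 2, c.h x = 0) {x : X.carrier}
    (hx : x ∈ X.total (model c S)) : c.h x ∈ X.total (model c S) := by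
  refine total_induction (p := fun x => c.h x ∈ X.total (model c S)) (by simp) ?_ ?_ hx
  · intro a b ha hb
    rw [map_add]; exact add_mem ha hb
  · rintro (_ | k) a ha
    · rw [c.h_zero a (model_le_gr c hS 0 ha)]
      exact zero_mem _
    · exact mem_total_of_mem (model_le_gr c hS) (h_mem_model c hS2 ha)

theorem eq_smul_one_of_cohomology (hX : X.cohomology.IsOneConnected) {x : X.carrier}
    (hx : x ∈ X.gr 0) (hd : X.d x = 0) : ∃ r : ℚ, x = r • (1 : X.carrier) := by
  obtain ⟨r, hr⟩ := hX.1.exists_smul_one (X.mk_mem_cohomologyGr 0 ⟨x, hd⟩ hx)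
  have h1 : X.cohomologyMk (⟨x, hd⟩ - r • 1) = 0 := by
    rw [map_sub, map_smul, map_one]
    exact sub_eq_zero.2 hr
  obtain ⟨w, hw⟩ := (X.cohomologyMk_eq_zero _).1 h1
  change X.d w = x - r • (1 : X.carrier) at hw
  exact ⟨r, sub_eq_zero.1 (eq_zero_of_d_eq_of_mem_zero
    (sub_mem hx (Submodule.smul_mem _ r X.one_mem_gr)) hw)⟩

theorem exact_of_cohomologyGr_eq_bot {k : ℕ} (hX : X.cohomology.gr k = ⊥) {x : X.carrier}
    (hx : x ∈ X.gr k) (hd : X.d x = 0) : ∃ w, X.d w = x := by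
  have h := X.mk_mem_cohomologyGr k ⟨x, hd⟩ hx
  change _ ∈ X.cohomology.gr k at h
  rw [hX] at h
  exact (X.cohomologyMk_eq_zero _).1 ((Submodule.mem_bot ℚ).1 h)

theorem one_ne_zero_of_cohomology (hX : X.cohomology.IsConnected) : (1 : X.carrier) ≠ 0 := by
  intro h
  apply hX.one_ne_zero
  have h1 : (1 : X.cocycles) = 0 := Subtype.ext h
  have h2 := congrArg X.cohomologyMk h1
  rwa [map_one, map_zero] at h2

/-- Stability under h gives injectivity in cohomology. Surjectivity comes from the harmonic
representatives in degrees ≥ 2, and from 1-connectedness of the cohomology in degrees 0 and 1. -/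
theorem model_isQuasiIso (hX : X.cohomology.IsOneConnected) (hS : ∀ k, S k ≤ X.gr k)
    (hS2 : ∀ x ∈ S 2, c.h x = 0) : (model_isSub c hS).incl.IsQuasiIso := by
  refine Hom.isQuasiIso_of_homogeneous _ ?_ ?_
  · rintro i ⟨x, hx⟩ - hd ⟨w, hw⟩
    change X.d w = x at hw
    exact ⟨⟨c.h x, total_model_h_mem c hS hS2 hx⟩, Subtype.ext (c.d_h_eq hw)⟩
  · intro k y hy hd
    have key : ∃ x ∈ model c S k, X.d x = 0 ∧ ∃ w, X.d w = y - x := by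
      rcases k with _ | _ | k
      · refine ⟨y, ?_, hd, 0, by simp⟩
        obtain ⟨r, rfl⟩ := eq_smul_one_of_cohomology hX hy hd
        rw [model_zero]
        exact Submodule.smul_mem _ _ (Submodule.mem_span_singleton_self 1)
      · obtain ⟨w, hw⟩ := exact_of_cohomologyGr_eq_bot hX.2 hy hd
        exact ⟨0, zero_mem _, map_zero _, w, by rw [hw, sub_zero]⟩
      · have h := c.sub_d_h_mem_harmonic hy hd
        exact ⟨_, harmonic_le_model c (by omega) h, (c.mem_harmonic.1 h).2.1, c.h y,
          (sub_sub_cancel _ _).symm⟩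
    obtain ⟨x, hx, hdx, hw⟩ := key
    exact ⟨⟨x, mem_total_of_mem (model_le_gr c hS) hx⟩, Subtype.ext hdx, hw⟩

/-- A CDGA with `1`-connected cohomology of finite type contains a quasi-isomorphic `1`-connected
sub-CDGA of finite type, which may be chosen to contain prescribed finite-dimensional spaces. -/
theorem exists_finiteType_sub (hX : X.cohomology.IsOneConnected)
    (hXfin : X.cohomology.IsFiniteType) (hS : ∀ k, S k ≤ X.gr k) (hSfg : ∀ k, (S k).FG)
    (hS2 : ∀ x ∈ S 2, c.h x = 0) :
    ∃ (F : CDGA.{u}) (i : Hom F X), i.IsQuasiIso ∧ F.IsOneConnected ∧ F.IsFiniteType ∧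
      (∀ k, 2 ≤ k → ∀ x ∈ S k, ∃ y ∈ F.gr k, i.toAlgHom y = x) ∧
      (S 2 = ⊥ → S 3 = ⊥ → ∀ x ∈ F.gr 2, F.d x = 0) := by
  have hW := model_isSub c hS
  refine ⟨hW.toCDGA, hW.incl, model_isQuasiIso c hX hS hS2, ⟨?_, ?_⟩, ?_, ?_, ?_⟩
  · refine isConnected_of_exists_smul_one ?_ ?_
    · intro h
      apply one_ne_zero_of_cohomology hX.1
      rw [← map_one hW.incl.toAlgHom, h, map_zero]
    · intro x hx
      have h := hW.incl_mem hx
      rw [model_zero, Submodule.mem_span_singleton] at h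
      obtain ⟨r, hr⟩ := h
      exact ⟨r, hW.incl_injective (by rw [map_smul, map_one, hr])⟩
  · rw [eq_bot_iff]
    intro x hx
    have h := hW.incl_mem hx
    rw [model_one, Submodule.mem_bot] at h
    exact hW.incl_injective (h.trans (map_zero _).symm)
  · intro k
    have hfg := model_fg c (c.harmonic_fg hXfin) hSfg k
    rw [← Module.Finite.iff_fg] at hfg
    refine FiniteDimensional.of_injective
      (hW.incl.toAlgHom.toLinearMap.restrict (p := hW.toCDGA.gr k) (q := model c S k)
        fun x hx => hW.incl_mem hx) fun x y hxy => ?_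
    have h : hW.incl.toAlgHom x = hW.incl.toAlgHom y :=
      congrArg (fun z : model c S k => (z : X.carrier)) hxy
    exact Subtype.ext (hW.incl_injective h)
  · intro k hk x hx
    exact hW.exists_incl_eq (mem_model_of_mem c hk hx)
  · intro h2 h3 x hx
    apply hW.incl_injective
    rw [hW.incl.map_d, map_zero]
    exact d_model_two c h2 h3 (hW.incl_mem hx)

end FiniteModel

/-! ### The quotient by the orphans -/

section Orphans

variable {E : CDGA.{u}} (ε : E.carrier →ₗ[ℚ] ℚ)

/-- The orphans of degree `k`: the elements which are orthogonal to everything. -/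
noncomputable def orphans (k : ℕ) : Submodule ℚ E.carrier :=
  E.gr k ⊓ LinearMap.ker ((LinearMap.mul ℚ E.carrier).compr₂ ε)

variable {ε}

theorem mem_orphans {k : ℕ} {x : E.carrier} :
    x ∈ orphans ε k ↔ x ∈ E.gr k ∧ ∀ y, ε (x * y) = 0 := by
  rw [orphans, Submodule.mem_inf, LinearMap.mem_ker]
  refine and_congr_right fun _ => ⟨fun h y => ?_, fun h => LinearMap.ext fun y => h y⟩
  have := LinearMap.congr_fun h y
  simpa using this

/-- Because ε ∘ d = 0, the differential is self-adjoint up to sign for the pairing ε(x y), so the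
radical is stable under it. -/
theorem orphans_isDGIdeal (hd : ∀ x, ε (E.d x) = 0) : E.IsDGIdeal (orphans ε) where
  le _ _ hx := (mem_orphans.1 hx).1
  mul_mem_left i j x hx y hy := by
    obtain ⟨hy, hy'⟩ := mem_orphans.1 hy
    refine mem_orphans.2 ⟨E.mul_mem_gr hx hy, fun z => ?_⟩
    rw [E.gr_comm i j x y hx hy, smul_mul_assoc, map_smul, mul_assoc, hy', smul_zero]
  d_mem k x hx := by
    obtain ⟨hx, hx'⟩ := mem_orphans.1 hx
    refine mem_orphans.2 ⟨E.d_mem k x hx, fun z => ?_⟩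
    have h := E.leibniz k x z hx
    have h2 := congrArg ε h
    rw [hd, map_add, map_smul, hx', smul_zero, add_zero] at h2
    exact h2.symm

theorem orthogonal_of_mem_total_orphans {x : E.carrier} (hx : x ∈ E.total (orphans ε))
    (y : E.carrier) : ε (x * y) = 0 := by
  refine total_induction (p := fun x => ε (x * y) = 0) (by simp) ?_ ?_ hx
  · intro a b ha hb
    rw [add_mul, map_add, ha, hb, add_zero]
  · intro k a ha
    exact (mem_orphans.1 ha).2 y

/-- The quotient of an oriented CDGA by its orphans satisfies Poincaré duality. -/
theorem orphans_quot_isPoincareDuality {n : ℕ} (hdeg : ∀ i, i ≠ n → ∀ x ∈ E.gr i, ε x = 0)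
    (hd : ∀ x, ε (E.d x) = 0) (hE : E.IsOneConnected) (hfin : E.IsFiniteType)
    (hne : ∃ x, ε x ≠ 0) :
    (orphans_isDGIdeal hd).quot.IsOneConnected ∧
      (orphans_isDGIdeal hd).quot.IsPoincareDuality n := by
  set hO := orphans_isDGIdeal hd
  have hconn : hO.quot.IsConnected := by
    refine isConnected_of_exists_smul_one ?_ ?_
    · intro h
      rw [← map_one hO.proj.toAlgHom, hO.proj_eq_zero] at h
      obtain ⟨x, hx⟩ := hne
      exact hx (by simpa using orthogonal_of_mem_total_orphans h x)
    · rintro _ ⟨x, hx, rfl⟩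
      obtain ⟨r, rfl⟩ := hE.1.exists_smul_one hx
      exact ⟨r, map_smul hO.proj.toAlgHom r 1⟩
  obtain ⟨ε', hε'⟩ := exists_factor_of_surjective hO.proj.toAlgHom.toLinearMap
    hO.proj_surjective ε fun x hx => by
      simpa using orthogonal_of_mem_total_orphans (hO.proj_eq_zero.1 hx) 1
  replace hε' : ∀ x, ε' (hO.proj.toAlgHom x) = ε x := hε'
  have hfin' := IsFiniteType.of_surjective hO.proj hO.proj_surjective hfin
  have hinj : ∀ p q, p + q = n → Function.Injective (hO.quot.dualityMap ε' p q) := by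
    intro p q hpq
    rw [injective_iff_map_eq_zero]
    rintro ⟨y, hy⟩ h
    obtain ⟨e, he, rfl⟩ := hO.proj_surjective.exists_mem hy
    refine Subtype.ext (hO.proj_eq_zero.2 (mem_total_of_mem hO.le (mem_orphans.2 ⟨he, ?_⟩)))
    intro z
    refine graded_induction E.gr (p := fun z => ε (e * z) = 0) (by simp) ?_ ?_ z
    · intro a b ha hb
      rw [mul_add, map_add, ha, hb, add_zero]
    · intro j z hz
      by_cases hj : j = q
      · subst hj
        have h1 : ε' (hO.proj.toAlgHom e * hO.proj.toAlgHom z) = 0 :=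
          LinearMap.congr_fun h ⟨hO.proj.toAlgHom z, hO.proj.map_gr _ _ hz⟩
        rwa [← map_mul, hε'] at h1
      · exact hdeg (p + j) (by omega) _ (E.mul_mem_gr he hz)
  refine ⟨⟨hconn, ?_⟩, hconn, hfin', ε', ?_, ?_, ?_, ?_⟩
  · rw [eq_bot_iff]
    intro y hy
    obtain ⟨x, hx, rfl⟩ := hO.proj_surjective.exists_mem hy
    rw [hE.2, Submodule.mem_bot] at hx
    rw [hx, map_zero]
    exact zero_mem _
  · intro i hi y hy
    obtain ⟨x, hx, rfl⟩ := hO.proj_surjective.exists_mem hy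
    rw [hε', hdeg i hi x hx]
  · intro y
    obtain ⟨x, rfl⟩ := hO.proj_surjective y
    rw [← hO.proj.map_d, hε', hd]
  · intro p q hpq
    have := hfin' p
    have := hfin' q
    refine ⟨hinj p q hpq, ?_⟩
    -- Injectivity for (p, q) and for (q, p) bounds each dimension by the other, so injectivity
    -- already gives bijectivity.
    have h1 := LinearMap.finrank_le_finrank_of_injective (hinj p q hpq)
    have h2 := LinearMap.finrank_le_finrank_of_injective (hinj q p (by omega))
    rw [Subspace.dual_finrank_eq] at h1 h2
    refine (LinearMap.injective_iff_surjective_of_finrank_eq_finrank ?_).1 (hinj p q hpq)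
    rw [Subspace.dual_finrank_eq]
    exact le_antisymm h1 h2
  · intro p hp
    rw [eq_bot_iff]
    intro y hy
    obtain ⟨x, hx, rfl⟩ := hO.proj_surjective.exists_mem hy
    refine hO.proj_eq_zero.2 (mem_total_of_mem hO.le (mem_orphans.2 ⟨hx, fun z => ?_⟩))
    refine graded_induction E.gr (p := fun z => ε (x * z) = 0) (by simp) ?_ ?_ z
    · intro a b ha hb
      rw [mul_add, map_add, ha, hb, add_zero]
    · intro j z hz
      exact hdeg (p + j) (by omega) _ (E.mul_mem_gr hx hz)

end Orphans

/-! ### The shifted dual of a quotient -/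

section Dual

variable {A : CDGA.{u}} (n : ℕ) {J : ℕ → Submodule ℚ A.carrier} (hJ : A.IsDGIdeal J)

variable (J) in
/-- The linear forms on `A` which vanish on the ideal `J`. -/
abbrev DualQuot : Type u := (A.total J).dualAnnihilator

theorem dualQuot_apply_eq_zero (f : DualQuot J) {x : A.carrier} (hx : x ∈ A.total J) :
    f.1 x = 0 :=
  (Submodule.mem_dualAnnihilator _).1 f.2 x hx

variable (J) in
/-- The forms of degree `p` are those supported in degree `n - p`. -/
noncomputable def dualGr (p : ℕ) : Submodule ℚ (DualQuot J) where
  -- Phrased without subtraction, so that for p > n only the zero form qualifies.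
  carrier := {f | ∀ i, i + p ≠ n → ∀ x ∈ A.gr i, f.1 x = 0}
  zero_mem' := fun _ _ _ _ => rfl
  add_mem' {f g} hf hg i hi x hx := by
    change f.1 x + g.1 x = 0
    rw [hf i hi x hx, hg i hi x hx, add_zero]
  smul_mem' r f hf i hi x hx := by
    change r • f.1 x = 0
    rw [hf i hi x hx, smul_zero]

variable {n}

theorem dualQuot_ext {f g : DualQuot J} (h : ∀ i, ∀ x ∈ A.gr i, f.1 x = g.1 x) : f = g :=
  Subtype.ext (graded_linearMap_ext A.gr h)

theorem eq_zero_of_mem_dualGr {p : ℕ} {f : DualQuot J} (hf : f ∈ dualGr n J p)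
    (h : ∀ i, i + p = n → ∀ x ∈ A.gr i, f.1 x = 0) : f = 0 := by
  refine dualQuot_ext fun i x hx => ?_
  by_cases hi : i + p = n
  · exact h i hi x hx
  · exact hf i hi x hx

variable (n) in
/-- The component of degree `p` of a linear form. -/
noncomputable def dualPr (hJ : A.IsDGIdeal J) (p : ℕ) : DualQuot J →ₗ[ℚ] DualQuot J where
  toFun f := ⟨if p ≤ n then f.1 ∘ₗ A.pr (n - p) else 0, by
    rw [Submodule.mem_dualAnnihilator]
    intro x hx
    split_ifs
    · exact dualQuot_apply_eq_zero f (pr_mem_total hJ.le hx _)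
    · rfl⟩
  map_add' f g := by
    apply Subtype.ext
    simp only [Submodule.coe_add]
    split_ifs
    · rfl
    · rw [add_zero]
  map_smul' r f := by
    apply Subtype.ext
    simp only [Submodule.coe_smul, RingHom.id_apply]
    split_ifs
    · rfl
    · rw [smul_zero]

/-- Forms killing J see only degrees 0 to n of A, by `htop`. Their shifted degrees therefore also
lie between 0 and n, and each form is a finite sum of components. -/
theorem dualGr_isInternal (hJ : A.IsDGIdeal J) (htop : ∀ k, n < k → A.gr k ≤ J k) :
    DirectSum.IsInternal (dualGr n J) := by
  have hpr : ∀ (p : ℕ) (f : DualQuot J) (i : ℕ), ∀ x ∈ A.gr i,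
      (dualPr n hJ p f).1 x = if i + p = n then f.1 x else 0 := by
    intro p f i x hx
    change (if p ≤ n then f.1 ∘ₗ A.pr (n - p) else 0 : Module.Dual ℚ A.carrier) x = _
    by_cases hp : p ≤ n
    · rw [if_pos hp, LinearMap.comp_apply]
      split_ifs with h
      · rw [gpr_of_mem]
        convert hx using 2
        omega
      · rw [gpr_of_mem_ne _ hx (by omega), map_zero]
    · rw [if_neg hp, if_neg (by omega)]
      rfl
  refine isInternal_of_proj (dualGr n J) (dualPr n hJ) ?_ ?_ ?_
  · intro p f hf
    refine dualQuot_ext fun i x hx => ?_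
    rw [hpr p f i x hx]
    split_ifs with h
    · rfl
    · exact (hf i h x hx).symm
  · intro p q hpq f hf
    refine dualQuot_ext fun i x hx => ?_
    rw [hpr q f i x hx]
    split_ifs with h
    · exact hf i (by omega) x hx
    · rfl
  · intro f
    have : f = ∑ p ∈ Finset.range (n + 1), dualPr n hJ p f := by
      refine dualQuot_ext fun i x hx => ?_
      rw [AddSubmonoidClass.coe_finsetSum, LinearMap.sum_apply,
        Finset.sum_congr rfl fun p _ => hpr p f i x hx]
      by_cases hi : i ≤ n
      · rw [Finset.sum_eq_single (n - i)]
        · rw [if_pos (by omega)]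
        · intro p hp hne
          rw [if_neg]
          rw [Finset.mem_range] at hp
          omega
        · intro h
          exact absurd (Finset.mem_range.2 (by omega)) h
      · rw [dualQuot_apply_eq_zero f (mem_total_of_mem hJ.le (htop i (by omega) hx))]
        exact (Finset.sum_eq_zero fun p _ => if_neg (by omega)).symm
    rw [this]
    refine sum_mem fun p _ => Submodule.mem_iSup_of_mem p fun i hi x hx => ?_
    rw [hpr p f i x hx, if_neg hi]

/-- The right action `(f ⬝ a) b = f (a * b)`. -/
noncomputable def dualAct (hJ : A.IsDGIdeal J) : DualQuot J →ₗ[ℚ] A.carrier →ₗ[ℚ] DualQuot J :=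
  LinearMap.mk₂ ℚ (fun f a => ⟨f.1 ∘ₗ LinearMap.mulLeft ℚ a, by
      rw [Submodule.mem_dualAnnihilator]
      intro x hx
      exact dualQuot_apply_eq_zero f (hJ.ideal.mul_mem_left a hx)⟩)
    (fun f g a => rfl) (fun r f a => rfl)
    (fun f a b => Subtype.ext (LinearMap.ext fun x => by
      change f.1 ((a + b) * x) = f.1 (a * x) + f.1 (b * x)
      rw [add_mul, map_add]))
    (fun r f a => Subtype.ext (LinearMap.ext fun x => by
      change f.1 ((r • a) * x) = r • f.1 (a * x)
      rw [smul_mul_assoc, map_smul]))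

theorem dualAct_apply (f : DualQuot J) (a b : A.carrier) :
    (dualAct hJ f a).1 b = f.1 (a * b) := rfl

theorem sgn_mem_total (hJ : A.IsDGIdeal J) {x : A.carrier} (hx : x ∈ A.total J) :
    A.sgn x ∈ A.total J := by
  refine total_induction (p := fun x => A.sgn x ∈ A.total J) (by simp) ?_ ?_ hx
  · intro a b ha hb
    rw [map_add]; exact add_mem ha hb
  · intro k a ha
    rw [sgn_of_mem (hJ.le k ha)]
    exact Submodule.smul_mem _ _ (mem_total_of_mem hJ.le ha)

variable (n) in
/-- The differential of the shifted dual. -/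
noncomputable def dualD (hJ : A.IsDGIdeal J) : DualQuot J →ₗ[ℚ] DualQuot J where
  -- On a form f of degree p this is -(-1)^p f ∘ d, the sign for which Leibniz holds with (f a)(b) =
  -- f(a b). Using `sgn` produces it by one linear map for all p.
  toFun f := ⟨((-1 : ℚ) ^ n) • (f.1 ∘ₗ A.d ∘ₗ A.sgn), by
    rw [Submodule.mem_dualAnnihilator]
    intro x hx
    rw [LinearMap.smul_apply, LinearMap.comp_apply, LinearMap.comp_apply,
      dualQuot_apply_eq_zero f (hJ.d_mem_total (sgn_mem_total hJ hx)), smul_zero]⟩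
  map_add' f g := by
    apply Subtype.ext
    simp only [Submodule.coe_add, LinearMap.add_comp, smul_add]
  map_smul' r f := by
    apply Subtype.ext
    simp only [Submodule.coe_smul, RingHom.id_apply, LinearMap.smul_comp]
    rw [smul_comm]

theorem dualD_apply (f : DualQuot J) (x : A.carrier) :
    (dualD n hJ f).1 x = ((-1 : ℚ) ^ n) * f.1 (A.d (A.sgn x)) := rfl

theorem dual_leibniz (p : ℕ) (f : DualQuot J) (hf : f ∈ dualGr n J p) (a : A.carrier) :
    dualD n hJ (dualAct hJ f a) =
      dualAct hJ (dualD n hJ f) a + ((-1 : ℚ) ^ p) • dualAct hJ f (A.d a) := by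
  refine graded_induction A.gr (p := fun a => dualD n hJ (dualAct hJ f a) =
      dualAct hJ (dualD n hJ f) a + ((-1 : ℚ) ^ p) • dualAct hJ f (A.d a)) (by simp) ?_ ?_ a
  · intro a b ha hb
    simp only [map_add, ha, hb, smul_add]
    abel
  · intro i a ha
    refine dualQuot_ext fun j x hx => ?_
    change ((-1 : ℚ) ^ n) * f.1 (a * A.d (A.sgn x)) =
      ((-1 : ℚ) ^ n) * f.1 (A.d (A.sgn (a * x))) + ((-1 : ℚ) ^ p) * f.1 (A.d a * x)
    rw [sgn_of_mem (A.mul_mem_gr ha hx), sgn_of_mem hx, map_smul, map_smul, A.leibniz i a x ha,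
      mul_smul_comm]
    simp only [map_smul, map_add, smul_eq_mul]
    have e1 : ((-1 : ℚ) ^ (i + j)) * (-1) ^ i = (-1) ^ j := by
      rw [← pow_add, show i + j + i = j + 2 * i by ring, pow_add, pow_mul (-1 : ℚ) 2]
      simp
    -- The two terms have opposite signs when a, x and f have matching degrees; otherwise f kills
    -- both.
    have e2 : ((-1 : ℚ) ^ n) * (-1) ^ (i + j) * f.1 (A.d a * x) +
        (-1) ^ p * f.1 (A.d a * x) = 0 := by
      by_cases h : i + 1 + j + p = n
      · have : ((-1 : ℚ) ^ n) * (-1) ^ (i + j) = - (-1) ^ p := by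
          rw [← h, ← pow_add, show i + 1 + j + p + (i + j) = p + 1 + 2 * (i + j) by ring, pow_add,
            pow_mul (-1 : ℚ) 2, pow_succ]
          simp
        rw [this]
        ring
      · rw [hf _ h _ (A.mul_mem_gr (A.d_mem i a ha) hx)]
        ring
    linear_combination (-1 : ℚ) * e2 - ((-1 : ℚ) ^ n) * f.1 (a * A.d x) * e1

/-- The shifted dual `Hom(A / J, ℚ)[-n]` as a module over `A`. -/
noncomputable def dualModule (htop : ∀ k, n < k → A.gr k ≤ J k) : A.DGModule :=
  letI : DirectSum.Decomposition (dualGr n J) := (dualGr_isInternal hJ htop).chooseDecomposition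
  { carrier := DualQuot J
    gr := dualGr n J
    act := dualAct hJ
    act_one := fun f => dualQuot_ext fun i x _ => by rw [dualAct_apply, one_mul]
    act_mul := fun f a b => dualQuot_ext fun i x _ => by
      rw [dualAct_apply, dualAct_apply, dualAct_apply, mul_assoc]
    act_mem := fun p j f hf a ha i hi x hx => by
      rw [dualAct_apply]
      exact hf (j + i) (by omega) _ (A.mul_mem_gr ha hx)
    d := dualD n hJ
    d_mem := fun p f hf i hi x hx => by
      rw [dualD_apply, sgn_of_mem hx, map_smul, map_smul, hf (i + 1) (by omega) _ (A.d_mem i x hx),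
        smul_zero, mul_zero]
    d_d := fun f => dualQuot_ext fun i x _ => by
      rw [dualD_apply, dualD_apply, ← neg_neg (A.sgn (A.d (A.sgn x))), ← d_sgn, map_neg, A.d_d,
        neg_zero, map_zero, mul_zero, mul_zero]
      rfl
    leibniz := fun p f hf a => dual_leibniz hJ p f hf a
    der := 0
    der_mem := fun _ _ _ => zero_mem _
    der_mul := fun i j a _ b _ => by simp
    der_d := fun a => by simp }

end Dual

/-! ### Differential ideals in high degrees -/

/-- Multiplying by an element of positive degree raises the degree by at least 2, as A¹ = 0. So W is
an ideal as soon as a nonzero component in degree k is followed by everything from degree k + 2 on.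
-/
theorem isDGIdeal_of_isOneConnected {A : CDGA.{u}} (hA : A.IsOneConnected)
    {W : ℕ → Submodule ℚ A.carrier} (hle : ∀ k, W k ≤ A.gr k)
    (hd : ∀ k, ∀ x ∈ W k, A.d x ∈ W (k + 1))
    (hbig : ∀ k, W k = ⊥ ∨ ∀ i, k + 2 ≤ i → A.gr i ≤ W i) : A.IsDGIdeal W where
  le := hle
  d_mem := hd
  mul_mem_left i j x hx y hy := by
    rcases i with _ | _ | i
    · obtain ⟨r, rfl⟩ := hA.1.exists_smul_one hx
      rw [smul_one_mul, zero_add]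
      exact Submodule.smul_mem _ _ hy
    · rw [zero_add, hA.2, Submodule.mem_bot] at hx
      rw [hx, zero_mul]
      exact zero_mem _
    · rcases hbig j with h | h
      · rw [h, Submodule.mem_bot] at hy
        rw [hy, mul_zero]
        exact zero_mem _
      · exact h _ (by omega) (A.mul_mem_gr hx (hle j hy))

/-! ### Orientations -/

section Orientation

variable {A : CDGA.{u}}

/-- An orientation of a CDGA, inducing Poincaré duality in cohomology. -/
structure IsOrientation (n : ℕ) (ε : A.carrier →ₗ[ℚ] ℚ) : Prop where
  degree : ∀ i, i ≠ n → ∀ x ∈ A.gr i, ε x = 0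
  map_d : ∀ x, ε (A.d x) = 0
  -- This field and the next are the two halves of duality in H(A), injectivity and surjectivity,
  -- stated on cocycles.
  exact : ∀ x, A.d x = 0 → (∀ z, A.d z = 0 → ε (x * z) = 0) → ∃ y, A.d y = x
  represent : ∀ k l, k + l = n → ∀ f : A.carrier →ₗ[ℚ] ℚ, (∀ y, f (A.d y) = 0) →
    ∃ x ∈ A.gr k, A.d x = 0 ∧ ∀ z ∈ A.gr l, A.d z = 0 → ε (x * z) = f z

theorem exists_primitive_of_pr {x : A.carrier} (h : ∀ k, ∃ y, A.d y = A.pr k x) :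
    ∃ y, A.d y = x := by
  choose y hy using h
  obtain ⟨s, hs⟩ := sum_gpr A.gr x
  refine ⟨∑ i ∈ s, y i, ?_⟩
  rw [map_sum]
  conv_rhs => rw [hs]
  exact Finset.sum_congr rfl fun i _ => hy i

theorem exists_orientation {n : ℕ} (h : A.cohomology.IsPoincareDuality n) :
    ∃ ε : A.carrier →ₗ[ℚ] ℚ, IsOrientation n ε := by
  obtain ⟨c⟩ := A.exists_contraction
  obtain ⟨-, -, η, hdeg, -, hdual, hvan⟩ := h
  -- The map id - h d retracts A onto its cocycles, which extends the form on cohomology to all of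
  -- A.
  let π : A.carrier →ₗ[ℚ] A.cocycles :=
    LinearMap.codRestrict A.cocycles.toSubmodule (LinearMap.id - c.h ∘ₗ A.d) fun x => by
      change A.d (x - c.h (A.d x)) = 0
      rw [map_sub, c.d_h_d, sub_self]
  have hπ : ∀ z : A.cocycles, π z = z := by
    rintro ⟨z, hz⟩
    apply Subtype.ext
    change z - c.h (A.d z) = z
    rw [show A.d z = 0 from hz, map_zero, sub_zero]
  let ε : A.carrier →ₗ[ℚ] ℚ := η ∘ₗ A.cohomologyMk.toLinearMap ∘ₗ π
  have hε : ∀ z : A.cocycles, ε z = η (A.cohomologyMk z) := by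
    intro z
    change η (A.cohomologyMk (π z)) = _
    rw [hπ]
  have hεdeg : ∀ i, i ≠ n → ∀ x ∈ A.gr i, ε x = 0 := fun i hi x hx =>
    hdeg i hi _ (A.mk_mem_cohomologyGr i (π x) (sub_mem hx (c.h_d_mem hx)))
  refine ⟨ε, hεdeg, ?_, ?_, ?_⟩
  · intro x
    have h := hε ⟨A.d x, A.d_d x⟩
    rw [(A.cohomologyMk_eq_zero ⟨A.d x, A.d_d x⟩).2 ⟨x, rfl⟩] at h
    exact h.trans (map_zero η)
  · intro x hx hpair
    refine exists_primitive_of_pr fun k => ?_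
    have hdk : A.d (A.pr k x) = 0 := by rw [A.d_pr, hx, map_zero]
    have hk := A.mk_mem_cohomologyGr k ⟨A.pr k x, hdk⟩ (A.pr_mem k x)
    by_cases hkn : n < k
    · change _ ∈ A.cohomology.gr k at hk
      rw [hvan k hkn] at hk
      exact (A.cohomologyMk_eq_zero _).1 ((Submodule.mem_bot ℚ).1 hk)
    · have hz := (injective_iff_map_eq_zero _).1 (hdual k (n - k) (by omega)).1 ⟨_, hk⟩ ?_
      · exact (A.cohomologyMk_eq_zero _).1 (congrArg Subtype.val hz)
      · refine LinearMap.ext ?_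
        rintro ⟨_, z, hz, rfl⟩
        change η (A.cohomologyMk ⟨A.pr k x, hdk⟩ * A.cohomologyMk z) = 0
        rw [← map_mul, ← hε]
        change ε (A.pr k x * z) = 0
        rw [← hpair z z.2]
        refine graded_induction A.gr (p := fun x => ε (A.pr k x * z) = ε (x * z)) (by simp) ?_ ?_ x
        · intro a b ha hb
          simp only [map_add, add_mul, ha, hb]
        · intro i a ha
          by_cases hik : i = k
          · subst hik
            rw [gpr_of_mem _ ha]
          · rw [gpr_of_mem_ne _ ha hik, zero_mul, map_zero]
            exact (hεdeg (i + (n - k)) (by omega) _ (A.mul_mem_gr ha hz)).symm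
  · intro k l hkl f hf
    obtain ⟨f', hf'⟩ := exists_factor_of_surjective A.cohomologyMk.toLinearMap
      A.cohomologyMk_surjective (f ∘ₗ A.cocycles.val.toLinearMap) fun z hz => by
        obtain ⟨w, hw⟩ := (A.cohomologyMk_eq_zero z).1 hz
        change f z = 0
        rw [← hw, hf]
    obtain ⟨⟨_, x, hx, rfl⟩, hxf⟩ := (hdual k l hkl).2 (f' ∘ₗ (A.cohomologyGr l).subtype)
    refine ⟨x, hx, x.2, fun z hz hdz => ?_⟩
    have h1 := LinearMap.congr_fun hxf
      ⟨_, A.mk_mem_cohomologyGr l ⟨z, hdz⟩ hz⟩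
    have h2 := hε (x * ⟨z, hdz⟩)
    rw [map_mul] at h2
    exact (h2.trans h1).trans (hf' ⟨z, hdz⟩)

end Orientation

/-! ### The Lagrangian ideal -/

section Lagrangian

variable {A : CDGA.{u}} (c : A.Contraction) (n : ℕ)

/-- The ideal orthogonal to the part added to `A` in the construction of the Poincaré duality
model. -/
noncomputable def lagr (k : ℕ) : Submodule ℚ A.carrier :=
  -- Here `n / 2` is ⌊n/2⌋. In the next degree boundaries are left out, since d vanishes on J in
  -- degree ⌊n/2⌋ and they would create extra cohomology. For even n the middle cohomology is put
  -- into J, so that A/J has cohomology strictly below the middle.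
  if k < n / 2 then ⊥
  else if k = n / 2 then (if Even n then c.harmonic k else ⊥)
  else if k = n / 2 + 1 then A.gr k ⊓ LinearMap.ker c.h
  else A.gr k

variable {n}

theorem lagr_of_lt {k : ℕ} (hk : k < n / 2) : lagr c n k = ⊥ := if_pos hk

theorem lagr_of_large {k : ℕ} (hk : n / 2 + 2 ≤ k) : lagr c n k = A.gr k := by
  rw [lagr, if_neg (by omega), if_neg (by omega), if_neg (by omega)]

theorem lagr_le (k : ℕ) : lagr c n k ≤ A.gr k := by
  rw [lagr]
  split_ifs
  · exact bot_le
  · exact fun x hx => (c.mem_harmonic.1 hx).1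
  · exact bot_le
  · exact inf_le_left
  · exact le_rfl

theorem h_eq_zero_of_mem_lagr {k : ℕ} (hk : k ≤ n / 2 + 1) {x : A.carrier}
    (hx : x ∈ lagr c n k) : c.h x = 0 := by
  rw [lagr] at hx
  split_ifs at hx
  · rw [(Submodule.mem_bot ℚ).1 hx, map_zero]
  · exact (c.mem_harmonic.1 hx).2.2
  · rw [(Submodule.mem_bot ℚ).1 hx, map_zero]
  · exact hx.2
  · omega

theorem d_eq_zero_of_mem_lagr {k : ℕ} (hk : k ≤ n / 2) {x : A.carrier}
    (hx : x ∈ lagr c n k) : A.d x = 0 := by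
  rw [lagr] at hx
  split_ifs at hx
  · rw [(Submodule.mem_bot ℚ).1 hx, map_zero]
  · exact (c.mem_harmonic.1 hx).2.1
  · rw [(Submodule.mem_bot ℚ).1 hx, map_zero]
  · omega
  · omega

theorem mem_lagr_of_h_eq_zero {k : ℕ} (hk : n / 2 + 1 ≤ k) {x : A.carrier} (hx : x ∈ A.gr k)
    (h : c.h x = 0) : x ∈ lagr c n k := by
  rw [lagr, if_neg (by omega), if_neg (by omega)]
  split_ifs
  · exact ⟨hx, h⟩
  · exact hx

/-- The degree complementary to k ≤ ⌊n/2⌋ is at least n/2, where J contains all representatives.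
Consequently forms of degree k on A/J vanish on the representatives in degree n - k. -/
theorem mem_lagr_of_mem_harmonic {k l : ℕ} (hk : k ≤ n / 2) (hkl : l + k = n) {x : A.carrier}
    (hx : x ∈ c.harmonic l) : x ∈ lagr c n l := by
  by_cases hl : n / 2 + 1 ≤ l
  · exact mem_lagr_of_h_eq_zero c hl (c.mem_harmonic.1 hx).1 (c.mem_harmonic.1 hx).2.2
  · rw [lagr, if_neg (by omega), if_pos (by omega), if_pos ⟨n / 2, by omega⟩]
    exact hx

theorem lagr_isDGIdeal (hA : A.IsOneConnected) : A.IsDGIdeal (lagr c n) := by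
  refine isDGIdeal_of_isOneConnected hA (lagr_le c) ?_ ?_
  · intro k x hx
    by_cases hk : k ≤ n / 2
    · rw [d_eq_zero_of_mem_lagr c hk hx]
      exact zero_mem _
    · rw [lagr_of_large c (by omega)]
      exact A.d_mem k x (lagr_le c k hx)
  · intro k
    by_cases hk : k < n / 2
    · exact Or.inl (lagr_of_lt c hk)
    · exact Or.inr fun i hi => (lagr_of_large c (by omega)).ge

/-- On J, the contraction is zero up to degree ⌊n/2⌋ + 1. From higher degrees it lands in ker h,
which J contains from degree ⌊n/2⌋ + 1 on. Thus composing with h preserves forms on A/J. -/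
theorem h_mem_total_lagr {x : A.carrier} (hx : x ∈ A.total (lagr c n)) :
    c.h x ∈ A.total (lagr c n) := by
  refine total_induction (p := fun x => c.h x ∈ A.total (lagr c n)) (by simp) ?_ ?_ hx
  · intro a b ha hb
    rw [map_add]; exact add_mem ha hb
  · intro k a ha
    by_cases hk : k ≤ n / 2 + 1
    · rw [h_eq_zero_of_mem_lagr c hk ha]
      exact zero_mem _
    · obtain ⟨k, rfl⟩ : ∃ l, k = l + 1 := ⟨k - 1, by omega⟩
      exact mem_total_of_mem (lagr_le c) (mem_lagr_of_h_eq_zero c (by omega)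
        (c.h_mem k a (lagr_le c _ ha)) (c.h_h a))

variable {ε : A.carrier →ₗ[ℚ] ℚ}

/-- The degree complementary to k > n/2 is below n/2, where J is zero. For odd n this includes
degree ⌊n/2⌋, which explains the parity test in `lagr`. -/
theorem IsOrientation.mul_lagr (hε : IsOrientation n ε) {k : ℕ} (hk : n / 2 + 1 ≤ k)
    {y : A.carrier} (hy : y ∈ A.gr k) {x : A.carrier} (hx : x ∈ A.total (lagr c n)) :
    ε (y * x) = 0 := by
  refine total_induction (p := fun x => ε (y * x) = 0) (by simp) ?_ ?_ hx
  · intro a b ha hb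
    rw [mul_add, map_add, ha, hb, add_zero]
  · intro l x hx
    by_cases h : k + l = n
    · have hx0 : x = 0 := by
        rw [lagr] at hx
        split_ifs at hx with h1 h2 h3 h4
        · exact (Submodule.mem_bot ℚ).1 hx
        · obtain ⟨m, rfl⟩ := h3
          omega
        · exact (Submodule.mem_bot ℚ).1 hx
        · omega
        · omega
      rw [hx0, mul_zero, map_zero]
    · exact hε.degree _ h _ (A.mul_mem_gr hy (lagr_le c l hx))

/-- The key step for the surjectivity in cohomology of the map to the Poincaré duality model. -/
theorem IsOrientation.exists_lagr_correction (hε : IsOrientation n ε) {k : ℕ} {a : A.carrier}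
    (ha : a ∈ A.gr k) (f : A.carrier →ₗ[ℚ] ℚ) (hfJ : ∀ x ∈ A.total (lagr c n), f x = 0)
    (hfk : ∀ i, i + k ≠ n → ∀ x ∈ A.gr i, f x = 0) (hda : A.d a ∈ lagr c n (k + 1))
    (hf : ∀ b, ε (A.d a * b) + (-1) ^ n * f (A.d (A.sgn b)) = 0) :
    ∃ y ∈ lagr c n k, A.d y = A.d a ∧ ∃ g : A.carrier →ₗ[ℚ] ℚ,
      (∀ x ∈ A.total (lagr c n), g x = 0) ∧
      ∀ b, ε (y * b) + f b = (-1) ^ n * g (A.d (A.sgn b)) := by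
  obtain ⟨y, hyk, hdy, hyJ, hypair⟩ : ∃ y ∈ A.gr k, A.d y = A.d a ∧ y ∈ lagr c n k ∧
      ∀ x ∈ A.total (lagr c n), ε (y * x) = 0 := by
    -- For k ≤ ⌊n/2⌋ the contraction kills `A.d a` ∈ J, so y = 0. For larger k, y lies in ker h and
    -- pairs to zero with J.
    refine ⟨c.h (A.d a), c.h_d_mem ha, c.d_h_d a, ?_⟩
    by_cases hk : k + 1 ≤ n / 2 + 1
    · rw [h_eq_zero_of_mem_lagr c hk hda]
      exact ⟨zero_mem _, fun x _ => by rw [zero_mul, map_zero]⟩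
    · exact ⟨mem_lagr_of_h_eq_zero c (by omega) (c.h_d_mem ha) (c.h_h _),
        fun x hx => hε.mul_lagr c (by omega) (c.h_d_mem ha) hx⟩
  -- Subtracting the orphan (y, -ε(y ·)) turns (a, f) into (a - y, f₁), with a - y closed. It
  -- remains to handle f₁, a form on A/J vanishing on boundaries.
  let f₁ : A.carrier →ₗ[ℚ] ℚ := f + ε ∘ₗ LinearMap.mulLeft ℚ y
  have hf₁ : ∀ b, f₁ b = f b + ε (y * b) := fun _ => rfl
  have hf₁J : ∀ x ∈ A.total (lagr c n), f₁ x = 0 := fun x hx => by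
    rw [hf₁, hfJ x hx, hypair x hx, add_zero]
  have hf₁k : ∀ i, i + k ≠ n → ∀ x ∈ A.gr i, f₁ x = 0 := fun i hi x hx => by
    rw [hf₁, hfk i hi x hx, hε.degree (k + i) (by omega) _ (A.mul_mem_gr hyk hx), add_zero]
  have hf₁d : ∀ b, f₁ (A.d b) = 0 := by
    intro b
    refine graded_induction A.gr (p := fun b => f₁ (A.d b) = 0) (by simp) ?_ ?_ b
    · intro x y hx hy
      rw [map_add, map_add, hx, hy, add_zero]
    · intro l b hb
      by_cases hl : l + 1 + k = n
      · have h1 := congrArg ε (A.leibniz k y b hyk)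
        rw [hε.map_d, map_add, map_smul, hdy, smul_eq_mul] at h1
        have h2 := hf b
        rw [sgn_of_mem hb, map_smul, map_smul, smul_eq_mul, ← mul_assoc, ← pow_add,
          show n + l = k + 1 + 2 * l by omega, pow_add _ _ (2 * l), pow_mul (-1 : ℚ) 2,
          pow_succ] at h2
        have h3 : ((-1 : ℚ) ^ k) * (-1) ^ k = 1 := by rw [← mul_pow]; simp
        rw [hf₁]
        norm_num at h2
        linear_combination (-(-1 : ℚ) ^ k) * h1 - (-1 : ℚ) ^ k * h2 -
          (f (A.d b) + ε (y * A.d b)) * h3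
      · exact hf₁k (l + 1) hl _ (A.d_mem l b hb)
  -- The element z represents the functional induced by f₁ on the cohomology of degree n - k. For k
  -- ≤ ⌊n/2⌋ that functional is zero, since J contains the representatives, and z = 0 serves.
  obtain ⟨z, hzJ, hdz, hzpair, hz⟩ : ∃ z ∈ lagr c n k, A.d z = 0 ∧
      (∀ x ∈ A.total (lagr c n), ε (z * x) = 0) ∧
      ∀ l, l + k = n → ∀ w ∈ A.gr l, A.d w = 0 → f₁ w = ε (z * w) := by
    by_cases hk : n / 2 + 1 ≤ k
    · by_cases hkn : k ≤ n
      · obtain ⟨z, hz, hdz, hzf⟩ := hε.represent k (n - k) (by omega) f₁ hf₁d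
        have hh := c.sub_d_h_mem_harmonic hz hdz
        rw [c.mem_harmonic] at hh
        refine ⟨z - A.d (c.h z), mem_lagr_of_h_eq_zero c hk hh.1 hh.2.2, hh.2.1,
          fun x hx => hε.mul_lagr c hk hh.1 hx, fun l hl w hw hdw => ?_⟩
        obtain rfl : l = n - k := by omega
        rw [sub_mul, map_sub, ← A.d_mul_cocycle _ _ hdw, hε.map_d, sub_zero, hzf w hw hdw]
      · exact ⟨0, zero_mem _, map_zero _, fun x _ => by rw [zero_mul, map_zero],
          fun l hl => by omega⟩
    · refine ⟨0, zero_mem _, map_zero _, fun x _ => by rw [zero_mul, map_zero],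
        fun l hl w hw hdw => ?_⟩
      have h1 := mem_lagr_of_mem_harmonic c (k := k) (by omega) hl (c.sub_d_h_mem_harmonic hw hdw)
      have h2 := hf₁J _ (mem_total_of_mem (lagr_le c) h1)
      rw [map_sub, hf₁d, sub_zero] at h2
      rw [h2, zero_mul, map_zero]
  -- In degree n - k this form vanishes on cocycles, so g₁ = g₁ h d there; up to sign, g₁ ∘ h is
  -- therefore a primitive of g₁ in the dual.
  let g₁ : A.carrier →ₗ[ℚ] ℚ := f₁ - ε ∘ₗ LinearMap.mulLeft ℚ z
  have hg₁ : ∀ b, g₁ b = f₁ b - ε (z * b) := fun _ => rfl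
  have hg₁k : ∀ i, i + k ≠ n → ∀ x ∈ A.gr i, g₁ x = 0 := fun i hi x hx => by
    rw [hg₁, hf₁k i hi x hx, hε.degree (k + i) (by omega) _ (A.mul_mem_gr (lagr_le c k hzJ) hx),
      sub_zero]
  refine ⟨y - z, sub_mem hyJ hzJ, by rw [map_sub, hdy, hdz, sub_zero],
    ((-1 : ℚ) ^ k) • (g₁ ∘ₗ c.h), ?_, ?_⟩
  · intro x hx
    have hx' := h_mem_total_lagr c hx
    rw [LinearMap.smul_apply, LinearMap.comp_apply, hg₁, hf₁J _ hx', hzpair _ hx', sub_zero,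
      smul_zero]
  · intro b
    have h0 : ε ((y - z) * b) + f b = g₁ b := by
      rw [hg₁, hf₁, sub_mul, map_sub]; ring
    rw [h0]
    refine graded_induction A.gr (p := fun b =>
      g₁ b = (-1) ^ n * (((-1 : ℚ) ^ k) • (g₁ ∘ₗ c.h)) (A.d (A.sgn b))) (by simp) ?_ ?_ b
    · intro x y hx hy
      simp only [map_add, mul_add]
      rw [hx, hy]
    · intro l b hb
      rw [sgn_of_mem hb, map_smul, map_smul, LinearMap.smul_apply, LinearMap.comp_apply]
      by_cases hl : l + k = n
      · have h1 : g₁ (c.h (A.d b)) = g₁ b := by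
          have h2 := hz l hl (b - c.h (A.d b)) (sub_mem hb (c.h_d_mem hb))
            (by rw [map_sub, c.d_h_d, sub_self])
          have h3 : g₁ (b - c.h (A.d b)) = 0 := by rw [hg₁, h2, sub_self]
          rw [map_sub, sub_eq_zero] at h3
          exact h3.symm
        rw [h1, smul_eq_mul, smul_eq_mul, ← mul_assoc, ← mul_assoc, ← pow_add, ← pow_add,
          show n + l + k = 2 * n by omega, pow_mul]
        simp
      · rw [hg₁k l hl b hb, hg₁k l hl _ (c.h_d_mem hb)]
        simp

end Lagrangian

/-! ### The extension by the shifted dual -/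

section DualExt

variable {A : CDGA.{u}} {n : ℕ} {J : ℕ → Submodule ℚ A.carrier} (hJ : A.IsDGIdeal J)
  (htop : ∀ k, n < k → A.gr k ≤ J k) (ε : A.carrier →ₗ[ℚ] ℚ)

/-- The square-zero extension of `A` by the shifted dual of `A / J`. -/
noncomputable def dualExt : CDGA.{u} := (dualModule hJ htop).ext

/-- The element of the extension with given components. -/
noncomputable def dualExtMk (a : A.carrier) (f : DualQuot J) : (dualExt hJ htop).carrier :=
  DGModule.Ext.mk (M := dualModule hJ htop) a f

/-- The projection of the extension. -/
noncomputable def dualExtFst : Hom (dualExt hJ htop) A := (dualModule hJ htop).extFst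

/-- The inclusion of `A` in the extension. -/
noncomputable def dualExtInl : Hom A (dualExt hJ htop) :=
  (dualModule hJ htop).extInl (Hom.id A) fun _ => rfl

/-- The orientation of the extension. -/
noncomputable def dualExtForm : (dualExt hJ htop).carrier →ₗ[ℚ] ℚ :=
  ε ∘ₗ (dualModule hJ htop).extFstₗ +
    LinearMap.applyₗ (1 : A.carrier) ∘ₗ (A.total J).dualAnnihilator.subtype ∘ₗ
      (dualModule hJ htop).extSndₗ

variable {hJ htop ε}

theorem exists_dualExtMk (x : (dualExt hJ htop).carrier) : ∃ a f, x = dualExtMk hJ htop a f :=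
  ⟨DGModule.Ext.fst x, DGModule.Ext.snd x, rfl⟩

theorem dualExtMk_mem {k : ℕ} {a : A.carrier} {f : DualQuot J} :
    dualExtMk hJ htop a f ∈ (dualExt hJ htop).gr k ↔ a ∈ A.gr k ∧ f ∈ dualGr n J k := Iff.rfl

theorem dualExtMk_inj {a b : A.carrier} {f g : DualQuot J}
    (h : dualExtMk hJ htop a f = dualExtMk hJ htop b g) : a = b ∧ f = g :=
  ⟨congrArg DGModule.Ext.fst h, congrArg DGModule.Ext.snd h⟩

theorem dualExtMk_sub (a b : A.carrier) (f g : DualQuot J) :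
    dualExtMk hJ htop a f - dualExtMk hJ htop b g = dualExtMk hJ htop (a - b) (f - g) := by
  rw [sub_eq_iff_eq_add]
  exact DGModule.Ext.ext (sub_add_cancel a b).symm (sub_add_cancel f g).symm

theorem d_dualExtMk (a : A.carrier) (f : DualQuot J) :
    (dualExt hJ htop).d (dualExtMk hJ htop a f) = dualExtMk hJ htop (A.d a) (dualD n hJ f) :=
  DGModule.Ext.ext rfl (zero_add _)

theorem dualExtInl_apply (a : A.carrier) :
    (dualExtInl hJ htop).toAlgHom a = dualExtMk hJ htop a 0 := rfl

theorem dualExtForm_mk (a : A.carrier) (f : DualQuot J) :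
    dualExtForm hJ htop ε (dualExtMk hJ htop a f) = ε a + f.1 1 := rfl

theorem dualExtForm_mul_inl (a b : A.carrier) (f : DualQuot J) :
    dualExtForm hJ htop ε (dualExtMk hJ htop a f * dualExtMk hJ htop b 0) =
      ε (a * b) + f.1 b := by
  change ε (a * b) + ((dualAct hJ f b).1 1 + ((dualModule hJ htop).lact a 0 : DualQuot J).1 1) = _
  rw [map_zero, dualAct_apply, mul_one]
  exact congrArg _ (add_zero _)

theorem dualExtForm_mul_inr {i p : ℕ} {a : A.carrier} (ha : a ∈ A.gr i) (f : DualQuot J)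
    {g : DualQuot J} (hg : g ∈ dualGr n J p) :
    dualExtForm hJ htop ε (dualExtMk hJ htop a f * dualExtMk hJ htop 0 g) =
      (-1 : ℚ) ^ (i * p) * g.1 a := by
  change ε (a * 0) + (f.1 (0 * 1) + ((dualModule hJ htop).lact a g : DualQuot J).1 1) = _
  rw [(dualModule hJ htop).lact_of_mem ha hg, mul_zero, zero_mul, map_zero, map_zero, zero_add,
    zero_add]
  change (-1 : ℚ) ^ (i * p) * g.1 (a * 1) = _
  rw [mul_one]

theorem dualGr_induction (hJ : A.IsDGIdeal J) (htop : ∀ k, n < k → A.gr k ≤ J k)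
    {p : DualQuot J → Prop} (h0 : p 0) (hadd : ∀ f g, p f → p g → p (f + g))
    (hgr : ∀ i, ∀ f ∈ dualGr n J i, p f) (f : DualQuot J) : p f := by
  let _ : DirectSum.Decomposition (dualGr n J) := (dualGr_isInternal hJ htop).chooseDecomposition
  exact graded_induction (dualGr n J) h0 hadd hgr f

theorem dualExtForm_degree (hε : ∀ i, i ≠ n → ∀ x ∈ A.gr i, ε x = 0) {i : ℕ} (hi : i ≠ n)
    {x : (dualExt hJ htop).carrier} (hx : x ∈ (dualExt hJ htop).gr i) :
    dualExtForm hJ htop ε x = 0 := by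
  obtain ⟨a, f, rfl⟩ := exists_dualExtMk x
  rw [dualExtMk_mem] at hx
  rw [dualExtForm_mk, hε i hi a hx.1, hx.2 0 (by omega) 1 A.one_mem_gr, add_zero]

theorem dualExtForm_d (hε : ∀ x, ε (A.d x) = 0) (x : (dualExt hJ htop).carrier) :
    dualExtForm hJ htop ε ((dualExt hJ htop).d x) = 0 := by
  obtain ⟨a, f, rfl⟩ := exists_dualExtMk x
  rw [d_dualExtMk, dualExtForm_mk, hε, dualD_apply, sgn_of_mem A.one_mem_gr, map_smul, A.d_one,
    smul_zero, map_zero, mul_zero, add_zero]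

/-- Orthogonality to all (0, g) says that every form vanishing on J kills a, hence a ∈ J.
Orthogonality to all (b, 0) then determines f as -ε(a ·). -/
theorem mem_orphans_dualExt {k : ℕ} {a : A.carrier} {f : DualQuot J} :
    dualExtMk hJ htop a f ∈ orphans (dualExtForm hJ htop ε) k ↔
      a ∈ J k ∧ f ∈ dualGr n J k ∧ ∀ b, ε (a * b) + f.1 b = 0 := by
  rw [mem_orphans, dualExtMk_mem]
  constructor
  · rintro ⟨⟨ha, hf⟩, h⟩
    refine ⟨mem_of_mem_total (W := J) ?_ ha, hf, fun b => ?_⟩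
    · rw [← Subspace.forall_mem_dualAnnihilator_apply_eq_zero_iff]
      intro g hg
      refine dualGr_induction hJ htop (p := fun g => g.1 a = 0) rfl ?_ ?_ ⟨g, hg⟩
      · intro g g' hg hg'
        change g.1 a + g'.1 a = 0
        rw [hg, hg', add_zero]
      · intro p g hg
        have h1 := h (dualExtMk hJ htop 0 g)
        rw [dualExtForm_mul_inr ha f hg] at h1
        exact (mul_eq_zero.1 h1).resolve_left (pow_ne_zero _ (by norm_num))
    · have h1 := h (dualExtMk hJ htop b 0)
      rwa [dualExtForm_mul_inl] at h1
  · rintro ⟨ha, hf, h⟩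
    refine ⟨⟨hJ.le k ha, hf⟩, fun y => ?_⟩
    obtain ⟨b, g, rfl⟩ := exists_dualExtMk y
    have h1 : dualExtMk hJ htop b g = dualExtMk hJ htop b 0 + dualExtMk hJ htop 0 g :=
      DGModule.Ext.ext (add_zero b).symm (zero_add g).symm
    rw [h1, mul_add, map_add, dualExtForm_mul_inl, h, zero_add]
    refine dualGr_induction hJ htop (p := fun g => dualExtForm hJ htop ε
      (dualExtMk hJ htop a f * dualExtMk hJ htop 0 g) = 0) ?_ ?_ ?_ g
    · have := dualExtForm_mul_inl (hJ := hJ) (htop := htop) (ε := ε) a 0 f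
      rw [this, mul_zero, map_zero, map_zero, add_zero]
    · intro g g' hg hg'
      have h2 : dualExtMk hJ htop 0 (g + g') = dualExtMk hJ htop 0 g + dualExtMk hJ htop 0 g' :=
        DGModule.Ext.ext (add_zero 0).symm rfl
      rw [h2, mul_add, map_add, hg, hg', add_zero]
    · intro p g hg
      rw [dualExtForm_mul_inr (hJ.le k ha) f hg,
        dualQuot_apply_eq_zero g (mem_total_of_mem hJ.le ha), mul_zero]

/-- In degrees 0 and 1 the shifted dual consists of forms on A/J in degrees n and n - 1, which must
therefore vanish. -/
theorem dualExt_isOneConnected (hA : A.IsOneConnected) (h0 : A.gr n ≤ J n)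
    (h1 : ∀ i, i + 1 = n → A.gr i ≤ J i) : (dualExt hJ htop).IsOneConnected := by
  have hz : ∀ p (f : DualQuot J), f ∈ dualGr n J p → (∀ i, i + p = n → A.gr i ≤ J i) → f = 0 :=
    fun p f hf h => eq_zero_of_mem_dualGr hf fun i hi x hx =>
      dualQuot_apply_eq_zero f (mem_total_of_mem hJ.le (h i hi hx))
  refine ⟨isConnected_of_exists_smul_one ?_ ?_, ?_⟩
  · intro h
    exact hA.1.one_ne_zero (dualExtMk_inj (a := 1) (b := 0) (f := 0) (g := 0) h).1
  · intro x hx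
    obtain ⟨a, f, rfl⟩ := exists_dualExtMk x
    rw [dualExtMk_mem] at hx
    obtain ⟨r, rfl⟩ := hA.1.exists_smul_one hx.1
    rw [hz 0 f hx.2 fun i hi => by rwa [show i = n from hi]]
    exact ⟨r, (map_smul (dualExtInl hJ htop).toAlgHom r 1)⟩
  · rw [eq_bot_iff]
    intro x hx
    obtain ⟨a, f, rfl⟩ := exists_dualExtMk x
    rw [dualExtMk_mem, hA.2, Submodule.mem_bot] at hx
    rw [hx.1, hz 1 f hx.2 h1]
    exact zero_mem _

theorem dualExt_isFiniteType (hA : A.IsFiniteType) : (dualExt hJ htop).IsFiniteType := by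
  intro k
  have := hA k
  have := hA (n - k)
  let F : (dualExt hJ htop).gr k →ₗ[ℚ] A.gr k × Module.Dual ℚ (A.gr (n - k)) :=
    ((dualExtFst hJ htop).restrictGr k).prod
      ((A.gr (n - k)).subtype.dualMap ∘ₗ (A.total J).dualAnnihilator.subtype ∘ₗ
        (dualModule hJ htop).extSndₗ ∘ₗ ((dualExt hJ htop).gr k).subtype)
  refine FiniteDimensional.of_injective F ?_
  rw [injective_iff_map_eq_zero]
  rintro ⟨x, hx⟩ h
  obtain ⟨a, f, rfl⟩ := exists_dualExtMk x
  obtain ⟨h1, h2⟩ := Prod.ext_iff.1 h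
  have ha : a = 0 := congrArg Subtype.val h1
  have hf : f = 0 := eq_zero_of_mem_dualGr hx.2 fun i hi y hy => by
    obtain rfl : i = n - k := by omega
    exact LinearMap.congr_fun h2 ⟨y, hy⟩
  apply Subtype.ext
  change dualExtMk hJ htop a f = 0
  rw [ha, hf]
  rfl

end DualExt

/-! ### Poincaré duality models -/

/-- For n ≥ 5 the degree n - 1 is at least ⌊n/2⌋ + 2, where J is everything. For n = 3 and n = 4 the
requirement is h = 0 in degree n - 1: either h lands in A¹ = 0, or h x = h d h x with d zero on A².
-/
theorem gr_le_lagr_of_add_one_eq {A : CDGA.{u}} (c : A.Contraction) {n : ℕ} (hn : 3 ≤ n)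
    (hA : A.IsOneConnected) (hA2 : n = 4 → ∀ x ∈ A.gr 2, A.d x = 0) (i : ℕ) (hi : i + 1 = n) :
    A.gr i ≤ lagr c n i := by
  intro x hx
  rcases Nat.lt_or_ge i (n / 2 + 2) with h | h
  · refine mem_lagr_of_h_eq_zero c (by omega) hx ?_
    rw [← c.h_d_h]
    obtain rfl | rfl : i = 2 ∨ i = 3 := by omega
    · have h1 := c.h_mem 1 x hx
      rw [hA.2, Submodule.mem_bot] at h1
      rw [h1, map_zero, map_zero]
    · rw [hA2 (by omega) _ (c.h_mem 2 x hx), map_zero]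
  · rwa [lagr_of_large c h]

/-- Pairing with the image of a cocycle z of A kills boundaries and orphans, so ε(x z) = 0 for every
such z, and duality in H(A) makes x exact. -/
theorem exists_primitive_of_mk_exact {A : CDGA.{u}} {n : ℕ} {J : ℕ → Submodule ℚ A.carrier}
    {hJ : A.IsDGIdeal J} {htop : ∀ k, n < k → A.gr k ≤ J k} {ε : A.carrier →ₗ[ℚ] ℚ}
    (hε : IsOrientation n ε) {x : A.carrier} (hx : A.d x = 0) {y : (dualExt hJ htop).carrier}
    (h : (dualExt hJ htop).d y - (dualExtInl hJ htop).toAlgHom x ∈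
      (dualExt hJ htop).total (orphans (dualExtForm hJ htop ε))) : ∃ z, A.d z = x := by
  refine hε.exact x hx fun z hz => ?_
  have h1 := orthogonal_of_mem_total_orphans h ((dualExtInl hJ htop).toAlgHom z)
  rw [sub_mul, map_sub, ← d_mul_cocycle _ _ _ (by rw [← Hom.map_d, hz, map_zero]),
    dualExtForm_d hε.map_d, zero_sub, neg_eq_zero, ← map_mul] at h1
  rw [dualExtInl_apply, dualExtForm_mk] at h1
  simpa using h1

theorem exists_poincareDuality_model {A : CDGA.{u}} {n : ℕ} (hn : 3 ≤ n) (hA : A.IsOneConnected)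
    (hfin : A.IsFiniteType) (hA2 : n = 4 → ∀ x ∈ A.gr 2, A.d x = 0) {ε : A.carrier →ₗ[ℚ] ℚ}
    (hε : IsOrientation n ε) : ∃ (P : CDGA.{u}) (α : Hom A P), α.IsQuasiIso ∧ P.IsOneConnected ∧
      P.IsPoincareDuality n ∧ ∀ (B : CDGA.{u}) (φ : Hom A B), B.VanishesFrom ((n : ℚ) / 2 - 1) →
        ∃ φ' : Hom P B, φ'.comp α = φ := by
  obtain ⟨c⟩ := A.exists_contraction
  have hJ := lagr_isDGIdeal c (n := n) hA
  have hbig : ∀ k, n / 2 + 2 ≤ k → A.gr k ≤ lagr c n k := fun k hk => (lagr_of_large c hk).ge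
  have htop : ∀ k, n < k → A.gr k ≤ lagr c n k := fun k hk => hbig k (by omega)
  have hgr0 : A.gr n ≤ lagr c n n := by
    rcases Nat.lt_or_ge n (n / 2 + 2) with h | h
    · omega
    · exact hbig n h
  have hO := orphans_isDGIdeal (dualExtForm_d (hJ := hJ) (htop := htop) hε.map_d)
  have hα : (hO.proj.comp (dualExtInl hJ htop)).IsQuasiIso := by
    refine Hom.isQuasiIso_of_homogeneous _ ?_ ?_
    · rintro i x - hdx ⟨w, hw⟩
      obtain ⟨w, rfl⟩ := hO.proj_surjective w
      rw [← hO.proj.map_d] at hw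
      refine exists_primitive_of_mk_exact hε hdx (y := w) (hO.proj_eq_zero.1 ?_)
      rw [map_sub, hw]
      exact sub_self _
    · intro k y hy hdy
      obtain ⟨e, he, rfl⟩ := hO.proj_surjective.exists_mem hy
      obtain ⟨a, f, rfl⟩ := exists_dualExtMk e
      rw [← hO.proj.map_d, hO.proj_eq_zero] at hdy
      have h1 := mem_of_mem_total hdy ((dualExt hJ htop).d_mem k _ he)
      rw [d_dualExtMk, mem_orphans_dualExt] at h1
      obtain ⟨h1, -, h2⟩ := h1
      rw [dualExtMk_mem] at he
      -- The correction yields (a, f) = (a - z, 0) + d (0, g) + (z, -ε(z ·)), whose last term is an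
      -- orphan. So the class comes from a - z.
      obtain ⟨z, hz, hdz, g, hgJ, hg⟩ := hε.exists_lagr_correction c he.1 f.1
        (fun x hx => dualQuot_apply_eq_zero f hx) he.2 h1 h2
      refine ⟨a - z, by rw [map_sub, hdz, sub_self], hO.proj.toAlgHom
        (dualExtMk hJ htop 0 ⟨g, (Submodule.mem_dualAnnihilator g).2 hgJ⟩), ?_⟩
      change _ = hO.proj.toAlgHom _ - hO.proj.toAlgHom ((dualExtInl hJ htop).toAlgHom (a - z))
      rw [← hO.proj.map_d, ← map_sub, ← sub_eq_zero, ← map_sub, hO.proj_eq_zero, dualExtInl_apply,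
        d_dualExtMk, dualExtMk_sub, dualExtMk_sub, map_zero, sub_sub_cancel, sub_zero, zero_sub]
      have hgf : ∀ b, (dualD n hJ ⟨g, (Submodule.mem_dualAnnihilator g).2 hgJ⟩ - f).1 b =
          ε (z * b) := fun b => sub_eq_iff_eq_add.2 (hg b).symm
      refine mem_total_of_mem hO.le (k := k) (mem_orphans_dualExt.2 ⟨neg_mem hz, ?_, fun b => ?_⟩)
      · intro i hi b hb
        rw [hgf, hε.degree (k + i) (by omega) _ (A.mul_mem_gr (lagr_le c k hz) hb)]
      · rw [hgf, neg_mul, map_neg, neg_add_cancel]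
  have hE := dualExt_isOneConnected (hJ := hJ) (htop := htop) hA hgr0
    (gr_le_lagr_of_add_one_eq c hn hA hA2)
  -- If the form were zero then so would be ε, and duality would make 1 a boundary.
  have hne : ∃ x, dualExtForm hJ htop ε x ≠ 0 := by
    by_contra! h
    obtain ⟨y, hy⟩ := hε.exact 1 A.d_one fun z _ => by
      have h1 := h (dualExtMk hJ htop z 0)
      rw [dualExtForm_mk] at h1
      simpa using h1
    exact hA.1.one_ne_zero (eq_zero_of_d_eq_of_mem_zero A.one_mem_gr hy)
  obtain ⟨hP, hP'⟩ := orphans_quot_isPoincareDuality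
    (fun i hi x hx => dualExtForm_degree hε.degree hi hx) (dualExtForm_d hε.map_d) hE
    (dualExt_isFiniteType hfin) hne
  refine ⟨_, _, hα, hP, hP', fun B φ hB => ?_⟩
  -- The first component of an orphan lies in J, which is concentrated in degrees k ≥ ⌊n/2⌋, and B
  -- vanishes there.
  obtain ⟨φ', hφ'⟩ := hO.exists_desc (φ.comp (dualExtFst hJ htop)) fun k x hx => by
    obtain ⟨a, f, rfl⟩ := exists_dualExtMk x
    rw [mem_orphans_dualExt] at hx
    change φ.toAlgHom a = 0
    by_cases hk : k < n / 2
    · have h1 := hx.1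
      rw [lagr_of_lt c hk, Submodule.mem_bot] at h1
      rw [h1, map_zero]
    · have h1 := φ.map_gr k a (lagr_le c k hx.1)
      have h2 : (n : ℚ) ≤ 2 * k + 1 := by exact_mod_cast (by omega : n ≤ 2 * k + 1)
      rw [hB k (by linarith)] at h1
      exact (Submodule.mem_bot ℚ).1 h1
  refine ⟨φ', ?_⟩
  ext x
  exact congrArg (fun g : Hom _ B => g.toAlgHom ((dualExtInl hJ htop).toAlgHom x)) hφ'

/-! ### Equivalences of morphisms -/

theorem Hom.EquivalentOver.equivalent {A A' B : CDGA.{u}} {f : Hom A B} {g : Hom A' B}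
    (h : f.EquivalentOver g) : f.Equivalent g := by
  have key : ∀ f g : Over B, Relation.EqvGen Over.Step f g →
      Relation.EqvGen Arrow.Step ⟨f.src, B, f.hom⟩ ⟨g.src, B, g.hom⟩ := by
    intro f g h
    induction h with
    | rel f g h =>
      obtain ⟨α, hα, hc⟩ := h
      exact .rel _ _ ⟨α, Hom.id B, hα, Hom.isQuasiIso_id B, hc.symm⟩
    | refl f => exact .refl _
    | symm f g _ ih => exact .symm _ _ ih
    | trans f g k _ _ ih₁ ih₂ => exact .trans _ _ _ ih₁ ih₂
  exact key _ _ h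

theorem Hom.IsQuasiIso.cohomology_isOneConnected {A B : CDGA.{u}} {f : Hom A B}
    (hf : f.IsQuasiIso) (h : B.cohomology.IsOneConnected) : A.cohomology.IsOneConnected :=
  .of_injective f.cohomologyMap hf.1 h

theorem Hom.IsQuasiIso.cohomology_isPoincareDuality {A B : CDGA.{u}} {f : Hom A B}
    (hf : f.IsQuasiIso) {n : ℕ} (h : B.cohomology.IsOneConnected)
    (hd : B.cohomology.IsPoincareDuality n) : A.cohomology.IsPoincareDuality n :=
  .of_bijective f.cohomologyMap hf (hf.cohomology_isOneConnected h).1 hd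

/-! ### Surjections from Poincaré duality CDGAs -/

/-- A surjective morphism has linear sections, which are normalised in degree `2`. -/
theorem Hom.Surjective.exists_section {X Q : CDGA.{u}} {φ : Hom X Q} (hφ : φ.Surjective)
    (c : X.Contraction) (hQ : Q.gr 1 = ⊥) (k : ℕ) : ∃ s : Q.gr k →ₗ[ℚ] X.carrier,
      (∀ q, s q ∈ X.gr k) ∧ (∀ q, φ.toAlgHom (s q) = q) ∧ (k = 2 → ∀ q, c.h (s q) = 0) := by
  have hsurj : Function.Surjective (φ.restrictGr k) := by
    rintro ⟨q, hq⟩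
    obtain ⟨x, hx, rfl⟩ := hφ.exists_mem hq
    exact ⟨⟨x, hx⟩, rfl⟩
  obtain ⟨s, hs⟩ := (φ.restrictGr k).exists_rightInverse_of_surjective
    (LinearMap.range_eq_top.2 hsurj)
  have hs' : ∀ q, φ.toAlgHom (s q) = q := fun q => congrArg Subtype.val (LinearMap.congr_fun hs q)
  by_cases hk : k = 2
  · subst hk
    -- The correction does not change the image in Q, because φ (h (s q)) lies in Q¹ = 0.
    refine ⟨(LinearMap.id - X.d ∘ₗ c.h) ∘ₗ (X.gr 2).subtype ∘ₗ s, fun q => ?_, fun q => ?_,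
      fun _ q => ?_⟩
    · exact sub_mem (s q).2 (c.d_h_mem (s q).2)
    · change φ.toAlgHom (s q - X.d (c.h (s q))) = q
      have h1 := φ.map_gr 1 _ (c.h_mem 1 _ (s q).2)
      rw [hQ, Submodule.mem_bot] at h1
      rw [map_sub, φ.map_d, h1, map_zero, sub_zero, hs']
    · change c.h (s q - X.d (c.h (s q))) = 0
      rw [map_sub, c.h_d_h, sub_self]
  · exact ⟨(X.gr k).subtype ∘ₗ s, fun q => (s q).2, hs', fun h => absurd h hk⟩

/-- Lifts of Q in degrees ≥ 2 are put into the finite-type model F. Since F → Q factors through P,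
the map from P is then onto in those degrees as well; below them Q has only scalars. -/
theorem exists_poincareDuality_of_surjective {n : ℕ} (hn : 3 ≤ n) {X Q : CDGA.{u}} {φ : Hom X Q}
    (hφ : φ.Surjective) (hX : X.cohomology.IsOneConnected)
    (hXd : X.cohomology.IsPoincareDuality n) (hQ : Q.IsOneConnected) (hQfin : Q.IsFiniteType)
    (hQv : Q.VanishesFrom ((n : ℚ) / 2 - 1)) : ∃ (P : CDGA.{u}) (φ' : Hom P Q),
      φ.EquivalentOver φ' ∧ φ'.Surjective ∧ P.IsOneConnected ∧ P.IsPoincareDuality n := by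
  obtain ⟨c⟩ := X.exists_contraction
  choose s hs hφs hs2 using hφ.exists_section c hQ.2
  have hbot : ∀ k, Q.gr k = ⊥ → LinearMap.range (s k) = ⊥ := by
    intro k hk
    rw [LinearMap.range_eq_bot]
    ext ⟨q, hq⟩
    have : (⟨q, hq⟩ : Q.gr k) = 0 := by
      rw [hk, Submodule.mem_bot] at hq
      exact Subtype.ext hq
    rw [this, map_zero, map_zero]
  obtain ⟨F, i, hi, hF, hFfin, hFs, hF2⟩ := exists_finiteType_sub c (S := fun k => LinearMap.range (s k))
    hX hXd.2.1 (fun k => by rintro _ ⟨q, rfl⟩; exact hs k q)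
    (fun k => by
      have := hQfin k
      change (LinearMap.range (s k)).FG
      rw [LinearMap.range_eq_map]
      exact Module.Finite.fg_top.map _)
    (by rintro _ ⟨q, rfl⟩; exact hs2 2 rfl q)
  obtain ⟨ε, hε⟩ := exists_orientation (hi.cohomology_isPoincareDuality hX hXd)
  -- For n = 4 the target Q vanishes from degree 1 on, so no lifts are prescribed in degrees 2 and 3
  -- and d is zero on F².
  obtain ⟨P, α, hα, hP, hPd, hfac⟩ := exists_poincareDuality_model hn hF hFfin
    (fun hn4 => hF2 (hbot 2 (hQv 2 (by subst hn4; norm_num)))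
      (hbot 3 (hQv 3 (by subst hn4; norm_num)))) hε
  obtain ⟨φ', hφ'⟩ := hfac Q (φ.comp i) hQv
  have hsurj : ∀ q, ∃ x, φ'.toAlgHom x = q := by
    refine graded_induction Q.gr ⟨0, map_zero _⟩ ?_ ?_
    · rintro _ _ ⟨x, rfl⟩ ⟨y, rfl⟩
      exact ⟨x + y, map_add _ x y⟩
    · rintro (_ | _ | k) q hq
      · obtain ⟨r, rfl⟩ := hQ.1.exists_smul_one hq
        exact ⟨r • 1, by rw [map_smul, map_one]⟩
      · rw [zero_add, hQ.2, Submodule.mem_bot] at hq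
        exact ⟨0, by rw [hq, map_zero]⟩
      · obtain ⟨y, -, hy⟩ := hFs (k + 2) (by omega) _ ⟨⟨q, hq⟩, rfl⟩
        refine ⟨α.toAlgHom y, ?_⟩
        have h1 := congrArg (fun g : Hom F Q => g.toAlgHom y) hφ'
        refine h1.trans ((congrArg φ.toAlgHom hy).trans (hφs (k + 2) _))
  exact ⟨P, φ', .trans _ ⟨F, φ.comp i⟩ _ (.symm _ _ (.rel _ _ ⟨i, hi, rfl⟩))
    (.rel _ _ ⟨α, hα, hφ'⟩), hsurj, hP, hPd⟩

/-! ### Truncation -/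

/-- A `1`-connected CDGA whose cohomology vanishes in high degrees is quasi-isomorphic to a
quotient vanishing in these degrees. -/
theorem exists_truncation {n : ℕ} (hn : 3 ≤ n) {B : CDGA.{u}} (hB : B.IsOneConnected)
    (hBv : B.cohomology.VanishesFrom ((n : ℚ) / 2 - 1)) : ∃ (Q : CDGA.{u}) (p : Hom B Q),
      p.IsQuasiIso ∧ p.Surjective ∧ Q.IsOneConnected ∧ Q.VanishesFrom ((n : ℚ) / 2 - 1) := by
  obtain ⟨c⟩ := B.exists_contraction
  -- If m is the least degree ≥ n/2 - 1, then W is everything from degree m on and the image of h d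
  -- in degree m - 1. The latter is a complement of the cocycles, and this makes W acyclic.
  let W : ℕ → Submodule ℚ B.carrier := fun k =>
    if n ≤ 2 * k + 2 then B.gr k
    else if n ≤ 2 * k + 4 then B.gr k ⊓ LinearMap.ker (LinearMap.id - c.h ∘ₗ B.d)
    else ⊥
  have hW1 : ∀ k, n ≤ 2 * k + 2 → W k = B.gr k := fun k hk => if_pos hk
  have hW2 : ∀ k, ¬ n ≤ 2 * k + 2 → ∀ x ∈ W k, c.h (B.d x) = x := by
    intro k hk x hx
    simp only [W] at hx
    rw [if_neg hk] at hx
    split_ifs at hx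
    · exact (sub_eq_zero.1 hx.2).symm
    · rw [(Submodule.mem_bot ℚ).1 hx, map_zero, map_zero]
  have hle : ∀ k, W k ≤ B.gr k := by
    intro k
    simp only [W]
    split_ifs
    · exact le_rfl
    · exact inf_le_left
    · exact bot_le
  have hW : B.IsDGIdeal W := by
    refine isDGIdeal_of_isOneConnected hB hle ?_ ?_
    · intro k x hx
      by_cases hk : n ≤ 2 * k + 4
      · rw [hW1 _ (by omega)]
        exact B.d_mem k x (hle k hx)
      · simp only [W] at hx
        rw [if_neg (by omega), if_neg hk, Submodule.mem_bot] at hx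
        rw [hx, map_zero]
        exact zero_mem _
    · intro k
      by_cases hk : n ≤ 2 * k + 4
      · exact Or.inr fun i hi => (hW1 i (by omega)).ge
      · exact Or.inl (by simp only [W]; rw [if_neg (by omega), if_neg hk])
  have hvan : ∀ k : ℕ, (n : ℚ) / 2 - 1 ≤ k → n ≤ 2 * k + 2 := by
    intro k hk
    have : (n : ℚ) ≤ 2 * k + 2 := by linarith
    exact_mod_cast this
  refine ⟨hW.quot, hW.proj, hW.proj_isQuasiIso ?_, hW.proj_surjective,
    ⟨isConnected_of_exists_smul_one ?_ ?_, ?_⟩, ?_⟩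
  · intro k x hx hdx
    by_cases hk : n ≤ 2 * k + 2
    · have h2 : (n : ℚ) ≤ 2 * k + 2 := by exact_mod_cast hk
      obtain ⟨w, hw⟩ := exact_of_cohomologyGr_eq_bot (hBv k (by linarith)) (hle k hx) hdx
      refine ⟨c.h x, ?_, c.d_h_eq hw⟩
      obtain ⟨k, rfl⟩ : ∃ l, k = l + 1 := ⟨k - 1, by omega⟩
      refine mem_total_of_mem hle (k := k) ?_
      have h3 := c.h_mem k x (hle _ hx)
      by_cases hk' : n ≤ 2 * k + 2
      · rwa [hW1 k hk']
      · simp only [W]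
        rw [if_neg hk', if_pos (by omega)]
        exact ⟨h3, sub_eq_zero.2 (c.h_d_h x).symm⟩
    · refine ⟨0, zero_mem _, ?_⟩
      rw [← hW2 k hk x hx, hdx, map_zero, map_zero]
  · intro h
    rw [← map_one hW.proj.toAlgHom, hW.proj_eq_zero] at h
    have h1 := hW2 0 (by omega) 1 (mem_of_mem_total h B.one_mem_gr)
    rw [B.d_one, map_zero] at h1
    exact hB.1.one_ne_zero h1.symm
  · rintro _ ⟨x, hx, rfl⟩
    obtain ⟨r, rfl⟩ := hB.1.exists_smul_one hx
    exact ⟨r, map_smul hW.proj.toAlgHom r 1⟩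
  · rw [eq_bot_iff]
    rintro _ ⟨x, hx, rfl⟩
    rw [hB.2] at hx
    rw [(Submodule.mem_bot ℚ).1 hx, map_zero]
    exact zero_mem _
  · intro k hk
    rw [eq_bot_iff]
    rintro _ ⟨x, hx, rfl⟩
    refine hW.proj_eq_zero.2 (mem_total_of_mem hle (k := k) ?_)
    rwa [hW1 k (hvan k hk)]

end CDGA

/-! ### Assembly of the two statements -/

theorem mainTheorem3 (n : ℕ) (A B : CDGA.{u}) (ψ : CDGA.Hom A B)
    (hA : A.cohomology.IsOneConnected)
    (hA_dual : A.cohomology.IsPoincareDuality n)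
    (hB : B.cohomology.IsOneConnected)
    (hB_fin : B.cohomology.IsFiniteType)
    (hB_van : B.cohomology.VanishesFrom ((n : ℚ) / 2 - 1))
    (hψ : ∀ y ∈ B.cohomology.gr 2, ∃ x ∈ A.cohomology.gr 2, ψ.cohomologyMap.toAlgHom x = y) :
    (∃ (P Q : CDGA.{u}) (φ : CDGA.Hom P Q),
      ψ.Equivalent φ ∧ φ.Surjective ∧
      P.IsOneConnected ∧ P.IsPoincareDuality n ∧
      Q.IsOneConnected ∧ Q.VanishesFrom ((n : ℚ) / 2 - 1)) ∧
    (B.IsOneConnected → B.IsFiniteType → B.VanishesFrom ((n : ℚ) / 2 - 1) →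
      ∃ (P : CDGA.{u}) (φ : CDGA.Hom P B),
        ψ.Equivalent φ ∧ ψ.EquivalentOver φ ∧ φ.Surjective ∧
        P.IsOneConnected ∧ P.IsPoincareDuality n) := by
  -- Degree 0 must escape the vanishing range, since H⁰(B) contains 1 ≠ 0.
  have hn : 3 ≤ n := by
    by_contra! h
    have h2 : (n : ℚ) ≤ 2 := by exact_mod_cast (by omega : n ≤ 2)
    have h0 := B.cohomology.one_mem_gr
    rw [hB_van 0 (by push_cast; linarith), Submodule.mem_bot] at h0
    exact hB.1.one_ne_zero h0
  obtain ⟨X, i, r, φ, hi, hr, hφ, hφi⟩ := CDGA.exists_surjective_factorization ψ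
  have hX := hr.cohomology_isOneConnected hA
  have hXd := hr.cohomology_isPoincareDuality hA hA_dual
  have hψφ : ψ.EquivalentOver φ := .rel _ _ ⟨i, hi, hφi⟩
  constructor
  · obtain ⟨c⟩ := B.exists_contraction
    obtain ⟨B', j, hj, hB', hB'fin, -, -⟩ := CDGA.exists_finiteType_sub c (S := fun _ => ⊥) hB
      hB_fin (fun _ => bot_le) (fun _ => Submodule.fg_bot) (fun x hx => by
        rw [(Submodule.mem_bot ℚ).1 hx, map_zero])
    obtain ⟨Q, p, hp, hps, hQ, hQv⟩ := CDGA.exists_truncation hn hB'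
      (hB_van.of_injective j.cohomologyMap hj.1)
    -- Base change of φ along j keeps it surjective, now onto B', and the new source is still
    -- quasi-isomorphic to X because φ is onto. The zigzag for ψ then runs through φ, its base
    -- change, and the composite with B' → Q.
    have hfst : (CDGA.pullbackFst φ j).IsQuasiIso := by
      refine CDGA.pullbackFst_isQuasiIso φ j hj fun b => ?_
      obtain ⟨x, rfl⟩ := hφ b
      exact ⟨x, 0, by rw [map_zero, sub_zero]⟩
    have hsurj : (p.comp (CDGA.pullbackSnd φ j)).Surjective := by
      intro q
      obtain ⟨b, rfl⟩ := hps q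
      obtain ⟨x, hx⟩ := hφ (j.toAlgHom b)
      exact ⟨CDGA.pullbackPair φ j x b hx, rfl⟩
    obtain ⟨P, φ', hφ', hφ's, hP, hPd⟩ := CDGA.exists_poincareDuality_of_surjective hn hsurj
      (hfst.cohomology_isOneConnected hX) (hfst.cohomology_isPoincareDuality hX hXd) hQ
      (hB'fin.of_surjective p hps) hQv
    refine ⟨P, Q, φ', ?_, hφ's, hP, hPd, hQ, hQv⟩
    have h1 : (CDGA.pullbackSnd φ j).Equivalent φ :=
      .rel _ _ ⟨CDGA.pullbackFst φ j, j, hfst, hj, (CDGA.pullback_comm φ j).symm⟩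
    have h2 : (CDGA.pullbackSnd φ j).Equivalent (p.comp (CDGA.pullbackSnd φ j)) :=
      .rel _ _ ⟨CDGA.Hom.id _, p, CDGA.Hom.isQuasiIso_id _, hp, rfl⟩
    exact .trans _ _ _ hψφ.equivalent (.trans _ _ _ (.symm _ _ h1)
      (.trans _ _ _ h2 hφ'.equivalent))
  · intro hB1 hBf hBv
    obtain ⟨P, φ', hφ', hφ's, hP, hPd⟩ := CDGA.exists_poincareDuality_of_surjective hn hφ hX hXd
      hB1 hBf hBv
    have h : ψ.EquivalentOver φ' := .trans _ _ _ hψφ hφ'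
    exact ⟨P, φ', h.equivalent, h, hφ's, hP, hPd⟩
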